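/- **Setting.** Let $p(x,y)\ge 0$ be a probability density on $\mathbb R^m\times\{\pm1\}$ which is Lipschitz in $x$ and satisfies $p(x,y)=0$ for $\|x\|\ge R$. Let $\mathcal D=\{(x_i,y_i)\}_{i=1}^N$ be $N$ independent samples from $p$. For $\lambda\ge 0$, $\alpha>0$ and $\psi(u)=\frac12\big(u+\sqrt{1+u^2}\big)$ put $$\widehat f_\alpha(w;\mathcal D)=\tfrac12\lambda\|w\|^2+\frac1N\sum_{i=1}^N\alpha\,\psi\!\Big(\frac{1-y_iw^Tx_i}{\alpha}\Big).$$ Assume that either $\lambda>0$, or some minimizer $w^*$ of $w\mapsto\frac12\lambda\|w\|^2+\sum_{y=\pm1}\int p(x,y)\max(0,1-y\,w^Tx)\,dx$ satisfies $\sum_{y=\pm1}\int_{\{x:\,y=x^Tw^*\}}p(x,y)\,dS(x)>0$. At a point $w$ and smoothing parameter $\alpha$ let $g=\nabla\widehat f_\alpha(w;\mathcal D)$, $H=\operatorname{Hess}\widehat f_\alpha(w;\mathcal D)$, and let $d=-H^{-1}g$ be the full Newton step. For $0<\eta<1$ the *stopping test* holds at $(w,\alpha)$ if $H$ is invertible and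 $|d^Tg|<\eta\alpha$. A *guarded Newton step* replaces $w$ by $w+sd$, where $s$ is the first of $1,\frac12,\frac14,\dots$ with $\widehat f_\alpha(w+sd)\le\widehat f_\alpha(w)+c_1s\,d^Tg$; it is successful if $s\ge s_{\min}$. Fix $0<c_1<\frac12$, $0<s_{\min}\le1$, a reduction factor $0<\beta<1$, and $K\in\mathbb R$. **Lemma.** 1. Let $0<\eta<1$. For every $\varepsilon>0$ there is $C>0$ such that for all $N$ and $\alpha>0$ with $\alpha\le 1/C$ and $N\alpha\ge C$ (that is, $1\gg\alpha\gg1/N$): (a) for every fixed $w\in\mathbb R^m$, the probability that the stopping test holds at $(w,\alpha)$ (so that the algorithm reduces $\alpha\leftarrow\beta\alpha$ at $w$) while the guarded Newton method with smoothing parameter $\beta\alpha$, started at $w$, does not meet the stopping test at $\beta\alpha$ after at most $C(1+\log\log(1/\alpha))$ successful guarded steps, is at most $\varepsilon$; (b) with probability at least $1-\varepsilon$, simultaneously for all $w$ (possibly depending on $\mathcal D$) with $\|\nabla\widehat f_\alpha(w;\mathcal D)\|\le K\alpha$, the guarded Newton method with smoothing parameter $\beta\alpha$, started at $w$, meets the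 stopping test at $\beta\alpha$ after at most $C(1+\log\log(1/\alpha))$ successful guarded steps. 2. For every $\varepsilon>0$ there is $C>0$, not depending on $\eta$, such that for every $0<\eta<1$ there is $\alpha_0>0$ such that for all $N$ and $0<\alpha\le\alpha_0$ with $N\eta^2\alpha\ge C$ (that is, $\eta^2\alpha\gg1/N$), a single full Newton step with no line search suffices after the reduction $\alpha\leftarrow\beta\alpha$: with $d$ the full Newton step at $(w,\beta\alpha)$, which is then defined, the stopping test holds at $(w+d,\beta\alpha)$; moreover, if it does not already hold at $(w,\beta\alpha)$, then the step length $s=1$ satisfies the Armijo condition. This holds in the same two senses: (a) for every fixed $w$, the probability that the stopping test holds at $(w,\alpha)$ and the assertion fails is at most $\varepsilon$; (b) with probability at least $1-\varepsilon$ the assertion holds simultaneously for all $w$ with $\|\nabla\widehat f_\alpha(w;\mathcal D)\|\le K\alpha$. Here $C$ and $\alpha_0$ may depend on $m,p,R,\lambda,\beta,c_1,s_{\min},K,\varepsilon$, and in part 1 $C$ (in part 2 $\alpha_0$, but not $C$) also on $\eta$; they do not depend on $N$, $\alpha$ or $w$. -/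

import Mathlib

open MeasureTheory
open scoped ENNReal

noncomputable section

namespace SmoothSVM

/-- Feature and weight vectors, with the Euclidean norm. -/
abbrev Vec (m : ℕ) : Type := EuclideanSpace ℝ (Fin m)

/-- A dataset of `N` points `(x, y)`; the labels `y` are `1` or `-1` almost surely under the
sampling law `dataLaw` below. -/
abbrev Dataset (m N : ℕ) : Type := Fin N → Vec m × ℝ

/-- The two labels `1` and `-1`. -/
def labels : Finset ℝ := {1, -1}

/-! ### The distribution of the data -/

/-- `p` is a probability density on `ℝᵐ × {1, -1}` which is Lipschitz in `x` and vanishes for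
`‖x‖ ≥ R`. -/
structure IsDataDensity {m : ℕ} (p : Vec m → ℝ → ℝ) (R : ℝ) : Prop where
  nonneg : ∀ y ∈ labels, ∀ x, 0 ≤ p x y
  lipschitz : ∃ L : NNReal, ∀ y ∈ labels, LipschitzWith L (fun x => p x y)
  support : ∀ y ∈ labels, ∀ x, R ≤ ‖x‖ → p x y = 0
  total : ∑ y ∈ labels, ∫ x, p x y = 1

/-- The law on `ℝᵐ × {1, -1}` of one data point with density `p`. -/
def dataLaw {m : ℕ} (p : Vec m → ℝ → ℝ) : Measure (Vec m × ℝ) :=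
  ∑ y ∈ labels,
    ((volume : Measure (Vec m)).withDensity (fun x => ENNReal.ofReal (p x y))).map
      (fun x => (x, y))

/-- The law of a dataset of `N` independent data points with density `p`. -/
def sampleLaw {m : ℕ} (p : Vec m → ℝ → ℝ) (N : ℕ) : Measure (Dataset m N) :=
  Measure.pi (fun _ : Fin N => dataLaw p)

/-- The expectation of the unsmoothed regularized hinge loss. -/
def expectedObjective {m : ℕ} (p : Vec m → ℝ → ℝ) (lam : ℝ) (w : Vec m) : ℝ :=
  lam / 2 * ‖w‖ ^ 2 + ∑ y ∈ labels, ∫ x, p x y * max 0 (1 - y * inner ℝ w x)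

/-- The mass, with respect to `(m-1)`-dimensional surface measure, that the density puts on the
margin hyperplanes `{x | wᵀ x = y}`. (Only its positivity is used, so the normalization of the
Hausdorff measure plays no role.) -/
def marginMass {m : ℕ} (p : Vec m → ℝ → ℝ) (w : Vec m) : ℝ≥0∞ :=
  ∑ y ∈ labels, ∫⁻ x in {x : Vec m | y = inner ℝ w x}, ENNReal.ofReal (p x y)
    ∂(Measure.hausdorffMeasure ((m : ℝ) - 1))

/-- Either there is a quadratic regularization, or some minimizer of the expected objective has
positive density on its margin hyperplanes. -/
def Nondegenerate {m : ℕ} (p : Vec m → ℝ → ℝ) (lam : ℝ) : Prop :=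
  0 < lam ∨ ∃ w : Vec m, (∀ v, expectedObjective p lam w ≤ expectedObjective p lam v) ∧
    0 < marginMass p w

/-! ### The smoothed objective function -/

/-- `ψ(u) = (u + √(1 + u²)) / 2`. -/
def psi (u : ℝ) : ℝ := (u + Real.sqrt (1 + u ^ 2)) / 2

/-- The smoothed hinge loss `α ψ((1 - y wᵀx) / α)`. -/
def smoothedHinge {m : ℕ} (α : ℝ) (x : Vec m) (y : ℝ) (w : Vec m) : ℝ :=
  α * psi ((1 - y * inner ℝ w x) / α)

/-- The smoothed objective `(λ/2) ‖w‖² + (1/N) ∑ᵢ α ψ((1 - yᵢ wᵀxᵢ) / α)`. -/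
def objective {m N : ℕ} (lam α : ℝ) (D : Dataset m N) (w : Vec m) : ℝ :=
  lam / 2 * ‖w‖ ^ 2 + (1 / (N : ℝ)) * ∑ i, smoothedHinge α (D i).1 (D i).2 w

/-- The gradient of the smoothed objective. -/
def grad {m N : ℕ} (lam α : ℝ) (D : Dataset m N) (w : Vec m) : Vec m :=
  gradient (objective lam α D) w

/-- The Hessian of the smoothed objective, as a linear map. -/
def hess {m N : ℕ} (lam α : ℝ) (D : Dataset m N) (w : Vec m) : Vec m →L[ℝ] Vec m :=
  fderiv ℝ (grad lam α D) w

/-! ### The guarded Newton method -/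

/-- The full Newton step `d = -H⁻¹ g`. -/
def newtonDir {m N : ℕ} (lam α : ℝ) (D : Dataset m N) (w : Vec m) : Vec m :=
  -((hess lam α D w).inverse (grad lam α D w))

/-- The stopping test at smoothing parameter `α`: the Newton step `d` is defined, and
`|dᵀ g| < η α`. -/
def StopTest {m N : ℕ} (lam η α : ℝ) (D : Dataset m N) (w : Vec m) : Prop :=
  (hess lam α D w).IsInvertible ∧
    |(inner ℝ (newtonDir lam α D w) (grad lam α D w) : ℝ)| < η * α

/-- The Armijo sufficient decrease condition for the step length `s` along the Newton step. -/
def Armijo {m N : ℕ} (lam c₁ α : ℝ) (D : Dataset m N) (w : Vec m) (s : ℝ) : Prop :=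
  objective lam α D (w + s • newtonDir lam α D w) ≤
    objective lam α D w + c₁ * s * inner ℝ (newtonDir lam α D w) (grad lam α D w)

/-- One guarded Newton step from `w` to `w'`: starting from the step length `1`, the step length
is halved until the Armijo condition holds; the line search must succeed with a step length
that is not below `smin`. -/
def GuardedStep {m N : ℕ} (lam c₁ smin α : ℝ) (D : Dataset m N) (w w' : Vec m) : Prop :=
  (hess lam α D w).IsInvertible ∧
    ∃ j : ℕ, (∀ i < j, ¬ Armijo lam c₁ α D w ((1 / 2) ^ i)) ∧
      Armijo lam c₁ α D w ((1 / 2) ^ j) ∧ smin ≤ (1 / 2) ^ j ∧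
      w' = w + ((1 / 2 : ℝ) ^ j) • newtonDir lam α D w

/-- Started at `w`, the guarded Newton method at smoothing parameter `α` meets the stopping test
after at most `b` steps. -/
def StopsWithin {m N : ℕ} (lam c₁ smin η α : ℝ) (D : Dataset m N) (w : Vec m) (b : ℝ) : Prop :=
  ∃ k : ℕ, (k : ℝ) ≤ b ∧ ∃ v : ℕ → Vec m, v 0 = w ∧
    (∀ i < k, GuardedStep lam c₁ smin α D (v i) (v (i + 1))) ∧ StopTest lam η α D (v k)

/-- A single full Newton step at smoothing parameter `α`, without line search, is enough: the
stopping test holds after the step of length `1`, and, unless no step was needed at all,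
the Armijo condition accepts this step length at once. -/
def OneFullStepSuffices {m N : ℕ} (lam c₁ η α : ℝ) (D : Dataset m N) (w : Vec m) : Prop :=
  (hess lam α D w).IsInvertible ∧
    StopTest lam η α D (w + newtonDir lam α D w) ∧
    (¬ StopTest lam η α D w → Armijo lam c₁ α D w 1)

end SmoothSVM

end

open SmoothSVM

/-!
One full Newton step is already enough, so the bound on the number of guarded steps holds with a
single step, and both parts follow from the convergence of one full step
(`OneFullStepSuffices.stopsWithin`). After the reduction of `α` to `s = β α`, this convergence needs
a small gradient at `w`, a Hessian that is coercive at both ends of the step, and a gradient that is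
almost affine in between (`oneFullStepSuffices_of_increment`).

All errors caused by the smoothing are dominated by the fraction of the data within a distance of
order `s` of the margin hyperplanes, measured by the function `bump`. Its expectation is `O(s)` at
every `w`, since the density is bounded with compact support (`exists_integral_bump_le`). This
bounds the Hessian, and then the stopping test at `α` yields a gradient of order `√(η α)`, also
after the reduction (`norm_grad_reduced_le_of_stopTest`). Hence the Newton step has length
`r = O(√(η α))`, which is much larger than the smoothing width `s`. That the gradient is affine up to
`o(r)` on a ball of this radius has two reasons. The expected gradient has a Taylor expansion uniform
in `s`: a linear map that carries the margin hyperplanes of `w` to those of `w + v` moves the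
dependence on `w` from the concentrated kernel to the Lipschitz density
(`exists_integral_gradKer_taylor`). The fluctuations of the gradient increments are small uniformly
on the ball, by Chebyshev's inequality on a finite grid of mesh proportional to `r`
(`exists_measure_gradKer_increment_le`). The new gradient is then `o(√(η α))`, which passes the
stopping test if the Hessian is coercive there.

With `λ > 0` coercivity is trivial. Otherwise there are finitely many balls of positive density
centred on a margin hyperplane of the minimizer, such that every direction is seen by one of them
(`exists_isSpanning`), and a point with a small gradient is close to the minimizer
(`exists_measure_localization_le`). Enough data near the margin in each ball make the Hessian
coercive (`hess_ge_of_localBump`); at a fixed point this has high probability by Chebyshev's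
inequality. The end of the Newton step, however, depends on the data: it ranges over a ball of radius
of order `1 / √N`, and with only `N s ≥ C` the failure probability `O(1 / (N s))` at a point does not
allow a union bound over the grid of mesh `s` in this ball. Instead, the event that the step ends
near a given grid point `q` and that the Hessian is degenerate there is bounded by a product. The
step ends near `q` only if a sum of `N` independent vectors is small, and the contribution of one
half of the data spreads this sum out, whatever the other half is (`measure_bad_inter_sum_le`); the
degeneracy is witnessed by the other half alone. The sum over the grid points of these products is
again `O(1 / (N s))` (`exists_measure_newton_end_degenerate_le`).

For the statement uniform in `w` the gradient is of order `α` rather than `√(η α)`, which leaves much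
room. Put `α = a ^ 12`. Chernoff bounds and a grid of mesh `a ^ 11`, a scale at which the expected
number of data near the margin is at least of order `1 / a`, control the data near the margin for all
`w` in a ball at once. They give a Hessian of order at least `a ^ 3` and gradients that pass the
stopping test at both ends of the step (`oneFullStepSuffices_of_small_grad`).
-/

noncomputable section

namespace SmoothSVM

/-! ### Scalar estimates for the smoothed hinge -/

/-- The bump `1 / (1 + u²)`, which dominates all the errors caused by the smoothing. -/
def bump (u : ℝ) : ℝ := (1 + u ^ 2)⁻¹

/-- The derivative of `psi`. -/
def psiDeriv (u : ℝ) : ℝ := (1 + u / √(1 + u ^ 2)) / 2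

/-- The second derivative of `psi`. -/
def psiCurv (u : ℝ) : ℝ := (2 * ((1 + u ^ 2) * √(1 + u ^ 2)))⁻¹

lemma bump_pos (u : ℝ) : 0 < bump u := by unfold bump; positivity

lemma bump_le_one (u : ℝ) : bump u ≤ 1 := by
  unfold bump
  exact inv_le_one_of_one_le₀ (by nlinarith [sq_nonneg u])

lemma bump_sq_le (u : ℝ) : bump u ^ 2 ≤ bump u := by
  nlinarith [bump_pos u, bump_le_one u]

lemma sqrt_one_add_sq_pos (u : ℝ) : 0 < √(1 + u ^ 2) := by positivity

lemma one_le_sqrt_one_add_sq (u : ℝ) : 1 ≤ √(1 + u ^ 2) :=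
  Real.one_le_sqrt.2 (by nlinarith [sq_nonneg u])

lemma abs_lt_sqrt_one_add_sq (u : ℝ) : |u| < √(1 + u ^ 2) := by
  rw [← Real.sqrt_sq_eq_abs]
  exact Real.sqrt_lt_sqrt (sq_nonneg _) (by linarith)

lemma continuous_bump : Continuous bump := by
  unfold bump
  exact Continuous.inv₀ (by fun_prop) (fun u => by positivity)

lemma continuous_psiDeriv : Continuous psiDeriv := by
  unfold psiDeriv
  exact (continuous_const.add (continuous_id.div (by fun_prop)
    (fun u => (sqrt_one_add_sq_pos u).ne'))).div_const _

lemma continuous_psiCurv : Continuous psiCurv := by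
  unfold psiCurv
  exact Continuous.inv₀ (by fun_prop) (fun u => by positivity)

lemma hasDerivAt_sqrt_one_add_sq (u : ℝ) :
    HasDerivAt (fun u : ℝ => √(1 + u ^ 2)) (u / √(1 + u ^ 2)) u := by
  have h : HasDerivAt (fun u : ℝ => 1 + u ^ 2) (2 * u) u := by
    simpa using (hasDerivAt_pow 2 u).const_add 1
  convert h.sqrt (by positivity) using 1
  field_simp

lemma hasDerivAt_psi (u : ℝ) : HasDerivAt psi (psiDeriv u) u :=
  ((hasDerivAt_id u).add (hasDerivAt_sqrt_one_add_sq u)).div_const 2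

lemma hasDerivAt_psiDeriv (u : ℝ) : HasDerivAt psiDeriv (psiCurv u) u := by
  have h := (((hasDerivAt_id u).div (hasDerivAt_sqrt_one_add_sq u)
    (sqrt_one_add_sq_pos u).ne').const_add 1).div_const 2
  refine h.congr_deriv ?_
  have h1 : √(1 + u ^ 2) ^ 2 = 1 + u ^ 2 := Real.sq_sqrt (by positivity)
  have h2 := sqrt_one_add_sq_pos u
  unfold psiCurv
  simp only [id]
  rw [← h1]
  have h3 : √(√(1 + u ^ 2) ^ 2) = √(1 + u ^ 2) := Real.sqrt_sq h2.le
  rw [h3]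
  field_simp
  nlinarith

lemma psiCurv_nonneg (u : ℝ) : 0 ≤ psiCurv u := by unfold psiCurv; positivity

lemma psiCurv_le_bump (u : ℝ) : psiCurv u ≤ bump u / 2 := by
  unfold psiCurv bump
  rw [mul_inv, mul_inv, div_eq_inv_mul]
  have h := inv_le_one_of_one_le₀ (one_le_sqrt_one_add_sq u)
  have h2 : 0 < (1 + u ^ 2)⁻¹ := by positivity
  nlinarith

lemma bump_sq_le_psiCurv (u : ℝ) : bump u ^ 2 / 2 ≤ psiCurv u := by
  unfold psiCurv bump
  rw [mul_inv, mul_inv, div_eq_inv_mul, sq]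
  have h1 : √(1 + u ^ 2) ≤ 1 + u ^ 2 := by
    have := one_le_sqrt_one_add_sq u
    have h2 := Real.sq_sqrt (show (0 : ℝ) ≤ 1 + u ^ 2 by positivity)
    nlinarith
  have h := inv_anti₀ (sqrt_one_add_sq_pos u) h1
  gcongr

lemma abs_div_sqrt_le_one (u : ℝ) : |u / √(1 + u ^ 2)| ≤ 1 := by
  rw [abs_div, abs_of_pos (sqrt_one_add_sq_pos u), div_le_one (sqrt_one_add_sq_pos u)]
  exact (abs_lt_sqrt_one_add_sq u).le

lemma psiDeriv_nonneg (u : ℝ) : 0 ≤ psiDeriv u := by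
  have := abs_le.1 (abs_div_sqrt_le_one u)
  unfold psiDeriv; linarith

lemma psiDeriv_le_one (u : ℝ) : psiDeriv u ≤ 1 := by
  have := abs_le.1 (abs_div_sqrt_le_one u)
  unfold psiDeriv; linarith

lemma monotone_psiDeriv : Monotone psiDeriv :=
  monotone_of_hasDerivAt_nonneg (f' := psiCurv) hasDerivAt_psiDeriv psiCurv_nonneg

lemma psiDeriv_neg (u : ℝ) : psiDeriv (-u) = 1 - psiDeriv u := by
  unfold psiDeriv; rw [neg_sq, neg_div]; ring

lemma one_sub_psiDeriv_le {u : ℝ} (hu : 0 ≤ u) : 1 - psiDeriv u ≤ bump u / 2 := by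
  unfold psiDeriv bump
  have h := sqrt_one_add_sq_pos u
  have h2 := Real.sq_sqrt (show (0 : ℝ) ≤ 1 + u ^ 2 by positivity)
  have h3 : u / √(1 + u ^ 2) ≥ 1 - (1 + u ^ 2)⁻¹ := by
    rw [ge_iff_le, ← h2]
    have h5 : √(√(1 + u ^ 2) ^ 2) = √(1 + u ^ 2) := Real.sqrt_sq h.le
    rw [h5]
    have h4 : u < √(1 + u ^ 2) := lt_of_abs_lt (abs_lt_sqrt_one_add_sq u)
    rw [show (1 : ℝ) - (√(1 + u ^ 2) ^ 2)⁻¹ = (u / √(1 + u ^ 2)) * (u / √(1 + u ^ 2)) by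
      field_simp; linarith]
    have h6 : 0 ≤ u / √(1 + u ^ 2) := by positivity
    have h7 := (abs_le.1 (abs_div_sqrt_le_one u)).2
    nlinarith
  linarith

lemma psiDeriv_le_of_nonpos {u : ℝ} (hu : u ≤ 0) : psiDeriv u ≤ bump u / 2 := by
  have h := one_sub_psiDeriv_le (u := -u) (by linarith)
  rw [psiDeriv_neg] at h
  have : bump (-u) = bump u := by unfold bump; rw [neg_sq]
  rw [this] at h; linarith

lemma bump_anti {u v : ℝ} (h : |u| ≤ |v|) : bump v ≤ bump u := by
  unfold bump
  have := sq_le_sq.2 h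
  gcongr

/-- The bump varies slowly. -/
lemma bump_le_bump_add (u t : ℝ) : bump u ≤ 2 * (1 + t ^ 2) * bump (u + t) := by
  unfold bump
  rw [← div_eq_mul_inv, le_div_iff₀ (by positivity), inv_mul_le_iff₀ (by positivity)]
  nlinarith [sq_nonneg (u - t), sq_nonneg (u * t), sq_nonneg u, sq_nonneg t]

lemma bump_div_le {u s r : ℝ} (hs : 0 < s) (hsr : s ≤ r) : bump (u / s) ≤ bump (u / r) := by
  apply bump_anti
  rw [abs_div, abs_div, abs_of_pos hs, abs_of_pos (hs.trans_le hsr)]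
  gcongr

/-- Shrinking the width of the bump from `r` to `s` costs at most the factor `(s / r) ^ 2`. -/
lemma bump_div_ge {u s r : ℝ} (hs : 0 < s) (hsr : s ≤ r) :
    (s / r) ^ 2 * bump (u / r) ≤ bump (u / s) := by
  have hr := hs.trans_le hsr
  unfold bump
  rw [← div_eq_mul_inv, div_le_iff₀ (by positivity), ← div_eq_inv_mul, le_div_iff₀ (by positivity)]
  have h1 : (s / r) ^ 2 ≤ 1 := by
    rw [div_pow, div_le_one (by positivity)]; gcongr
  have h2 : (s / r) ^ 2 * (1 + (u / s) ^ 2) = (s / r) ^ 2 + (u / r) ^ 2 := by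
    field_simp
  rw [h2]; linarith

/-- Away from its jump, `psiDeriv` is close to the Heaviside function at every scale. -/
lemma abs_psiDeriv_sub_le_of_mul_nonneg {u v : ℝ} (h : 0 ≤ u * v) :
    |psiDeriv u - psiDeriv v| ≤ (bump u + bump v) / 2 := by
  have hu := bump_pos u
  have hv := bump_pos v
  rcases mul_nonneg_iff.1 h with ⟨h1, h2⟩ | ⟨h1, h2⟩
  · have := one_sub_psiDeriv_le h1
    have := one_sub_psiDeriv_le h2
    have := psiDeriv_le_one u
    have := psiDeriv_le_one v
    rw [abs_le]; constructor <;> linarith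
  · have := psiDeriv_le_of_nonpos h1
    have := psiDeriv_le_of_nonpos h2
    have := psiDeriv_nonneg u
    have := psiDeriv_nonneg v
    rw [abs_le]; constructor <;> linarith

lemma abs_psiDeriv_sub_le_one (u v : ℝ) : |psiDeriv u - psiDeriv v| ≤ 1 := by
  have := psiDeriv_nonneg u
  have := psiDeriv_nonneg v
  have := psiDeriv_le_one u
  have := psiDeriv_le_one v
  rw [abs_le]; constructor <;> linarith

/-- The derivatives of the hinge smoothed at two widths differ only near the kink, at the scale of
the larger width. -/
lemma abs_psiDeriv_scale_sub_le {u s r : ℝ} (hs : 0 < s) (hsr : s ≤ r) :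
    |psiDeriv (u / s) - psiDeriv (u / r)| ≤ bump (u / r) := by
  have hr := hs.trans_le hsr
  have h := abs_psiDeriv_sub_le_of_mul_nonneg (u := u / s) (v := u / r)
    (by rw [div_mul_div_comm]; exact div_nonneg (mul_self_nonneg u) (by positivity))
  linarith [bump_div_le (u := u) hs hsr]

/-- An increment of `psiDeriv` over a distance `τ`, which is at least the smoothing width, is
controlled by the bump of width `τ`. -/
lemma abs_psiDeriv_sub_le {u v s τ : ℝ} (hs : 0 < s) (hsτ : s ≤ τ) (huv : |v - u| ≤ τ) :
    |psiDeriv (v / s) - psiDeriv (u / s)| ≤ 3 * bump (u / τ) := by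
  have hτ := hs.trans_le hsτ
  rcases le_or_gt 0 (v * u) with h | h
  · have h1 := abs_psiDeriv_sub_le_of_mul_nonneg (u := v / s) (v := u / s)
      (by rw [div_mul_div_comm]; exact div_nonneg h (by positivity))
    have h2 := bump_div_le (u := u) hs hsτ
    have h3 := bump_div_le (u := v) hs hsτ
    have h4 := bump_le_bump_add (v / τ) ((u - v) / τ)
    rw [← add_div, add_sub_cancel] at h4
    have h5 : ((u - v) / τ) ^ 2 ≤ 1 := by
      rw [div_pow, div_le_one (by positivity), sq_le_sq, abs_of_pos hτ, abs_sub_comm]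
      exact huv
    have h6 := bump_pos (u / τ)
    have h7 : 2 * (1 + ((u - v) / τ) ^ 2) * bump (u / τ) ≤ 4 * bump (u / τ) := by
      apply mul_le_mul_of_nonneg_right _ h6.le
      linarith
    linarith
  · have hu : |u| ≤ τ := by
      refine le_trans ?_ huv
      rcases mul_neg_iff.1 h with ⟨h1, h2⟩ | ⟨h1, h2⟩
      · rw [abs_of_neg h2, abs_of_pos (by linarith)]; linarith
      · rw [abs_of_pos h2, abs_of_neg (by linarith)]; linarith
    have h1 : 1 / 2 ≤ bump (u / τ) := by
      unfold bump
      rw [one_div]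
      apply inv_anti₀ (by positivity)
      have : (u / τ) ^ 2 ≤ 1 := by
        rw [div_pow, div_le_one (by positivity), sq_le_sq, abs_of_pos hτ]; exact hu
      linarith
    linarith [abs_psiDeriv_sub_le_one (v / s) (u / s)]

/-- `s ψ(u / s)` is within `s / 2` of the positive part of `u`. -/
lemma abs_psi_scale_sub_le {u s : ℝ} (hs : 0 < s) : |s * psi (u / s) - max 0 u| ≤ s / 2 := by
  have h1 : √(1 + (u / s) ^ 2) ≤ 1 + |u / s| :=
    Real.sqrt_le_iff.2 ⟨by positivity, by rw [← sq_abs (u / s)]; nlinarith [abs_nonneg (u / s)]⟩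
  have h2 := abs_lt_sqrt_one_add_sq (u / s)
  have h3 : |u / s| = |u| / s := by rw [abs_div, abs_of_pos hs]
  rw [h3] at h1 h2
  have h4 : s * psi (u / s) = (u + s * √(1 + (u / s) ^ 2)) / 2 := by
    unfold psi; field_simp
  have h5 : max 0 u = (u + |u|) / 2 := by
    rcases le_total 0 u with h | h
    · rw [max_eq_right h, abs_of_nonneg h]; ring
    · rw [max_eq_left h, abs_of_nonpos h]; ring
  have h6 : s * (|u| / s) = |u| := by field_simp
  have h7 := mul_le_mul_of_nonneg_left h1 hs.le
  have h8 := mul_le_mul_of_nonneg_left h2.le hs.le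
  rw [mul_add] at h7
  rw [h4, h5, abs_le]
  constructor <;> linarith

/-! ### Gradient and Hessian of the smoothed objective -/

/-- The margin `1 - y wᵀx` of the data point `z = (x, y)`. -/
def margin {m : ℕ} (w : Vec m) (z : Vec m × ℝ) : ℝ := 1 - z.2 * inner ℝ w z.1

/-- The empirical mean of `h` over the dataset. -/
def empMean {m N : ℕ} (D : Dataset m N) (h : Vec m × ℝ → ℝ) : ℝ := (1 / (N : ℝ)) * ∑ i, h (D i)

/-- The set of possible data points: labels of modulus one, features of norm at most `R`. -/
def dataRange (m : ℕ) (R : ℝ) : Set (Vec m × ℝ) := {z | |z.2| = 1 ∧ ‖z.1‖ ≤ R}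

section empMean
variable {m N : ℕ} (D : Dataset m N) (h k : Vec m × ℝ → ℝ)

lemma empMean_add : empMean D (fun z => h z + k z) = empMean D h + empMean D k := by
  simp only [empMean, Finset.sum_add_distrib]; ring

lemma empMean_sub : empMean D (fun z => h z - k z) = empMean D h - empMean D k := by
  simp only [empMean, Finset.sum_sub_distrib]; ring

lemma empMean_const_mul (c : ℝ) : empMean D (fun z => c * h z) = c * empMean D h := by
  simp only [empMean, ← Finset.mul_sum]; ring

variable {D h k}

lemma empMean_mono (H : ∀ i, h (D i) ≤ k (D i)) : empMean D h ≤ empMean D k := by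
  unfold empMean
  gcongr with i
  exact H i

lemma empMean_congr (H : ∀ i, h (D i) = k (D i)) : empMean D h = empMean D k := by
  unfold empMean
  simp only [H]

lemma abs_empMean_le (H : ∀ i, |h (D i)| ≤ k (D i)) : |empMean D h| ≤ empMean D k := by
  unfold empMean
  rw [abs_mul, abs_of_nonneg (by positivity : (0 : ℝ) ≤ 1 / N)]
  gcongr
  exact (Finset.abs_sum_le_sum_abs _ _).trans (Finset.sum_le_sum fun i _ => H i)

lemma empMean_nonneg (H : ∀ i, 0 ≤ h (D i)) : 0 ≤ empMean D h :=
  mul_nonneg (by positivity) (Finset.sum_nonneg fun i _ => H i)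

lemma empMean_le_const {c : ℝ} (hc : 0 ≤ c) (H : ∀ i, h (D i) ≤ c) : empMean D h ≤ c := by
  unfold empMean
  have h1 : ∑ i, h (D i) ≤ N * c := by
    simpa using Finset.sum_le_sum (s := Finset.univ) fun i _ => H i
  rcases Nat.eq_zero_or_pos N with hN | hN
  · subst hN; simpa using hc
  · have : (0 : ℝ) < N := by exact_mod_cast hN
    rw [one_div, inv_mul_le_iff₀ this]; exact h1

end empMean

section calculus
variable {m N : ℕ} {lam α : ℝ} {D : Dataset m N}

lemma hasFDerivAt_margin (w : Vec m) (z : Vec m × ℝ) :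
    HasFDerivAt (fun w => margin w z) (-(z.2 • innerSL ℝ z.1)) w := by
  have h : HasFDerivAt (fun w : Vec m => z.2 * innerSL ℝ z.1 w) (z.2 • innerSL ℝ z.1) w :=
    ((innerSL ℝ z.1).hasFDerivAt).const_mul z.2
  refine (h.const_sub 1).congr_of_eventuallyEq (Filter.Eventually.of_forall fun w => ?_)
  simp [margin, real_inner_comm]

lemma hasFDerivAt_margin_div (w : Vec m) (z : Vec m × ℝ) :
    HasFDerivAt (fun w => margin w z / α) (-((z.2 / α) • innerSL ℝ z.1)) w := by
  have h := (hasFDerivAt_margin w z).mul_const α⁻¹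
  refine (h.congr_fderiv ?_).congr_of_eventuallyEq (Filter.Eventually.of_forall fun w => ?_)
  · ext v; simp; ring
  · simp [div_eq_mul_inv]

/-- The gradient of the smoothed objective, written out. -/
lemma hasGradientAt_objective (hα : 0 < α) (w : Vec m) :
    HasGradientAt (objective lam α D)
      (lam • w - (1 / (N : ℝ)) • ∑ i, (psiDeriv (margin w (D i) / α) * (D i).2) • (D i).1) w := by
  rw [hasGradientAt_iff_hasFDerivAt]
  have h1 : HasFDerivAt (fun w : Vec m => lam / 2 * ‖w‖ ^ 2) ((lam / 2) • (2 • innerSL ℝ w)) w :=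
    ((hasStrictFDerivAt_norm_sq w).hasFDerivAt).const_mul (lam / 2)
  have h2 : ∀ i, HasFDerivAt (fun w => smoothedHinge α (D i).1 (D i).2 w)
      (α • (psiDeriv (margin w (D i) / α) • (-(((D i).2 / α) • innerSL ℝ (D i).1)))) w := fun i =>
    ((hasDerivAt_psi _).comp_hasFDerivAt w (hasFDerivAt_margin_div w (D i))).const_mul α
  have h3 := h1.add ((HasFDerivAt.fun_sum fun i (_ : i ∈ Finset.univ) => h2 i).const_mul (1 / (N : ℝ)))
  refine h3.congr_fderiv ?_
  ext v
  simp only [InnerProductSpace.toDual_apply_apply, inner_sub_left, inner_smul_left, sum_inner,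
    add_apply, smul_apply, sum_apply,
    neg_apply, innerSL_apply_apply, smul_eq_mul, nsmul_eq_mul,
    RCLike.conj_to_real]
  rw [sub_eq_add_neg, ← mul_neg, ← Finset.sum_neg_distrib]
  congr 1
  · push_cast; ring
  · congr 1
    refine Finset.sum_congr rfl fun i _ => ?_
    field_simp

lemma grad_eq (hα : 0 < α) (w : Vec m) : grad lam α D w =
    lam • w - (1 / (N : ℝ)) • ∑ i, (psiDeriv (margin w (D i) / α) * (D i).2) • (D i).1 :=
  (hasGradientAt_objective hα w).gradient

lemma inner_grad (hα : 0 < α) (w e : Vec m) : inner ℝ (grad lam α D w) e =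
    lam * inner ℝ w e -
      empMean D (fun z => psiDeriv (margin w z / α) * z.2 * inner ℝ z.1 e) := by
  rw [grad_eq hα]
  simp [inner_sub_left, inner_smul_left, sum_inner, empMean]

lemma hasFDerivAt_grad (hα : 0 < α) (w : Vec m) : HasFDerivAt (grad lam α D)
    (lam • ContinuousLinearMap.id ℝ (Vec m) + (1 / (N : ℝ)) • ∑ i,
      (psiCurv (margin w (D i) / α) * ((D i).2 ^ 2 / α)) •
        (innerSL ℝ (D i).1).smulRight (D i).1) w := by
  have h2 : ∀ i, HasFDerivAt
      (fun w => (psiDeriv (margin w (D i) / α) * (D i).2) • (D i).1)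
      (((D i).2 • (psiCurv (margin w (D i) / α) • (-(((D i).2 / α) • innerSL ℝ (D i).1)))).smulRight
        (D i).1) w := fun i =>
    (((hasDerivAt_psiDeriv _).comp_hasFDerivAt w
      (hasFDerivAt_margin_div w (D i))).mul_const (D i).2).smul_const (D i).1
  have h3 := ((hasFDerivAt_id (𝕜 := ℝ) w).const_smul lam).sub
    ((HasFDerivAt.fun_sum fun i (_ : i ∈ Finset.univ) => h2 i).const_smul (1 / (N : ℝ)))
  refine (h3.congr_fderiv ?_).congr_of_eventuallyEq
    (Filter.Eventually.of_forall fun w => grad_eq hα w)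
  rw [sub_eq_add_neg, ← smul_neg, ← Finset.sum_neg_distrib]
  congr 2
  refine Finset.sum_congr rfl fun i _ => ?_
  ext v
  simp
  ring

lemma inner_hess (hα : 0 < α) (w v e : Vec m) : inner ℝ (hess lam α D w v) e =
    lam * inner ℝ v e +
      empMean D (fun z => psiCurv (margin w z / α) * (z.2 ^ 2 / α) *
        (inner ℝ z.1 v * inner ℝ z.1 e)) := by
  rw [hess, (hasFDerivAt_grad hα w).fderiv]
  simp [inner_add_left, inner_smul_left, sum_inner, empMean, mul_assoc]

lemma hess_symm (hα : 0 < α) (w v e : Vec m) :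
    inner ℝ (hess lam α D w v) e = inner ℝ v (hess lam α D w e) := by
  rw [real_inner_comm (hess lam α D w e) v, inner_hess hα, inner_hess hα, real_inner_comm e v]
  congr 2
  ext z; ring

lemma inner_hess_self_nonneg (hlam : 0 ≤ lam) (hα : 0 < α) (w v : Vec m) :
    0 ≤ inner ℝ (hess lam α D w v) v := by
  rw [inner_hess hα]
  refine add_nonneg (mul_nonneg hlam real_inner_self_nonneg) (empMean_nonneg fun i => ?_)
  have := psiCurv_nonneg (margin w (D i) / α)
  exact mul_nonneg (mul_nonneg this (by positivity)) (mul_self_nonneg _)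

lemma lam_mul_le_inner_hess_self (hα : 0 < α) (w v : Vec m) :
    lam * ‖v‖ ^ 2 ≤ inner ℝ (hess lam α D w v) v := by
  rw [inner_hess hα, real_inner_self_eq_norm_sq]
  have : 0 ≤ empMean D (fun z => psiCurv (margin w z / α) * (z.2 ^ 2 / α) *
        (inner ℝ z.1 v * inner ℝ z.1 v)) := empMean_nonneg fun i => by
    have := psiCurv_nonneg (margin w (D i) / α)
    exact mul_nonneg (mul_nonneg this (by positivity)) (mul_self_nonneg _)
  linarith

end calculus

/-! ### Newton steps -/

section newton
variable {V : Type*} [NormedAddCommGroup V] [InnerProductSpace ℝ V]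

lemma isInvertible_of_coercive [FiniteDimensional ℝ V] {T : V →L[ℝ] V} {c : ℝ} (hc : 0 < c)
    (hT : ∀ v, c * ‖v‖ ^ 2 ≤ inner ℝ (T v) v) : T.IsInvertible := by
  have hinj : Function.Injective (T : V →ₗ[ℝ] V) := by
    rw [injective_iff_map_eq_zero]
    intro v hv
    have h1 := hT v
    have h2 : T v = 0 := hv
    rw [h2, inner_zero_left] at h1
    have h3 : ‖v‖ ^ 2 = 0 := le_antisymm (by nlinarith) (sq_nonneg _)
    simpa using h3
  exact ⟨(LinearEquiv.ofInjectiveEndo _ hinj).toContinuousLinearEquiv, by ext v; rfl⟩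

lemma norm_mul_le_of_coercive {T : V →L[ℝ] V} {c : ℝ}
    (hT : ∀ v, c * ‖v‖ ^ 2 ≤ inner ℝ (T v) v) (v : V) : c * ‖v‖ ≤ ‖T v‖ := by
  rcases (norm_nonneg v).eq_or_lt with h | h
  · rw [← h]; simp
  · have h1 := (hT v).trans (real_inner_le_norm _ _)
    rw [sq, ← mul_assoc] at h1
    exact le_of_mul_le_mul_right h1 h

/-- A positive semidefinite operator `T ≤ M` satisfies `T² ≤ M T`. -/
lemma norm_sq_le_of_psd_le {T : V →L[ℝ] V} {M : ℝ} (hM : 0 < M)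
    (hsym : ∀ v e, inner ℝ (T v) e = inner ℝ v (T e)) (hpos : ∀ v, 0 ≤ inner ℝ (T v) v)
    (hT : ∀ v, inner ℝ (T v) v ≤ M * ‖v‖ ^ 2) (v : V) : ‖T v‖ ^ 2 ≤ M * inner ℝ (T v) v := by
  have h := hpos (v - M⁻¹ • T v)
  have h2 := hT (T v)
  have h3 : inner ℝ (T (T v)) v = ‖T v‖ ^ 2 := by rw [hsym, real_inner_self_eq_norm_sq]
  have h5 : inner ℝ (T v) (T v) = ‖T v‖ ^ 2 := real_inner_self_eq_norm_sq _
  simp only [map_sub, map_smul, inner_sub_left, inner_sub_right, inner_smul_left, inner_smul_right,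
    RCLike.conj_to_real, h3, h5] at h
  have h4 : M⁻¹ * (M⁻¹ * inner ℝ (T (T v)) (T v)) ≤ M⁻¹ * ‖T v‖ ^ 2 := by
    gcongr
    rw [inv_mul_le_iff₀ hM]; exact h2
  have h6 : M⁻¹ * ‖T v‖ ^ 2 ≤ inner ℝ (T v) v := by linarith
  rwa [inv_mul_le_iff₀ hM] at h6

end newton

section newtonDir
variable {m N : ℕ} {lam α : ℝ} {D : Dataset m N} {w : Vec m}

lemma hess_newtonDir (h : (hess lam α D w).IsInvertible) :
    hess lam α D w (newtonDir lam α D w) = -grad lam α D w := by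
  rw [newtonDir, map_neg, ← h.inverse_apply_eq.1 rfl]

/-- If the stopping test holds and the Hessian is bounded, then the gradient is small. -/
lemma norm_grad_sq_le_of_stopTest {η M : ℝ} (hlam : 0 ≤ lam) (hα : 0 < α) (hM : 0 < M)
    (h : StopTest lam η α D w)
    (hH : ∀ v, inner ℝ (hess lam α D w v) v ≤ M * ‖v‖ ^ 2) :
    ‖grad lam α D w‖ ^ 2 ≤ M * (η * α) := by
  have h1 := norm_sq_le_of_psd_le hM (hess_symm hα w) (inner_hess_self_nonneg hlam hα w) hH
    (newtonDir lam α D w)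
  rw [hess_newtonDir h.1, norm_neg, inner_neg_left, real_inner_comm] at h1
  have h2 := (neg_le_abs _).trans h.2.le
  exact h1.trans (by gcongr)

lemma norm_newtonDir_le {c : ℝ} (hc : 0 < c)
    (hH : ∀ v, c * ‖v‖ ^ 2 ≤ inner ℝ (hess lam α D w v) v) :
    ‖newtonDir lam α D w‖ ≤ ‖grad lam α D w‖ / c := by
  have h1 := norm_mul_le_of_coercive hH (newtonDir lam α D w)
  rw [hess_newtonDir (isInvertible_of_coercive hc hH), norm_neg] at h1
  rwa [le_div_iff₀ hc, mul_comm]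

lemma stopTest_of_norm_grad {c η : ℝ} (hc : 0 < c)
    (hH : ∀ v, c * ‖v‖ ^ 2 ≤ inner ℝ (hess lam α D w v) v)
    (hg : ‖grad lam α D w‖ ^ 2 / c < η * α) : StopTest lam η α D w := by
  refine ⟨isInvertible_of_coercive hc hH, lt_of_le_of_lt ?_ hg⟩
  refine (abs_real_inner_le_norm _ _).trans ?_
  rw [sq, mul_div_right_comm]
  exact mul_le_mul_of_nonneg_right (norm_newtonDir_le hc hH) (norm_nonneg _)

/-- The Armijo condition for the full Newton step, when the gradient is nearly affine along it. -/
lemma armijo_one_of_remainder {c₁ B : ℝ} (hα : 0 < α)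
    (hinv : (hess lam α D w).IsInvertible)
    (hB : ∀ t ∈ Set.Icc (0 : ℝ) 1, ‖grad lam α D (w + t • newtonDir lam α D w) - grad lam α D w -
      hess lam α D w (t • newtonDir lam α D w)‖ ≤ B)
    (hle : ‖newtonDir lam α D w‖ * B ≤
      (1 / 2 - c₁) * |inner ℝ (newtonDir lam α D w) (grad lam α D w)|)
    (hneg : inner ℝ (newtonDir lam α D w) (grad lam α D w) ≤ 0) :
    Armijo lam c₁ α D w 1 := by
  set d := newtonDir lam α D w with hd
  set g := grad lam α D w with hg
  have hHd : hess lam α D w d = -g := hess_newtonDir hinv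
  -- the difference between the objective along the step and its quadratic model
  set F : ℝ → ℝ := fun t => objective lam α D (w + t • d) - t * inner ℝ d g +
    t ^ 2 / 2 * inner ℝ d g with hF
  have hderiv : ∀ t : ℝ, HasDerivAt F
      (inner ℝ (grad lam α D (w + t • d) - g - hess lam α D w (t • d)) d) t := by
    intro t
    have h1 : HasDerivAt (fun t : ℝ => w + t • d) d t := by
      simpa using ((hasDerivAt_id t).smul_const d).const_add w
    have h2 := (hasGradientAt_objective (lam := lam) (D := D) hα (w + t • d)).hasFDerivAt
    rw [← grad_eq hα] at h2
    have h3 := h2.comp_hasDerivAt t h1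
    have h4 : HasDerivAt (fun t : ℝ => t * inner ℝ d g) (inner ℝ d g) t := by
      simpa using (hasDerivAt_id t).mul_const (inner ℝ d g : ℝ)
    have h5 : HasDerivAt (fun t : ℝ => t ^ 2 / 2 * inner ℝ d g) (t * inner ℝ d g) t := by
      have := ((hasDerivAt_pow 2 t).div_const 2).mul_const (inner ℝ d g : ℝ)
      refine this.congr_deriv ?_
      push_cast; ring
    refine ((h3.sub h4).add h5).congr_deriv ?_
    rw [InnerProductSpace.toDual_apply_apply, map_smul, hHd]
    simp only [inner_sub_left, inner_smul_left, inner_neg_left, RCLike.conj_to_real]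
    rw [real_inner_comm d g]; ring
  have h1 := norm_image_sub_le_of_norm_deriv_le_segment_01' (f := F) (C := ‖d‖ * B)
    (fun t _ => (hderiv t).hasDerivWithinAt) (fun t ht => by
      rw [Real.norm_eq_abs]
      refine (abs_real_inner_le_norm _ _).trans ?_
      rw [mul_comm]
      gcongr
      exact hB t ⟨ht.1, ht.2.le⟩)
  have h2 := (le_abs_self _).trans h1
  simp only [hF] at h2
  rw [abs_of_nonpos hneg] at hle
  simp only [Armijo, ← hd, ← hg]
  simp only [one_smul, zero_smul, add_zero] at h2 ⊢
  linarith

end newtonDir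

/-! ### Deviations of sums of independent variables -/

section deviations
variable {Ω : Type*} [MeasurableSpace Ω] {μ : Measure Ω} [IsProbabilityMeasure μ] {N : ℕ}

/-- Chebyshev's inequality for a sum over part of the sample. -/
lemma pi_chebyshev {h : Ω → ℝ} (hh : MemLp h 2 μ) (S : Finset (Fin N)) {t : ℝ} (ht : 0 < t) :
    (Measure.pi fun _ : Fin N => μ) {D | t ≤ |∑ i ∈ S, h (D i) - S.card * ∫ z, h z ∂μ|} ≤
      ENNReal.ofReal (S.card * (∫ z, h z ^ 2 ∂μ) / t ^ 2) := by
  classical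
  set X : Fin N → Ω → ℝ := fun i => if i ∈ S then h else fun _ => 0 with hX
  have hXm : ∀ i, MemLp (X i) 2 μ := by
    intro i; simp only [hX]; split_ifs
    · exact hh
    · exact MemLp.zero'
  have hsum : (∑ i, fun D : Fin N → Ω => X i (D i)) = fun D => ∑ i ∈ S, h (D i) := by
    funext D
    rw [Finset.sum_apply, Finset.sum_congr rfl (g := fun i => if i ∈ S then h (D i) else 0)]
    · simp
    · intro i _; simp only [hX]; split_ifs <;> rfl
  have hmem : ∀ i, MemLp (fun D : Fin N → Ω => X i (D i)) 2 (Measure.pi fun _ : Fin N => μ) :=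
    fun i => (hXm i).comp_measurePreserving
      (measurePreserving_eval (fun _ : Fin N => μ) i)
  have hmemS : MemLp (fun D : Fin N → Ω => ∑ i ∈ S, h (D i)) 2 (Measure.pi fun _ : Fin N => μ) := by
    rw [← hsum]; exact memLp_finsetSum' _ fun i _ => hmem i
  have hvar := ProbabilityTheory.variance_sum_pi (μ := fun _ : Fin N => μ) hXm
  rw [hsum] at hvar
  have hvi : ∀ i, ProbabilityTheory.variance (X i) μ ≤ if i ∈ S then ∫ z, h z ^ 2 ∂μ else 0 := by
    intro i; simp only [hX]; split_ifs
    · exact ProbabilityTheory.variance_le_expectation_sq hh.aestronglyMeasurable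
    · exact (ProbabilityTheory.variance_zero μ).le
  have hvar2 : ProbabilityTheory.variance (fun D : Fin N → Ω => ∑ i ∈ S, h (D i))
      (Measure.pi fun _ : Fin N => μ) ≤ S.card * ∫ z, h z ^ 2 ∂μ := by
    rw [hvar]
    refine (Finset.sum_le_sum fun i _ => hvi i).trans ?_
    simp
  have hint : ∫ D, (∑ i ∈ S, h (D i)) ∂(Measure.pi fun _ : Fin N => μ) =
      S.card * ∫ z, h z ∂μ := by
    rw [integral_finsetSum]
    · rw [Finset.sum_congr rfl fun i _ => integral_comp_eval (μ := fun _ : Fin N => μ)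
        hh.aestronglyMeasurable]
      simp
    · intro i _
      exact (measurePreserving_eval (fun _ : Fin N => μ) i).integrable_comp_of_integrable
        (hh.integrable (by norm_num))
  have h1 := ProbabilityTheory.meas_ge_le_variance_div_sq hmemS ht
  rw [hint] at h1
  exact h1.trans (ENNReal.ofReal_le_ofReal (by gcongr))

lemma integral_prod_pi_pow (f : Ω → ℝ) :
    ∫ D, ∏ i, f (D i) ∂(Measure.pi fun _ : Fin N => μ) = (∫ z, f z ∂μ) ^ N := by
  rw [integral_fintype_prod_eq_prod (fun _ : Fin N => f)]
  simp

/-- The exponential Markov inequality behind both of the bounds below. -/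
lemma pi_exp_sum_le {h : Ω → ℝ} (hm : Measurable h) {B : ℝ} (hB : ∀ z, h z ≤ B) (t : ℝ) :
    (Measure.pi fun _ : Fin N => μ) {D | t ≤ ∑ i, h (D i)} ≤
      ENNReal.ofReal (Real.exp (-t) * (∫ z, Real.exp (h z) ∂μ) ^ N) := by
  have hint : Integrable (fun z => Real.exp (h z)) μ :=
    Integrable.of_bound (by fun_prop) (Real.exp B) (Filter.Eventually.of_forall fun z => by
      rw [Real.norm_eq_abs, abs_of_pos (Real.exp_pos _)]; exact Real.exp_le_exp.2 (hB z))
  have hint2 : Integrable (fun D : Fin N → Ω => ∏ i, Real.exp (h (D i)))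
      (Measure.pi fun _ : Fin N => μ) := Integrable.fintype_prod fun _ => hint
  have h1 := mul_meas_ge_le_integral_of_nonneg (μ := Measure.pi fun _ : Fin N => μ)
    (Filter.Eventually.of_forall fun D => Finset.prod_nonneg fun i _ => (Real.exp_pos _).le)
    hint2 (Real.exp t)
  rw [integral_prod_pi_pow (fun z => Real.exp (h z))] at h1
  have h2 : {D : Fin N → Ω | Real.exp t ≤ ∏ i, Real.exp (h (D i))} =
      {D | t ≤ ∑ i, h (D i)} := by
    ext D; simp [← Real.exp_sum]
  rw [h2] at h1
  rw [← ENNReal.ofReal_toReal (measure_ne_top (Measure.pi fun _ : Fin N => μ) _)]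
  refine ENNReal.ofReal_le_ofReal ?_
  rw [Real.exp_neg, ← div_eq_inv_mul, le_div_iff₀ (Real.exp_pos t), mul_comm]
  exact h1

/-- Chernoff's bound for the upper tail. -/
lemma pi_chernoff_upper {h : Ω → ℝ} (hm : Measurable h) (h0 : ∀ z, 0 ≤ h z) (h1 : ∀ z, h z ≤ 1)
    (t : ℝ) : (Measure.pi fun _ : Fin N => μ) {D | t ≤ ∑ i, h (D i)} ≤
      ENNReal.ofReal (Real.exp (2 * (N * ∫ z, h z ∂μ) - t)) := by
  have hi : Integrable h μ := Integrable.of_bound (by fun_prop) 1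
    (Filter.Eventually.of_forall fun z => by rw [Real.norm_eq_abs, abs_of_nonneg (h0 z)]; exact h1 z)
  refine (pi_exp_sum_le hm h1 t).trans (ENNReal.ofReal_le_ofReal ?_)
  have h2 : ∀ z, Real.exp (h z) ≤ 1 + 2 * h z := by
    intro z
    have h3 := Real.abs_exp_sub_one_sub_id_le (x := h z) (by rw [abs_of_nonneg (h0 z)]; exact h1 z)
    have h4 := (abs_le.1 h3).2
    nlinarith [h0 z, h1 z]
  have h3 : ∫ z, Real.exp (h z) ∂μ ≤ Real.exp (2 * ∫ z, h z ∂μ) := by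
    calc ∫ z, Real.exp (h z) ∂μ ≤ ∫ z, (1 + 2 * h z) ∂μ := by
          refine integral_mono_of_nonneg (Filter.Eventually.of_forall fun z => (Real.exp_pos _).le)
            ((integrable_const _).add (hi.const_mul 2)) (Filter.Eventually.of_forall h2)
      _ = 2 * (∫ z, h z ∂μ) + 1 := by
          rw [integral_add (integrable_const _) (hi.const_mul 2), integral_const_mul]
          simp [add_comm]
      _ ≤ _ := Real.add_one_le_exp _
  calc Real.exp (-t) * (∫ z, Real.exp (h z) ∂μ) ^ N
      ≤ Real.exp (-t) * Real.exp (2 * ∫ z, h z ∂μ) ^ N := by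
        gcongr
    _ = _ := by
        rw [← Real.exp_nat_mul, ← Real.exp_add]; congr 1; ring

/-- Chernoff's bound for the lower tail. -/
lemma pi_chernoff_lower {h : Ω → ℝ} (hm : Measurable h) (h0 : ∀ z, 0 ≤ h z) (h1 : ∀ z, h z ≤ 1)
    (t : ℝ) : (Measure.pi fun _ : Fin N => μ) {D | ∑ i, h (D i) ≤ t} ≤
      ENNReal.ofReal (Real.exp (t - N * (∫ z, h z ∂μ) / 2)) := by
  have hi : Integrable h μ := Integrable.of_bound (by fun_prop) 1
    (Filter.Eventually.of_forall fun z => by rw [Real.norm_eq_abs, abs_of_nonneg (h0 z)]; exact h1 z)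
  have key := pi_exp_sum_le (μ := μ) (N := N) hm.neg (B := 0)
    (fun z => by simpa using h0 z) (-t)
  have hset : {D : Fin N → Ω | -t ≤ ∑ i, (-h) (D i)} = {D | ∑ i, h (D i) ≤ t} := by
    ext D; simp
  rw [hset] at key
  refine key.trans (ENNReal.ofReal_le_ofReal ?_)
  have h2 : ∀ z, Real.exp ((-h) z) ≤ 1 + (-1 / 2) * h z := by
    intro z
    rw [Pi.neg_apply, Real.exp_neg]
    have h3 : 1 + h z ≤ Real.exp (h z) := by linarith [Real.add_one_le_exp (h z)]
    have h4 := h0 z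
    have h5 := h1 z
    rw [inv_le_iff_one_le_mul₀ (Real.exp_pos _)]
    nlinarith
  have h3 : ∫ z, Real.exp ((-h) z) ∂μ ≤ Real.exp ((-1 / 2) * ∫ z, h z ∂μ) := by
    calc ∫ z, Real.exp ((-h) z) ∂μ ≤ ∫ z, (1 + (-1 / 2) * h z) ∂μ := by
          refine integral_mono_of_nonneg (Filter.Eventually.of_forall fun z => (Real.exp_pos _).le)
            ((integrable_const _).add (hi.const_mul _)) (Filter.Eventually.of_forall h2)
      _ = (-1 / 2) * (∫ z, h z ∂μ) + 1 := by
          rw [integral_add (integrable_const _) (hi.const_mul _), integral_const_mul]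
          simp [add_comm]
      _ ≤ _ := Real.add_one_le_exp _
  calc Real.exp (- -t) * (∫ z, Real.exp ((-h) z) ∂μ) ^ N
      ≤ Real.exp (- -t) * Real.exp ((-1 / 2) * ∫ z, h z ∂μ) ^ N := by
        gcongr
    _ = _ := by
        rw [← Real.exp_nat_mul, ← Real.exp_add]; congr 1; ring

/-- Markov's inequality for a mean over the sample. -/
lemma pi_markov {h : Ω → ℝ} (hi : Integrable h μ) (h0 : ∀ z, 0 ≤ h z) {t : ℝ} (ht : 0 < t) :
    (Measure.pi fun _ : Fin N => μ) {D | t ≤ (1 / (N : ℝ)) * ∑ i, h (D i)} ≤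
      ENNReal.ofReal ((∫ z, h z ∂μ) / t) := by
  have hint : ∀ i : Fin N, Integrable (fun D : Fin N → Ω => h (D i))
      (Measure.pi fun _ : Fin N => μ) := fun i =>
    (measurePreserving_eval (fun _ : Fin N => μ) i).integrable_comp_of_integrable hi
  have h1 := mul_meas_ge_le_integral_of_nonneg (μ := Measure.pi fun _ : Fin N => μ)
    (f := fun D => (1 / (N : ℝ)) * ∑ i, h (D i))
    (Filter.Eventually.of_forall fun D => mul_nonneg (by positivity)
      (Finset.sum_nonneg fun i _ => h0 _))
    ((integrable_finsetSum _ fun i _ => hint i).const_mul _) t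
  have h2 : ∫ D, (1 / (N : ℝ)) * ∑ i, h (D i) ∂(Measure.pi fun _ : Fin N => μ) ≤ ∫ z, h z ∂μ := by
    rw [integral_const_mul, integral_finsetSum _ fun i _ => hint i]
    rw [Finset.sum_congr rfl fun i _ => integral_comp_eval (μ := fun _ : Fin N => μ)
        hi.aestronglyMeasurable]
    rcases Nat.eq_zero_or_pos N with hN | hN
    · subst hN; simpa using integral_nonneg h0
    · have : (0 : ℝ) < N := by exact_mod_cast hN
      simp [this.ne']
  rw [← ENNReal.ofReal_toReal (measure_ne_top (Measure.pi fun _ : Fin N => μ) _)]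
  refine ENNReal.ofReal_le_ofReal ?_
  rw [le_div_iff₀ ht, mul_comm]
  exact h1.trans h2

end deviations

/-! ### Grids -/

lemma norm_le_sum_abs {m : ℕ} (v : Vec m) : ‖v‖ ≤ ∑ k, |v k| := by
  rw [EuclideanSpace.norm_eq]
  refine Real.sqrt_le_iff.2 ⟨Finset.sum_nonneg fun _ _ => abs_nonneg _, ?_⟩
  simp only [Real.norm_eq_abs]
  exact Finset.sum_sq_le_sq_sum_of_nonneg fun _ _ => abs_nonneg _

/-- A cubic grid of mesh `s / (m + 1)`, which is `s`-dense in the ball in the Euclidean norm. -/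
lemma exists_grid (m : ℕ) (q₀ : Vec m) {ρ s : ℝ} (hρ : 0 ≤ ρ) (hs : 0 < s) :
    ∃ T : Finset (Vec m), (T.card : ℝ) ≤ (2 * (m + 1) * (ρ / s) + 1) ^ m ∧
      ∀ v, ‖v - q₀‖ ≤ ρ → ∃ q ∈ T, ‖v - q‖ ≤ s := by
  classical
  set a : ℝ := s / (m + 1) with ha
  have ha0 : 0 < a := by positivity
  set n : ℕ := ⌊2 * ρ / a⌋₊ + 1 with hn
  set G : (Fin m → Fin n) → Vec m :=
    fun f => WithLp.toLp 2 fun k => q₀ k - ρ + (f k : ℕ) * a with hG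
  refine ⟨Finset.univ.image G, ?_, fun v hv => ?_⟩
  · have h1 : ((Finset.univ.image G).card : ℝ) ≤ (n : ℝ) ^ m := by
      have := Finset.card_image_le (s := (Finset.univ : Finset (Fin m → Fin n))) (f := G)
      rw [Finset.card_univ, Fintype.card_fun, Fintype.card_fin, Fintype.card_fin] at this
      exact_mod_cast this
    refine h1.trans ?_
    gcongr
    rw [hn]; push_cast
    have := Nat.floor_le (show 0 ≤ 2 * ρ / a by positivity)
    have h3 : 2 * ρ / a = 2 * (m + 1) * (ρ / s) := by rw [ha]; field_simp
    linarith
  · have hk : ∀ k, |v k - q₀ k| ≤ ρ := fun k => by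
      have := PiLp.norm_apply_le (v - q₀) k
      simp only [PiLp.sub_apply, Real.norm_eq_abs] at this
      exact this.trans hv
    have hf : ∀ k, ⌊(v k - q₀ k + ρ) / a⌋₊ < n := fun k => by
      rw [hn, Nat.lt_succ_iff]
      apply Nat.floor_le_floor
      have := (abs_le.1 (hk k)).2
      gcongr; linarith
    refine ⟨G fun k => ⟨_, hf k⟩, Finset.mem_image_of_mem _ (Finset.mem_univ _), ?_⟩
    refine (norm_le_sum_abs _).trans ?_
    have h2 : ∀ k, |(v - G fun k => ⟨_, hf k⟩) k| ≤ a := fun k => by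
      have h0 : 0 ≤ (v k - q₀ k + ρ) / a := by
        have := (abs_le.1 (hk k)).1
        apply div_nonneg _ ha0.le; linarith
      have h3 := Nat.floor_le h0
      have h4 := (Nat.lt_floor_add_one ((v k - q₀ k + ρ) / a)).le
      rw [le_div_iff₀ ha0] at h3
      rw [div_le_iff₀ ha0] at h4
      simp only [hG, PiLp.sub_apply]
      rw [abs_le]; constructor <;> linarith
    refine (Finset.sum_le_sum fun k _ => h2 k).trans ?_
    rw [Finset.sum_const, Finset.card_univ, Fintype.card_fin, nsmul_eq_mul, ha,
      mul_div_assoc', div_le_iff₀ (by positivity)]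
    nlinarith

/-- Union bound over a grid: if a failure at `w` forces a failure at all grid points near `w`, then
the probability of a failure anywhere in a ball is controlled. -/
lemma measure_exists_le_of_grid {m : ℕ} {Ω : Type*} [MeasurableSpace Ω] (μ : Measure Ω)
    (q₀ : Vec m) {ρ s κ : ℝ} (hρ : 0 ≤ ρ) (hs : 0 < s) {A A' : Vec m → Ω → Prop}
    (hA : ∀ w q D, ‖w - q‖ ≤ s → ‖q - q₀‖ ≤ ρ + s → A w D → A' q D)
    (hA' : ∀ q, ‖q - q₀‖ ≤ ρ + s → μ {D | A' q D} ≤ ENNReal.ofReal κ) :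
    μ {D | ∃ w, ‖w - q₀‖ ≤ ρ ∧ A w D} ≤
      ENNReal.ofReal ((2 * (m + 1) * (ρ / s) + 1) ^ m * κ) := by
  classical
  obtain ⟨T, hT, hcov⟩ := exists_grid m q₀ hρ hs
  set T' := T.filter fun q => ‖q - q₀‖ ≤ ρ + s
  have h1 : {D | ∃ w, ‖w - q₀‖ ≤ ρ ∧ A w D} ⊆ ⋃ q ∈ T', {D | A' q D} := by
    rintro D ⟨w, hw, hAw⟩
    obtain ⟨q, hq, hwq⟩ := hcov w hw
    have h2 : ‖q - q₀‖ ≤ ρ + s := by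
      calc ‖q - q₀‖ = ‖(w - q₀) - (w - q)‖ := by congr 1; abel
        _ ≤ ‖w - q₀‖ + ‖w - q‖ := norm_sub_le _ _
        _ ≤ _ := by gcongr
    exact Set.mem_biUnion (Finset.mem_filter.2 ⟨hq, h2⟩) (hA w q D hwq h2 hAw)
  refine (measure_mono h1).trans ((measure_biUnion_finset_le _ _).trans ?_)
  refine (Finset.sum_le_sum fun q hq => hA' q (Finset.mem_filter.1 hq).2).trans ?_
  rw [Finset.sum_const, nsmul_eq_mul, ENNReal.ofReal_mul (by positivity)]
  gcongr
  rw [← ENNReal.ofReal_natCast]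
  refine ENNReal.ofReal_le_ofReal (le_trans ?_ hT)
  exact_mod_cast Finset.card_filter_le _ _

/-! ### The law of the data -/

lemma mem_labels {y : ℝ} : y ∈ labels ↔ y = 1 ∨ y = -1 := by simp [labels]

lemma abs_eq_one_of_mem_labels {y : ℝ} (h : y ∈ labels) : |y| = 1 := by
  rcases mem_labels.1 h with h | h <;> simp [h]

section law
variable {m : ℕ} {p : Vec m → ℝ → ℝ} {R : ℝ}

lemma IsDataDensity.continuous (hp : IsDataDensity p R) {y : ℝ} (hy : y ∈ labels) :
    Continuous fun x => p x y := by
  obtain ⟨L, hL⟩ := hp.lipschitz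
  exact (hL y hy).continuous

lemma IsDataDensity.norm_lt (hp : IsDataDensity p R) {y : ℝ} (hy : y ∈ labels) {x : Vec m}
    (h : p x y ≠ 0) : ‖x‖ < R := by
  by_contra hx
  exact h (hp.support y hy x (not_lt.1 hx))

lemma IsDataDensity.R_pos (hp : IsDataDensity p R) : 0 < R := by
  by_contra hR
  have h : ∀ y ∈ labels, ∀ x, p x y = 0 := fun y hy x =>
    hp.support y hy x ((not_lt.1 hR).trans (norm_nonneg x))
  have h1 := hp.total
  rw [Finset.sum_eq_zero] at h1
  · exact zero_ne_one h1
  · intro y hy; simp [h y hy]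

lemma IsDataDensity.hasCompactSupport (hp : IsDataDensity p R) {y : ℝ} (hy : y ∈ labels) :
    HasCompactSupport fun x => p x y := by
  refine HasCompactSupport.intro (isCompact_closedBall (0 : Vec m) R) fun x hx => ?_
  refine hp.support y hy x ?_
  simp only [Metric.mem_closedBall, dist_zero_right, not_le] at hx
  exact hx.le

lemma IsDataDensity.integrable (hp : IsDataDensity p R) {y : ℝ} (hy : y ∈ labels) :
    Integrable fun x => p x y :=
  (hp.continuous hy).integrable_of_hasCompactSupport (hp.hasCompactSupport hy)

lemma IsDataDensity.exists_bound (hp : IsDataDensity p R) :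
    ∃ P : ℝ, 0 < P ∧ ∀ y ∈ labels, ∀ x, p x y ≤ P := by
  have h : ∀ y ∈ labels, ∃ P : ℝ, ∀ x, p x y ≤ P := fun y hy => by
    obtain ⟨P, hP⟩ := (isCompact_closedBall (0 : Vec m) R).exists_bound_of_continuousOn
      (hp.continuous hy).continuousOn
    refine ⟨max P 0, fun x => ?_⟩
    by_cases hx : ‖x‖ ≤ R
    · exact (le_abs_self _).trans ((hP x (by simpa using hx)).trans (le_max_left _ _))
    · rw [hp.support y hy x (not_le.1 hx).le]; exact le_max_right _ _
  obtain ⟨P₁, h₁⟩ := h 1 (by simp [labels])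
  obtain ⟨P₂, h₂⟩ := h (-1) (by simp [labels])
  refine ⟨max 1 (max P₁ P₂), by positivity, fun y hy x => ?_⟩
  rcases mem_labels.1 hy with rfl | rfl
  · exact (h₁ x).trans ((le_max_left _ _).trans (le_max_right _ _))
  · exact (h₂ x).trans ((le_max_right _ _).trans (le_max_right _ _))

lemma lintegral_dataLaw (hp : IsDataDensity p R) {f : Vec m × ℝ → ℝ≥0∞} (hf : Measurable f) :
    ∫⁻ z, f z ∂dataLaw p = ∑ y ∈ labels, ∫⁻ x, ENNReal.ofReal (p x y) * f (x, y) := by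
  rw [dataLaw, lintegral_finsetSum_measure]
  refine Finset.sum_congr rfl fun y hy => ?_
  rw [lintegral_map hf (by fun_prop)]
  exact lintegral_withDensity_eq_lintegral_mul _ (hp.continuous hy).measurable.ennreal_ofReal
    (hf.comp (by fun_prop))

lemma isProbabilityMeasure_dataLaw (hp : IsDataDensity p R) : IsProbabilityMeasure (dataLaw p) := by
  constructor
  have h := lintegral_dataLaw hp (f := fun _ => 1) measurable_const
  rw [lintegral_one] at h
  simp only [mul_one] at h
  rw [h, ← ENNReal.ofReal_one, ← hp.total, ENNReal.ofReal_sum_of_nonneg]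
  · refine Finset.sum_congr rfl fun y hy => ?_
    rw [ofReal_integral_eq_lintegral_ofReal (hp.integrable hy)
      (Filter.Eventually.of_forall (hp.nonneg y hy))]
  · exact fun y hy => integral_nonneg (hp.nonneg y hy)

lemma measurableSet_dataRange : MeasurableSet (dataRange m R) := by
  refine ((isClosed_eq (f := fun z : Vec m × ℝ => |z.2|) (by fun_prop) continuous_const).inter
    (isClosed_le (f := fun z : Vec m × ℝ => ‖z.1‖) (by fun_prop) continuous_const)).measurableSet

lemma ae_mem_dataRange (hp : IsDataDensity p R) : ∀ᵐ z ∂dataLaw p, z ∈ dataRange m R := by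
  rw [ae_iff]
  change dataLaw p (dataRange m R)ᶜ = 0
  rw [← lintegral_indicator_one measurableSet_dataRange.compl,
    lintegral_dataLaw hp (measurable_one.indicator measurableSet_dataRange.compl)]
  refine Finset.sum_eq_zero fun y hy => ?_
  rw [lintegral_eq_zero_iff' (by
    refine ((hp.continuous hy).measurable.ennreal_ofReal.mul ?_).aemeasurable
    exact (measurable_one.indicator measurableSet_dataRange.compl).comp (by fun_prop))]
  refine Filter.Eventually.of_forall fun x => ?_
  by_cases h : p x y = 0
  · simp [h]
  · have : (x, y) ∈ dataRange m R := ⟨abs_eq_one_of_mem_labels hy, (hp.norm_lt hy h).le⟩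
    simp [this]

lemma ae_sampleLaw (hp : IsDataDensity p R) (N : ℕ) :
    ∀ᵐ D ∂sampleLaw p N, ∀ i, D i ∈ dataRange m R := by
  have := isProbabilityMeasure_dataLaw hp
  rw [ae_all_iff]
  exact fun i => (measurePreserving_eval (fun _ : Fin N => dataLaw p) i).quasiMeasurePreserving.ae
    (ae_mem_dataRange hp)

lemma integrable_dataLaw (hp : IsDataDensity p R) {f : Vec m × ℝ → ℝ} (hf : Measurable f) {B : ℝ}
    (hB : ∀ z ∈ dataRange m R, |f z| ≤ B) : Integrable f (dataLaw p) := by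
  have := isProbabilityMeasure_dataLaw hp
  exact Integrable.of_bound hf.aestronglyMeasurable B
    ((ae_mem_dataRange hp).mono fun z hz => hB z hz)

lemma memLp_dataLaw (hp : IsDataDensity p R) {f : Vec m × ℝ → ℝ} (hf : Measurable f) {B : ℝ}
    (hB : ∀ z ∈ dataRange m R, |f z| ≤ B) : MemLp f 2 (dataLaw p) := by
  have := isProbabilityMeasure_dataLaw hp
  exact MemLp.of_bound hf.aestronglyMeasurable B
    ((ae_mem_dataRange hp).mono fun z hz => hB z hz)

lemma integral_dataLaw_mono (hp : IsDataDensity p R) {f g : Vec m × ℝ → ℝ}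
    (hg : Measurable g) {B : ℝ} (hfg : ∀ z ∈ dataRange m R, |f z| ≤ g z)
    (hB : ∀ z ∈ dataRange m R, g z ≤ B) : |∫ z, f z ∂dataLaw p| ≤ ∫ z, g z ∂dataLaw p := by
  rw [← Real.norm_eq_abs]
  refine norm_integral_le_of_norm_le (integrable_dataLaw hp hg (B := B) fun z hz => ?_)
    ((ae_mem_dataRange hp).mono hfg)
  rw [abs_of_nonneg ((abs_nonneg _).trans (hfg z hz))]
  exact hB z hz

/-- The expectation under the law of the data, written as integrals over feature space. -/
lemma integral_dataLaw (hp : IsDataDensity p R) {f : Vec m × ℝ → ℝ} (hf : Measurable f) {B : ℝ}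
    (hB : ∀ z ∈ dataRange m R, |f z| ≤ B) :
    ∫ z, f z ∂dataLaw p = ∑ y ∈ labels, ∫ x, p x y * f (x, y) := by
  have hint := integrable_dataLaw hp hf hB
  rw [dataLaw] at hint ⊢
  rw [integral_finsetSum_measure fun y hy => (integrable_finsetSum_measure.1 hint) y hy]
  refine Finset.sum_congr rfl fun y hy => ?_
  rw [integral_map (by fun_prop) hf.aestronglyMeasurable,
    integral_withDensity_eq_integral_toReal_smul (hp.continuous hy).measurable.ennreal_ofReal
    (Filter.Eventually.of_forall fun x => ENNReal.ofReal_lt_top)]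
  refine integral_congr_ae (Filter.Eventually.of_forall fun x => ?_)
  simp [ENNReal.toReal_ofReal (hp.nonneg y hy x)]

end law

/-! ### Mass of thin slabs -/

section slabs
variable {m : ℕ}

/-- Lebesgue integrals may be averaged over translates. -/
lemma lintegral_eq_lintegral_average {f : Vec m → ℝ≥0∞} (hf : Measurable f) (e : Vec m) :
    ∫⁻ x, f x = ∫⁻ x, ∫⁻ t in Set.Icc (0 : ℝ) 1, f (x + t • e) := by
  rw [lintegral_lintegral_swap (by fun_prop)]
  have : ∀ t : ℝ, ∫⁻ x, f (x + t • e) = ∫⁻ x, f x := fun t => lintegral_add_right_eq_self f (t • e)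
  simp [this]

lemma integrable_bump : Integrable bump := integrable_inv_one_add_sq

lemma lintegral_bump_affine (a : ℝ) {b s : ℝ} (hb : b ≠ 0) (hs : 0 < s) :
    ∫⁻ t : ℝ, ENNReal.ofReal (bump ((a - b * t) / s)) = ENNReal.ofReal (Real.pi * (s / |b|)) := by
  have h1 : ∀ t, bump ((a - b * t) / s) = (fun u => bump (u - a / s)) (b / s * t) := fun t => by
    unfold bump
    congr 2
    ring
  have h2 : b / s ≠ 0 := by positivity
  have hi : Integrable fun t => (fun u => bump (u - a / s)) (b / s * t) :=
    (integrable_bump.comp_sub_right (a / s)).comp_mul_left' h2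
  simp_rw [h1]
  rw [← ofReal_integral_eq_lintegral_ofReal hi
    (Filter.Eventually.of_forall fun t => (bump_pos _).le)]
  congr 1
  rw [Measure.integral_comp_mul_left (fun u => bump (u - a / s)), integral_sub_right_eq_self bump]
  have : ∫ x, bump x = Real.pi := integral_univ_inv_one_add_sq
  rw [this, inv_div, abs_div, abs_of_pos hs, smul_eq_mul]
  ring

lemma continuous_margin (w : Vec m) : Continuous (margin w) := by unfold margin; fun_prop

lemma margin_add (w x e : Vec m) (y : ℝ) : margin w (x + e, y) = margin w (x, y) - y * inner ℝ w e := by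
  simp only [margin, inner_add_right]; ring

lemma inner_self_unit {w : Vec m} (hw : w ≠ 0) : inner ℝ w (‖w‖⁻¹ • w) = ‖w‖ := by
  have : ‖w‖ ≠ 0 := norm_ne_zero_iff.2 hw
  rw [inner_smul_right, real_inner_self_eq_norm_sq]; field_simp

lemma norm_self_unit {w : Vec m} (hw : w ≠ 0) : ‖‖w‖⁻¹ • w‖ = 1 := by
  have : ‖w‖ ≠ 0 := norm_ne_zero_iff.2 hw
  rw [norm_smul, norm_inv, norm_norm, inv_mul_cancel₀ this]

lemma measurable_bump_margin (w : Vec m) (s : ℝ) :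
    Measurable fun z : Vec m × ℝ => bump (margin w z / s) :=
  (continuous_bump.comp ((continuous_margin w).div_const s)).measurable

/-- Upper bound for the volume of a slab of width `s / ‖w‖` in a ball. Averaging over translates in
the direction of `w` turns the integral over the ball into the integral of the bump over a line. -/
lemma lintegral_ball_bump_le {w : Vec m} (hw : w ≠ 0) {y s : ℝ} (hy : |y| = 1) (hs : 0 < s) (r : ℝ) :
    ∫⁻ x in Metric.ball 0 r, ENNReal.ofReal (bump (margin w (x, y) / s)) ≤
      volume (Metric.ball (0 : Vec m) (r + 1)) * ENNReal.ofReal (Real.pi * (s / ‖w‖)) := by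
  set e := ‖w‖⁻¹ • w with he
  have hmeas : Measurable fun x : Vec m => ENNReal.ofReal (bump (margin w (x, y) / s)) :=
    ((measurable_bump_margin w s).comp (by fun_prop)).ennreal_ofReal
  rw [← lintegral_indicator Metric.isOpen_ball.measurableSet,
    lintegral_eq_lintegral_average (hmeas.indicator Metric.isOpen_ball.measurableSet) e]
  have hw' : ‖w‖ ≠ 0 := norm_ne_zero_iff.2 hw
  have hb : y * ‖w‖ ≠ 0 := mul_ne_zero (by rintro rfl; simp at hy) hw'
  have key : ∀ x : Vec m, ∫⁻ t in Set.Icc (0 : ℝ) 1, (Metric.ball 0 r).indicator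
      (fun x => ENNReal.ofReal (bump (margin w (x, y) / s))) (x + t • e) ≤
      (Metric.ball 0 (r + 1)).indicator
        (fun _ => ENNReal.ofReal (Real.pi * (s / ‖w‖))) x := by
    intro x
    by_cases hx : x ∈ Metric.ball (0 : Vec m) (r + 1)
    · rw [Set.indicator_of_mem hx]
      refine (setLIntegral_le_lintegral _ _).trans ?_
      have h1 := lintegral_bump_affine (margin w (x, y)) hb hs
      rw [abs_mul, hy, one_mul, abs_norm] at h1
      rw [← h1]
      refine lintegral_mono fun t => ?_
      refine (Set.indicator_le_self _ _ _).trans ?_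
      rw [margin_add, inner_smul_right, he, inner_self_unit hw]
      exact le_of_eq (by congr 3; ring)
    · rw [Set.indicator_of_notMem hx]
      refine le_of_eq ((setLIntegral_congr_fun measurableSet_Icc fun t ht => ?_).trans
        (lintegral_zero))
      refine Set.indicator_of_notMem (fun h => hx ?_) _
      simp only [Metric.mem_ball, dist_zero_right] at h ⊢
      have h2 : ‖t • e‖ ≤ 1 := by
        rw [norm_smul, he, norm_self_unit hw, mul_one, Real.norm_eq_abs, abs_of_nonneg ht.1]
        exact ht.2
      calc ‖x‖ = ‖(x + t • e) - t • e‖ := by rw [add_sub_cancel_right]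
        _ ≤ ‖x + t • e‖ + ‖t • e‖ := norm_sub_le _ _
        _ < r + 1 := by linarith
  refine (lintegral_mono key).trans ?_
  rw [lintegral_indicator Metric.isOpen_ball.measurableSet, setLIntegral_const, mul_comm]

/-- Lower bound for the volume of a slab in a ball centred near the margin hyperplane, by averaging
over the translates in the direction of `w` that stay within the ball. -/
lemma le_lintegral_ball_bump_sq {w z : Vec m} (hw : w ≠ 0) {y s r : ℝ} (hy : |y| = 1) (hs : 0 < s)
    (hr : 0 < r) (hz : |margin w (z, y)| ≤ r * ‖w‖ / 8) (hsr : s ≤ r * ‖w‖ / 4) :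
    volume (Metric.ball (0 : Vec m) (r / 8)) * ENNReal.ofReal (s / (2 * (r * ‖w‖))) ≤
      ∫⁻ x in Metric.ball z r, ENNReal.ofReal (bump (margin w (x, y) / s) ^ 2) := by
  set e := ‖w‖⁻¹ • w with he
  have hw' : 0 < ‖w‖ := norm_pos_iff.2 hw
  have hne : ‖e‖ = 1 := norm_self_unit hw
  have hmeas : Measurable fun x : Vec m => ENNReal.ofReal (bump (margin w (x, y) / s) ^ 2) :=
    (((measurable_bump_margin w s).comp (by fun_prop)).pow_const 2).ennreal_ofReal
  rw [← lintegral_indicator Metric.isOpen_ball.measurableSet,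
    lintegral_eq_lintegral_average (hmeas.indicator Metric.isOpen_ball.measurableSet) (r • e)]
  -- the translation carries the ball around `z - (r / 2) e` through the slab
  set B := Metric.ball (z - (r / 2) • e) (r / 8) with hB
  have hvol : volume (Metric.ball (0 : Vec m) (r / 8)) = volume B :=
    (Measure.addHaar_ball_center _ _ _).symm
  rw [hvol, mul_comm, ← setLIntegral_const, ← lintegral_indicator Metric.isOpen_ball.measurableSet]
  refine lintegral_mono fun x => ?_
  by_cases hx : x ∈ B
  swap
  · rw [Set.indicator_of_notMem hx]; exact zero_le
  rw [Set.indicator_of_mem hx]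
  obtain ⟨v, hv, rfl⟩ : ∃ v : Vec m, ‖v‖ < r / 8 ∧ x = z - (r / 2) • e + v :=
    ⟨x - (z - (r / 2) • e), by simpa [hB, dist_eq_norm] using hx, by abel⟩
  have hmem : ∀ t ∈ Set.Icc (0 : ℝ) 1, z - (r / 2) • e + v + t • r • e ∈ Metric.ball z r := by
    intro t ht
    rw [Metric.mem_ball, dist_eq_norm,
      show z - (r / 2) • e + v + t • r • e - z = v + (t * r - r / 2) • e by module]
    have h1 : ‖(t * r - r / 2) • e‖ ≤ r / 2 := by
      rw [norm_smul, hne, mul_one, Real.norm_eq_abs, abs_le]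
      constructor <;> nlinarith [ht.1, ht.2]
    linarith [norm_add_le v ((t * r - r / 2) • e)]
  have hmar : ∀ t : ℝ, margin w (z - (r / 2) • e + v + t • r • e, y) =
      margin w (z, y) - y * inner ℝ w v - y * ((t - 1 / 2) * (r * ‖w‖)) := by
    intro t
    rw [show z - (r / 2) • e + v + t • r • e = z + (v + ((t - 1 / 2) * r) • e) by module,
      margin_add, inner_add_right, inner_smul_right, he, inner_self_unit hw]
    ring
  set a := margin w (z, y) - y * inner ℝ w v with ha
  have ha' : |a| ≤ r * ‖w‖ / 4 := by
    have h1 : |y * inner ℝ w v| ≤ r * ‖w‖ / 8 := by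
      rw [abs_mul, hy, one_mul]
      refine (abs_real_inner_le_norm w v).trans ?_
      nlinarith
    have := abs_sub (margin w (z, y)) (y * inner ℝ w v)
    rw [ha]; linarith
  have hyy : y * y = 1 := by rw [← abs_mul_abs_self, hy]; norm_num
  have hrw : 0 < r * ‖w‖ := by positivity
  set t₀ := 1 / 2 + y * a / (r * ‖w‖) with ht₀
  have h4 : |y * a / (r * ‖w‖)| ≤ 1 / 4 := by
    rw [abs_div, abs_mul, hy, one_mul, abs_of_pos hrw, div_le_iff₀ hrw]; linarith
  have h5 : s / (r * ‖w‖) ≤ 1 / 4 := by rw [div_le_iff₀ hrw]; linarith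
  set I := Set.Icc (t₀ - s / (r * ‖w‖)) (t₀ + s / (r * ‖w‖)) with hI
  have hIsub : I ⊆ Set.Icc (0 : ℝ) 1 := by
    have := abs_le.1 h4
    apply Set.Icc_subset_Icc <;> linarith
  have hlow : ∀ t ∈ I, ENNReal.ofReal (1 / 4) ≤ (Metric.ball z r).indicator
      (fun x => ENNReal.ofReal (bump (margin w (x, y) / s) ^ 2))
      (z - (r / 2) • e + v + t • r • e) := by
    intro t ht
    rw [Set.indicator_of_mem (hmem t (hIsub ht)), hmar]
    refine ENNReal.ofReal_le_ofReal ?_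
    have h6 : |(a - y * ((t - 1 / 2) * (r * ‖w‖))) / s| ≤ 1 := by
      have h7 : a - y * ((t - 1 / 2) * (r * ‖w‖)) = -(y * ((t - t₀) * (r * ‖w‖))) := by
        have h8 : t - t₀ = (t - 1 / 2) - y * a / (r * ‖w‖) := by rw [ht₀]; ring
        have h9 : y * a / (r * ‖w‖) * (r * ‖w‖) = y * a := div_mul_cancel₀ _ hrw.ne'
        rw [h8]
        linear_combination (-a) * hyy - y * h9
      rw [h7, abs_div, abs_neg, abs_mul, hy, one_mul, abs_mul, abs_of_pos hrw, abs_of_pos hs,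
        div_le_one hs, ← le_div_iff₀ hrw, abs_le]
      constructor <;> linarith [ht.1, ht.2]
    have h10 : 1 / 2 ≤ bump ((a - y * ((t - 1 / 2) * (r * ‖w‖))) / s) := by
      unfold bump
      rw [one_div]
      refine inv_anti₀ (by positivity) ?_
      have := (sq_le_one_iff_abs_le_one _).2 h6
      linarith
    nlinarith
  calc ENNReal.ofReal (s / (2 * (r * ‖w‖)))
      = ENNReal.ofReal (1 / 4) * volume I := by
        rw [hI, Real.volume_Icc, ← ENNReal.ofReal_mul (by norm_num)]
        congr 1
        field_simp; ring
    _ = ∫⁻ t in I, ENNReal.ofReal (1 / 4) := (setLIntegral_const _ _).symm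
    _ ≤ _ := (setLIntegral_mono' measurableSet_Icc hlow).trans (lintegral_mono_set hIsub)

end slabs

section slabLaw
variable {m : ℕ} {p : Vec m → ℝ → ℝ} {R : ℝ}

lemma abs_bump_le_one (u : ℝ) : |bump u| ≤ 1 := by
  rw [abs_of_pos (bump_pos u)]; exact bump_le_one u

/-- For `w` so small that no data point is near its margin hyperplane, the bump is tiny. -/
lemma bump_margin_le_of_small (hR : 0 < R) {w : Vec m} (hw : ‖w‖ ≤ 1 / (2 * R)) {s : ℝ} (hs : 0 < s)
    {z : Vec m × ℝ} (hz : z ∈ dataRange m R) : bump (margin w z / s) ≤ 4 * s ^ 2 := by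
  have h1 : 1 / 2 ≤ margin w z := by
    have h2 : |z.2 * inner ℝ w z.1| ≤ 1 / 2 := by
      rw [abs_mul, hz.1, one_mul]
      refine (abs_real_inner_le_norm _ _).trans ?_
      calc ‖w‖ * ‖z.1‖ ≤ 1 / (2 * R) * R := by gcongr; exact hz.2
        _ = 1 / 2 := by field_simp
    have := (abs_le.1 h2).2
    unfold margin; linarith
  unfold bump
  rw [inv_le_iff_one_le_mul₀ (by positivity), div_pow]
  have h3 : 4 * s ^ 2 * (1 + margin w z ^ 2 / s ^ 2) = 4 * s ^ 2 + 4 * margin w z ^ 2 := by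
    field_simp
  rw [h3]; nlinarith [sq_nonneg s]

/-- A slab of width `s` around any margin hyperplane has mass `O(s)`. -/
lemma exists_integral_bump_le (hp : IsDataDensity p R) :
    ∃ C : ℝ, 1 ≤ C ∧ ∀ (w : Vec m) (s : ℝ), 0 < s →
      ∫ z, bump (margin w z / s) ∂dataLaw p ≤ C * s := by
  have := isProbabilityMeasure_dataLaw hp
  have hR := hp.R_pos
  obtain ⟨P, hP, hpP⟩ := hp.exists_bound
  set V := (volume (Metric.ball (0 : Vec m) (R + 1))).toReal with hV
  have hV' : volume (Metric.ball (0 : Vec m) (R + 1)) = ENNReal.ofReal V :=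
    (ENNReal.ofReal_toReal measure_ball_lt_top.ne).symm
  have hV0 : 0 ≤ V := ENNReal.toReal_nonneg
  refine ⟨4 + 2 * (P * (V * (Real.pi * (2 * R)))), by
    have : 0 ≤ P * (V * (Real.pi * (2 * R))) := by positivity
    linarith, fun w s hs => ?_⟩
  have hint : Integrable (fun z => bump (margin w z / s)) (dataLaw p) :=
    integrable_dataLaw hp (measurable_bump_margin w s) fun z _ => abs_bump_le_one _
  have hC0 : 0 ≤ 2 * (P * (V * (Real.pi * (2 * R)))) * s := by positivity
  rw [add_mul]
  rcases le_or_gt ‖w‖ (1 / (2 * R)) with hw | hw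
  · have h1 : ∫ z, bump (margin w z / s) ∂dataLaw p ≤ 4 * s := by
      rcases le_or_gt s 1 with h | h
      · calc ∫ z, bump (margin w z / s) ∂dataLaw p ≤ ∫ z, 4 * s ∂dataLaw p := by
              refine integral_mono_ae hint (integrable_const _) ((ae_mem_dataRange hp).mono
                fun z hz => (bump_margin_le_of_small hR hw hs hz).trans ?_)
              nlinarith
          _ = 4 * s := by simp
      · calc ∫ z, bump (margin w z / s) ∂dataLaw p ≤ ∫ z, 1 ∂dataLaw p :=
              integral_mono hint (integrable_const _) fun z => bump_le_one _
          _ = 1 := by simp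
          _ ≤ 4 * s := by linarith
    linarith
  · have hw0 : w ≠ 0 := by
      rintro rfl
      rw [norm_zero] at hw
      exact absurd hw (not_lt.2 (by positivity))
    have h1 : ENNReal.ofReal (∫ z, bump (margin w z / s) ∂dataLaw p) ≤
        ENNReal.ofReal (2 * (P * (V * (Real.pi * (2 * R)))) * s) := by
      rw [ofReal_integral_eq_lintegral_ofReal hint
        (Filter.Eventually.of_forall fun z => (bump_pos _).le),
        lintegral_dataLaw hp (measurable_bump_margin w s).ennreal_ofReal]
      have hy : ∀ y ∈ labels, ∫⁻ x, ENNReal.ofReal (p x y) *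
          ENNReal.ofReal (bump (margin w (x, y) / s)) ≤
          ENNReal.ofReal (P * (V * (Real.pi * (2 * R))) * s) := by
        intro y hy
        calc _ ≤ ∫⁻ x, (Metric.ball (0 : Vec m) R).indicator (fun x => ENNReal.ofReal P *
              ENNReal.ofReal (bump (margin w (x, y) / s))) x := by
              refine lintegral_mono fun x => ?_
              by_cases hx : x ∈ Metric.ball (0 : Vec m) R
              · rw [Set.indicator_of_mem hx]
                gcongr
                exact hpP y hy x
              · have : p x y = 0 := hp.support y hy x (by simpa using hx)
                simp [this]
          _ = ENNReal.ofReal P * ∫⁻ x in Metric.ball 0 R,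
              ENNReal.ofReal (bump (margin w (x, y) / s)) := by
              rw [lintegral_indicator Metric.isOpen_ball.measurableSet, lintegral_const_mul]
              exact ((measurable_bump_margin w s).comp (by fun_prop)).ennreal_ofReal
          _ ≤ ENNReal.ofReal P * (ENNReal.ofReal V * ENNReal.ofReal (Real.pi * (s / ‖w‖))) := by
              rw [← hV']
              gcongr
              exact lintegral_ball_bump_le hw0 (abs_eq_one_of_mem_labels hy) hs R
          _ = ENNReal.ofReal (P * (V * (Real.pi * (s / ‖w‖)))) := by
              rw [← ENNReal.ofReal_mul hV0, ← ENNReal.ofReal_mul hP.le]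
          _ ≤ _ := by
              refine ENNReal.ofReal_le_ofReal ?_
              have h2 : s / ‖w‖ ≤ 2 * R * s := by
                rw [div_le_iff₀ (norm_pos_iff.2 hw0)]
                rw [div_lt_iff₀ (by positivity)] at hw
                nlinarith
              calc P * (V * (Real.pi * (s / ‖w‖))) ≤ P * (V * (Real.pi * (2 * R * s))) := by gcongr
                _ = _ := by ring
      refine (Finset.sum_le_sum hy).trans ?_
      have hcard : labels.card = 2 := by
        rw [labels, Finset.card_pair (by norm_num)]
      rw [Finset.sum_const, hcard, two_nsmul, ← ENNReal.ofReal_add (by positivity) (by positivity)]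
      exact ENNReal.ofReal_le_ofReal (by linarith)
    have h2 := (ENNReal.ofReal_le_ofReal_iff hC0).1 h1
    linarith

end slabLaw

/-! ### Data near the margin hyperplanes -/

/-- The data points with label `y` and features in the ball of radius `r` around `z`. -/
def piece {m : ℕ} (z : Vec m) (r y : ℝ) : Set (Vec m × ℝ) := {q | q.1 ∈ Metric.ball z r ∧ q.2 = y}

/-- The squared bump of width `s` around the margin hyperplane of `w`, cut off to a piece. -/
def localBump {m : ℕ} (z : Vec m) (r y s : ℝ) (w : Vec m) : Vec m × ℝ → ℝ :=
  (piece z r y).indicator fun q => bump (margin w q / s) ^ 2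

/-- Finitely many balls of radius `r`, centred on the margin hyperplane `{x | y w⋆ᵀx = 1}`, on which
the density is at least `c₀`, such that for every direction `e` one of them stays away from the
hyperplane orthogonal to `e`. -/
structure IsSpanning {m : ℕ} (p : Vec m → ℝ → ℝ) (wst : Vec m) (y : ℝ) (Z : Finset (Vec m))
    (r c₀ : ℝ) : Prop where
  label : y ∈ labels
  r_pos : 0 < r
  c_pos : 0 < c₀
  margin_eq : ∀ z ∈ Z, margin wst (z, y) = 0
  density : ∀ z ∈ Z, ∀ x ∈ Metric.ball z r, c₀ ≤ p x y
  direction : ∀ e : Vec m, ∃ z ∈ Z, ∀ x ∈ Metric.ball z r, r * ‖e‖ ≤ |inner ℝ x e|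

section
variable {m : ℕ} {p : Vec m → ℝ → ℝ} {R : ℝ}

lemma measurableSet_piece (z : Vec m) (r y : ℝ) : MeasurableSet (piece z r y) :=
  (Metric.isOpen_ball.measurableSet.preimage measurable_fst).inter
    ((measurableSet_singleton y).preimage measurable_snd)

lemma measurable_localBump (z : Vec m) (r y s : ℝ) (w : Vec m) :
    Measurable (localBump z r y s w) :=
  ((measurable_bump_margin w s).pow_const 2).indicator (measurableSet_piece z r y)

lemma localBump_nonneg (z : Vec m) (r y s : ℝ) (w : Vec m) (q : Vec m × ℝ) :
    0 ≤ localBump z r y s w q := Set.indicator_nonneg (fun _ _ => by positivity) _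

lemma localBump_le (z : Vec m) (r y s : ℝ) (w : Vec m) (q : Vec m × ℝ) :
    localBump z r y s w q ≤ bump (margin w q / s) :=
  (Set.indicator_le_self' (fun _ _ => by positivity) _).trans (bump_sq_le _)

lemma localBump_le_one (z : Vec m) (r y s : ℝ) (w : Vec m) (q : Vec m × ℝ) :
    localBump z r y s w q ≤ 1 := (localBump_le z r y s w q).trans (bump_le_one _)

lemma exists_pos_density_of_marginMass {w : Vec m} (h : 0 < marginMass p w) :
    ∃ y ∈ labels, ∃ x, y = inner ℝ w x ∧ 0 < p x y := by
  by_contra! hcon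
  refine h.ne' (Finset.sum_eq_zero fun y hy => ?_)
  have hS : MeasurableSet {x : Vec m | y = inner ℝ w x} :=
    (isClosed_eq continuous_const (by fun_prop)).measurableSet
  rw [setLIntegral_congr_fun hS (g := fun _ => 0) fun x hx =>
    ENNReal.ofReal_eq_zero.2 (hcon y hy x hx)]
  simp

/-- Positive mass on the margin hyperplanes gives balls that span. The density is positive near some
point of a hyperplane which does not pass through the origin, so no direction is orthogonal to all
points of the hyperplane nearby; by compactness of the unit sphere finitely many balls suffice. -/
lemma exists_isSpanning (hp : IsDataDensity p R) {w : Vec m} (h : 0 < marginMass p w) :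
    ∃ y Z r c₀, IsSpanning p w y Z r c₀ := by
  classical
  obtain ⟨y, hy, x₀, hx₀, hpos⟩ := exists_pos_density_of_marginMass h
  have hyy : y * y = 1 := by rw [← abs_mul_abs_self, abs_eq_one_of_mem_labels hy]; norm_num
  have hy0 : y ≠ 0 := by rintro rfl; simp at hyy
  have hw : w ≠ 0 := by rintro rfl; simp at hx₀; exact hy0 hx₀
  obtain ⟨r₁, hr₁, hball⟩ := Metric.continuous_iff.1 (hp.continuous hy) x₀ (p x₀ y / 2) (by linarith)
  have hdens : ∀ x, ‖x - x₀‖ < r₁ → p x₀ y / 2 ≤ p x y := fun x hx => by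
    have := hball x (by rwa [dist_eq_norm])
    rw [Real.dist_eq] at this
    linarith [(abs_lt.1 this).1]
  -- every direction is seen by some point of the hyperplane near `x₀`
  have hpt : ∀ e : Vec m, ‖e‖ = 1 →
      ∃ z : Vec m, ‖z - x₀‖ < r₁ / 2 ∧ inner ℝ w z = y ∧ inner ℝ z e ≠ 0 := by
    intro e he
    by_cases h0 : inner ℝ x₀ e = 0
    · have hww : 0 < ‖w‖ ^ 2 := by positivity
      set v := e - (inner ℝ w e / ‖w‖ ^ 2) • w with hv
      have hwv : inner ℝ w v = 0 := by
        rw [hv, inner_sub_right, inner_smul_right, real_inner_self_eq_norm_sq]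
        field_simp; ring
      have hv0 : v ≠ 0 := by
        intro hv0
        have he' : e = (inner ℝ w e / ‖w‖ ^ 2) • w := sub_eq_zero.1 hv0
        rw [he', inner_smul_right, real_inner_comm w x₀, ← hx₀] at h0
        rcases mul_eq_zero.1 h0 with h1 | h1
        · rw [h1, zero_smul] at he'
          rw [he', norm_zero] at he
          exact zero_ne_one he
        · exact hy0 h1
      have hve : inner ℝ v e = ‖v‖ ^ 2 := by
        rw [← real_inner_self_eq_norm_sq]
        conv_rhs => rw [hv, inner_sub_right, ← hv, inner_smul_right, real_inner_comm w v, hwv]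
        simp
      have hvn : 0 < ‖v‖ := norm_pos_iff.2 hv0
      refine ⟨x₀ + (r₁ / (4 * ‖v‖)) • v, ?_, ?_, ?_⟩
      · rw [add_sub_cancel_left, norm_smul, Real.norm_eq_abs, abs_of_pos (by positivity)]
        have : r₁ / (4 * ‖v‖) * ‖v‖ = r₁ / 4 := by field_simp
        rw [this]; linarith
      · rw [inner_add_right, inner_smul_right, hwv, ← hx₀]; simp
      · rw [inner_add_left, inner_smul_left, h0, hve, RCLike.conj_to_real]; positivity
    · exact ⟨x₀, by simpa using hr₁, hx₀.symm, h0⟩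
  choose! ζ hζ using hpt
  obtain ⟨t, ht, hcov⟩ := (isCompact_sphere (0 : Vec m) 1).elim_nhds_subcover
    (fun e => {e' | |inner ℝ (ζ e) e| / 2 < |inner ℝ (ζ e) e'|}) (by
      intro e he
      have h1 := (hζ e (by simpa using he)).2.2
      refine IsOpen.mem_nhds (isOpen_lt continuous_const (by fun_prop)) ?_
      exact half_lt_self (abs_pos.2 h1))
  obtain ⟨δ, hδ, hδt⟩ : ∃ δ : ℝ, 0 < δ ∧ ∀ e ∈ t, δ ≤ |inner ℝ (ζ e) e| / 2 := by
    rcases t.eq_empty_or_nonempty with h0 | h0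
    · exact ⟨1, one_pos, by simp [h0]⟩
    · obtain ⟨e₀, he₀, hmin⟩ := t.exists_min_image (fun e => |inner ℝ (ζ e) e| / 2) h0
      exact ⟨_, half_pos (abs_pos.2 (hζ e₀ (by simpa using ht e₀ he₀)).2.2), hmin⟩
  have hZ : ∀ z ∈ insert x₀ (t.image ζ), ‖z - x₀‖ < r₁ / 2 ∧ inner ℝ w z = y := by
    intro z hz
    rcases Finset.mem_insert.1 hz with rfl | hz
    · exact ⟨by simpa using hr₁, hx₀.symm⟩
    · obtain ⟨e, he, rfl⟩ := Finset.mem_image.1 hz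
      have := hζ e (by simpa using ht e he)
      exact ⟨this.1, this.2.1⟩
  refine ⟨y, insert x₀ (t.image ζ), min (r₁ / 2) (δ / 2), p x₀ y / 2, ⟨hy, by positivity,
    by positivity, fun z hz => ?_, fun z hz x hx => ?_, fun e => ?_⟩⟩
  · simp only [margin]; rw [(hZ z hz).2, hyy, sub_self]
  · apply hdens
    have h1 : ‖x - z‖ < r₁ / 2 := by
      rw [← dist_eq_norm]; exact (Metric.mem_ball.1 hx).trans_le (min_le_left _ _)
    calc ‖x - x₀‖ = ‖(x - z) + (z - x₀)‖ := by congr 1; abel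
      _ ≤ ‖x - z‖ + ‖z - x₀‖ := norm_add_le _ _
      _ < r₁ := by linarith [(hZ z hz).1]
  · rcases eq_or_ne e 0 with rfl | he
    · exact ⟨x₀, by simp, fun x _ => by simp⟩
    have hn : 0 < ‖e‖ := norm_pos_iff.2 he
    have hmem : ‖e‖⁻¹ • e ∈ Metric.sphere (0 : Vec m) 1 := by simp [norm_self_unit he]
    obtain ⟨e₁, he₁, h1⟩ := Set.mem_iUnion₂.1 (hcov hmem)
    refine ⟨ζ e₁, by simp [Finset.mem_image_of_mem ζ he₁], fun x hx => ?_⟩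
    have h2 : δ * ‖e‖ ≤ |inner ℝ (ζ e₁) e| := by
      have h3 : |inner ℝ (ζ e₁) e₁| / 2 < |inner ℝ (ζ e₁) (‖e‖⁻¹ • e)| := h1
      rw [inner_smul_right, abs_mul, abs_of_pos (inv_pos.2 hn), ← div_eq_inv_mul,
        lt_div_iff₀ hn] at h3
      refine le_trans ?_ h3.le
      gcongr
      exact hδt e₁ he₁
    have h4 : |inner ℝ (x - ζ e₁) e| ≤ δ / 2 * ‖e‖ := by
      refine (abs_real_inner_le_norm _ _).trans ?_
      gcongr
      rw [← dist_eq_norm]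
      exact (Metric.mem_ball.1 hx).le.trans (min_le_right _ _)
    have h5 : inner ℝ x e = inner ℝ (ζ e₁) e + inner ℝ (x - ζ e₁) e := by
      rw [← inner_add_left]; congr 1; abel
    have h6 : min (r₁ / 2) (δ / 2) * ‖e‖ ≤ δ / 2 * ‖e‖ := by
      gcongr; exact min_le_right _ _
    have h7 := abs_add_le (inner ℝ x e) (-inner ℝ (x - ζ e₁) e)
    rw [abs_neg, show inner ℝ x e + -inner ℝ (x - ζ e₁) e = inner ℝ (ζ e₁) e by rw [h5]; ring] at h7
    linarith

variable {wst : Vec m} {y r c₀ : ℝ} {Z : Finset (Vec m)}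

lemma IsSpanning.wst_ne_zero (h : IsSpanning p wst y Z r c₀) : wst ≠ 0 := by
  rintro rfl
  obtain ⟨z, hz, -⟩ := h.direction 0
  have := h.margin_eq z hz
  simp [margin] at this

lemma IsSpanning.norm_lt (hp : IsDataDensity p R) (h : IsSpanning p wst y Z r c₀) {z : Vec m}
    (hz : z ∈ Z) : ‖z‖ < R := by
  refine hp.norm_lt h.label (x := z) ?_
  have := h.density z hz z (Metric.mem_ball_self h.r_pos)
  have := h.c_pos
  linarith

lemma abs_margin_sub_le {w v : Vec m} {q : Vec m × ℝ} (hq : q ∈ dataRange m R) :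
    |margin w q - margin v q| ≤ ‖w - v‖ * R := by
  have : margin w q - margin v q = -(q.2 * inner ℝ (w - v) q.1) := by
    simp only [margin, inner_sub_left]; ring
  rw [this, abs_neg, abs_mul, hq.1, one_mul]
  exact (abs_real_inner_le_norm _ _).trans (by gcongr; exact hq.2)

/-- The mass of a piece is at least `c₀` times a volume. -/
lemma lintegral_piece_ge (hp : IsDataDensity p R) {y : ℝ} (hy : y ∈ labels) {z : Vec m} {r : ℝ}
    (hd : ∀ x ∈ Metric.ball z r, c₀ ≤ p x y) {f : Vec m × ℝ → ℝ≥0∞}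
    (hf : Measurable f) :
    ENNReal.ofReal c₀ * ∫⁻ x in Metric.ball z r, f (x, y) ≤
      ∫⁻ q, (piece z r y).indicator f q ∂dataLaw p := by
  rw [lintegral_dataLaw hp (hf.indicator (measurableSet_piece z r y))]
  refine le_trans ?_ (Finset.single_le_sum (fun _ _ => zero_le) hy)
  rw [← lintegral_const_mul _ (show Measurable fun x => f (x, y) from hf.comp (by fun_prop)),
    ← lintegral_indicator Metric.isOpen_ball.measurableSet]
  refine lintegral_mono fun x => ?_
  by_cases hx : x ∈ Metric.ball z r
  · rw [Set.indicator_of_mem hx, Set.indicator_of_mem (show (x, y) ∈ piece z r y from ⟨hx, rfl⟩)]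
    gcongr
    exact hd x hx
  · rw [Set.indicator_of_notMem hx]; exact zero_le

/-- Near `w⋆`, every piece of the slab of width `s` has mass of order `s`. -/
lemma exists_integral_localBump_ge (hp : IsDataDensity p R) (h : IsSpanning p wst y Z r c₀) :
    ∃ c r₁ s₁ : ℝ, 0 < c ∧ 0 < r₁ ∧ 0 < s₁ ∧ ∀ w, ‖w - wst‖ ≤ r₁ → ∀ s, 0 < s → s ≤ s₁ →
      ∀ z ∈ Z, c * s ≤ ∫ q, localBump z r y s w q ∂dataLaw p := by
  have := isProbabilityMeasure_dataLaw hp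
  have hR := hp.R_pos
  have hr := h.r_pos
  have hc₀ := h.c_pos
  have hn : 0 < ‖wst‖ := norm_pos_iff.2 h.wst_ne_zero
  set V := (volume (Metric.ball (0 : Vec m) (r / 8))).toReal with hV
  have hV' : volume (Metric.ball (0 : Vec m) (r / 8)) = ENNReal.ofReal V :=
    (ENNReal.ofReal_toReal measure_ball_lt_top.ne).symm
  have hV0 : 0 < V := ENNReal.toReal_pos
    (Metric.measure_ball_pos volume _ (by positivity)).ne' measure_ball_lt_top.ne
  refine ⟨c₀ * (V * (1 / (2 * (r * (2 * ‖wst‖))))), min (‖wst‖ / 2) (r * ‖wst‖ / (16 * R)),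
    r * ‖wst‖ / 8, by positivity, by positivity, by positivity, fun w hw s hs hs₁ z hz => ?_⟩
  have hw1 := hw.trans (min_le_left _ _)
  have hw2 := hw.trans (min_le_right _ _)
  have hlow : ‖wst‖ / 2 ≤ ‖w‖ := by
    have := norm_sub_norm_le wst w
    rw [norm_sub_rev] at this; linarith
  have hupp : ‖w‖ ≤ 2 * ‖wst‖ := by
    have := norm_sub_norm_le w wst; linarith
  have hw0 : w ≠ 0 := norm_pos_iff.1 (by linarith)
  have hzm : |margin w (z, y)| ≤ r * ‖w‖ / 8 := by
    have h1 := abs_margin_sub_le (R := R) (w := w) (v := wst) (q := (z, y))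
      ⟨abs_eq_one_of_mem_labels h.label, (h.norm_lt hp hz).le⟩
    rw [h.margin_eq z hz, sub_zero] at h1
    have h2 : ‖w - wst‖ * R ≤ r * ‖wst‖ / 16 := by
      calc ‖w - wst‖ * R ≤ r * ‖wst‖ / (16 * R) * R := by gcongr
        _ = _ := by field_simp
    nlinarith
  have h1 := le_lintegral_ball_bump_sq hw0 (abs_eq_one_of_mem_labels h.label) hs hr hzm
    (by nlinarith)
  have hm : Measurable fun q : Vec m × ℝ => ENNReal.ofReal (bump (margin w q / s) ^ 2) :=
    ((measurable_bump_margin w s).pow_const 2).ennreal_ofReal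
  have h2 := lintegral_piece_ge hp h.label (h.density z hz) hm
  have h3 : ∫⁻ q, (piece z r y).indicator (fun q => ENNReal.ofReal (bump (margin w q / s) ^ 2)) q
      ∂dataLaw p = ENNReal.ofReal (∫ q, localBump z r y s w q ∂dataLaw p) := by
    rw [ofReal_integral_eq_lintegral_ofReal (integrable_dataLaw hp (measurable_localBump z r y s w)
      (B := 1) fun q _ => by
        rw [abs_of_nonneg (localBump_nonneg ..)]; exact localBump_le_one ..)
      (Filter.Eventually.of_forall (localBump_nonneg z r y s w))]
    refine lintegral_congr fun q => ?_
    simp only [localBump, Set.indicator]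
    split_ifs <;> simp
  rw [h3] at h2
  have h4 : ENNReal.ofReal (c₀ * (V * (s / (2 * (r * ‖w‖))))) ≤
      ENNReal.ofReal (∫ q, localBump z r y s w q ∂dataLaw p) := by
    refine le_trans ?_ h2
    rw [ENNReal.ofReal_mul hc₀.le, ENNReal.ofReal_mul hV0.le, ← hV']
    gcongr
  have h5 := (ENNReal.ofReal_le_ofReal_iff (integral_nonneg (localBump_nonneg z r y s w))).1 h4
  refine le_trans ?_ h5
  rw [mul_assoc, mul_assoc, one_div, inv_mul_eq_div]
  have : 0 < ‖w‖ := by linarith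
  gcongr

end

/-! ### Smoothness of the expected gradient -/

/-- The contribution of a data point to minus the gradient of the loss, in the direction `e`. -/
def gradKer {m : ℕ} (s : ℝ) (w e : Vec m) (q : Vec m × ℝ) : ℝ :=
  psiDeriv (margin w q / s) * q.2 * inner ℝ q.1 e

/-- The contribution of a data point to the Hessian of the loss, as a bilinear form. -/
def hessKer {m : ℕ} (s : ℝ) (w v e : Vec m) (q : Vec m × ℝ) : ℝ :=
  psiCurv (margin w q / s) * (q.2 ^ 2 / s) * (inner ℝ q.1 v * inner ℝ q.1 e)

section
variable {m : ℕ} {p : Vec m → ℝ → ℝ} {R : ℝ}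

lemma continuous_gradKer (s : ℝ) (w e : Vec m) : Continuous (gradKer s w e) := by
  unfold gradKer
  have h1 := continuous_psiDeriv.comp ((continuous_margin w).div_const s)
  exact (h1.mul continuous_snd).mul (by fun_prop)

lemma continuous_hessKer (s : ℝ) (w v e : Vec m) : Continuous (hessKer s w v e) := by
  unfold hessKer
  have h1 := continuous_psiCurv.comp ((continuous_margin w).div_const s)
  exact (h1.mul (by fun_prop)).mul (by fun_prop)

lemma abs_inner_le_of_mem {q : Vec m × ℝ} (hq : q ∈ dataRange m R) (e : Vec m) :
    |inner ℝ q.1 e| ≤ R * ‖e‖ :=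
  (abs_real_inner_le_norm _ _).trans (by gcongr; exact hq.2)

lemma R_nonneg_of_mem {q : Vec m × ℝ} (hq : q ∈ dataRange m R) : 0 ≤ R :=
  (norm_nonneg _).trans hq.2

lemma abs_gradKer_le {q : Vec m × ℝ} (hq : q ∈ dataRange m R) (s : ℝ) (w e : Vec m) :
    |gradKer s w e q| ≤ R * ‖e‖ := by
  rw [gradKer, abs_mul, abs_mul, hq.1, mul_one, abs_of_nonneg (psiDeriv_nonneg _)]
  have := abs_inner_le_of_mem hq e
  calc _ ≤ 1 * (R * ‖e‖) := by gcongr; exact psiDeriv_le_one _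
    _ = _ := one_mul _

lemma abs_hessKer_le_bump {q : Vec m × ℝ} (hq : q ∈ dataRange m R) {s : ℝ} (hs : 0 < s)
    (w v e : Vec m) : |hessKer s w v e q| ≤ R ^ 2 / s * ‖v‖ * ‖e‖ * bump (margin w q / s) := by
  have hR := R_nonneg_of_mem hq
  have hy2 : q.2 ^ 2 = 1 := by rw [← sq_abs, hq.1]; norm_num
  rw [hessKer, abs_mul, abs_mul, abs_of_nonneg (psiCurv_nonneg _), hy2, abs_mul,
    abs_of_pos (one_div_pos.2 hs)]
  have h1 := abs_inner_le_of_mem hq v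
  have h2 := abs_inner_le_of_mem hq e
  have h3 := psiCurv_le_bump (margin w q / s)
  have h4 := bump_pos (margin w q / s)
  calc _ ≤ bump (margin w q / s) * (1 / s) * ((R * ‖v‖) * (R * ‖e‖)) := by
        gcongr; linarith
    _ = _ := by ring

lemma abs_hessKer_le {q : Vec m × ℝ} (hq : q ∈ dataRange m R) {s : ℝ} (hs : 0 < s)
    (w v e : Vec m) : |hessKer s w v e q| ≤ R ^ 2 / s * ‖v‖ * ‖e‖ := by
  refine (abs_hessKer_le_bump hq hs w v e).trans ?_
  exact mul_le_of_le_one_right (by positivity) (bump_le_one _)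

lemma hasDerivAt_gradKer {s : ℝ} (w v e : Vec m) (q : Vec m × ℝ) (t : ℝ) :
    HasDerivAt (fun t : ℝ => gradKer s (w + t • v) e q) (-hessKer s (w + t • v) v e q) t := by
  have h1 : HasDerivAt (fun t : ℝ => w + t • v) v t := by
    simpa using ((hasDerivAt_id t).smul_const v).const_add w
  have h2 := (hasFDerivAt_margin_div (α := s) (w + t • v) q).comp_hasDerivAt t h1
  have h3 := (((hasDerivAt_psiDeriv _).comp t h2).mul_const q.2).mul_const (inner ℝ q.1 e : ℝ)
  refine h3.congr_deriv ?_
  simp [hessKer]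
  ring

lemma hasDerivAt_integral_gradKer (hp : IsDataDensity p R) {s : ℝ} (hs : 0 < s) (w v e : Vec m)
    (t : ℝ) : HasDerivAt (fun t : ℝ => ∫ q, gradKer s (w + t • v) e q ∂dataLaw p)
      (-∫ q, hessKer s (w + t • v) v e q ∂dataLaw p) t := by
  have := isProbabilityMeasure_dataLaw hp
  rw [← integral_neg]
  have hint : Integrable (gradKer s (w + t • v) e) (dataLaw p) :=
    integrable_dataLaw hp (continuous_gradKer _ _ _).measurable fun q hq => abs_gradKer_le hq _ _ _
  have hbd : ∀ᵐ q ∂dataLaw p, ∀ t ∈ (Set.univ : Set ℝ),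
      ‖-hessKer s (w + t • v) v e q‖ ≤ R ^ 2 / s * ‖v‖ * ‖e‖ :=
    (ae_mem_dataRange hp).mono fun q hq t _ => by
      rw [norm_neg, Real.norm_eq_abs]
      exact abs_hessKer_le hq hs _ _ _
  have hmeas : ∀ t : ℝ, AEStronglyMeasurable (gradKer s (w + t • v) e) (dataLaw p) := fun t =>
    (continuous_gradKer _ _ _).measurable.aestronglyMeasurable
  have hmeas' : AEStronglyMeasurable (fun q => -hessKer s (w + t • v) v e q) (dataLaw p) :=
    (continuous_hessKer _ _ _ _).measurable.neg.aestronglyMeasurable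
  exact (hasDerivAt_integral_of_dominated_loc_of_deriv_le (μ := dataLaw p) (s := Set.univ)
    (F := fun t q => gradKer s (w + t • v) e q) (F' := fun t q => -hessKer s (w + t • v) v e q)
    Filter.univ_mem (Filter.Eventually.of_forall hmeas) hint hmeas' hbd (integrable_const _)
    (Filter.Eventually.of_forall fun q t _ => hasDerivAt_gradKer w v e q t)).2

/-- The linear map that carries the margin hyperplanes of `w` to those of `w'`. -/
def shear (w w' : Vec m) : Vec m →ₗ[ℝ] Vec m :=
  LinearMap.transvection (-(innerSL ℝ (w' - w)).toLinearMap) ((‖w'‖ ^ 2)⁻¹ • w')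

lemma shear_apply (w w' z : Vec m) :
    shear w w' z = z - (inner ℝ (w' - w) z * (‖w'‖ ^ 2)⁻¹) • w' := by
  rw [shear, LinearMap.transvection.apply, LinearMap.neg_apply, ContinuousLinearMap.coe_coe,
    innerSL_apply_apply, smul_smul, neg_mul, neg_smul, ← sub_eq_add_neg]

lemma inner_shear {w w' : Vec m} (hw' : w' ≠ 0) (z : Vec m) :
    inner ℝ w' (shear w w' z) = inner ℝ w z := by
  have : ‖w'‖ ≠ 0 := norm_ne_zero_iff.2 hw'
  rw [shear_apply, inner_sub_right, inner_smul_right, real_inner_self_eq_norm_sq, inner_sub_left]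
  field_simp; ring

lemma det_shear (w w' : Vec m) :
    LinearMap.det (shear w w') = 1 - inner ℝ (w' - w) w' * (‖w'‖ ^ 2)⁻¹ := by
  rw [shear, LinearMap.transvection.det, LinearMap.neg_apply, ContinuousLinearMap.coe_coe,
    innerSL_apply_apply, inner_smul_right]
  ring

lemma norm_shear_sub_le {w w' : Vec m} (hw' : w' ≠ 0) (z : Vec m) :
    ‖shear w w' z - z‖ ≤ ‖w' - w‖ / ‖w'‖ * ‖z‖ := by
  have hn : 0 < ‖w'‖ := norm_pos_iff.2 hw'
  rw [shear_apply, sub_sub_cancel_left, norm_neg, norm_smul, Real.norm_eq_abs, abs_mul,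
    abs_of_pos (inv_pos.2 (by positivity : 0 < ‖w'‖ ^ 2))]
  calc |inner ℝ (w' - w) z| * (‖w'‖ ^ 2)⁻¹ * ‖w'‖
      ≤ (‖w' - w‖ * ‖z‖) * (‖w'‖ ^ 2)⁻¹ * ‖w'‖ := by
        gcongr; exact abs_real_inner_le_norm _ _
    _ = _ := by field_simp

lemma abs_det_shear_sub_one_le {w w' : Vec m} (hw' : w' ≠ 0) :
    |LinearMap.det (shear w w') - 1| ≤ ‖w' - w‖ / ‖w'‖ := by
  have hn : 0 < ‖w'‖ := norm_pos_iff.2 hw'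
  rw [det_shear, sub_sub_cancel_left, abs_neg, abs_mul,
    abs_of_pos (inv_pos.2 (by positivity : 0 < ‖w'‖ ^ 2))]
  calc |inner ℝ (w' - w) w'| * (‖w'‖ ^ 2)⁻¹
      ≤ (‖w' - w‖ * ‖w'‖) * (‖w'‖ ^ 2)⁻¹ := by
        gcongr; exact abs_real_inner_le_norm _ _
    _ = _ := by field_simp

lemma integral_comp_linearMap {T : Vec m →ₗ[ℝ] Vec m} (hT : LinearMap.det T ≠ 0) {F : Vec m → ℝ}
    (hF : Continuous F) : ∫ x, F x = |LinearMap.det T| * ∫ z, F (T z) := by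
  have h1 := Measure.map_linearMap_addHaar_eq_smul_addHaar (volume : Measure (Vec m)) hT
  have h2 : ∫ z, F (T z) = ∫ x, F x ∂(Measure.map T volume) :=
    (integral_map T.continuous_of_finiteDimensional.measurable.aemeasurable
      hF.aestronglyMeasurable).symm
  rw [h2, h1, integral_smul_measure, ENNReal.toReal_ofReal (abs_nonneg _), abs_inv, smul_eq_mul,
    ← mul_assoc, mul_inv_cancel₀ (abs_ne_zero.2 hT), one_mul]

/-- The weighted second moment density `p(x, y) (xᵀh) (xᵀe)` is Lipschitz. -/
lemma abs_moment_sub_le {P : ℝ} {L : NNReal} (hp : IsDataDensity p R) {y : ℝ} (hy : y ∈ labels)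
    (hL : LipschitzWith L fun x => p x y) (hP : ∀ x, p x y ≤ P) (h e x x' : Vec m) :
    |p x y * (inner ℝ x h * inner ℝ x e) - p x' y * (inner ℝ x' h * inner ℝ x' e)| ≤
      (L * R ^ 2 + 2 * P * R) * ‖h‖ * ‖e‖ * ‖x - x'‖ := by
  have hR := hp.R_pos
  have hP0 : 0 ≤ P := (hp.nonneg y hy x).trans (hP x)
  have hLip : ∀ x x', |p x y - p x' y| ≤ L * ‖x - x'‖ := fun x x' => by
    have := hL.dist_le_mul x x'
    rwa [Real.dist_eq, dist_eq_norm] at this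
  have hin : ∀ {x : Vec m} (e : Vec m), ‖x‖ ≤ R → |inner ℝ x e| ≤ R * ‖e‖ := fun {x} e hx =>
    (abs_real_inner_le_norm _ _).trans (by gcongr)
  -- if one point is outside the support, only the variation of `p` matters
  have hout : ∀ x x', p x' y = 0 → |p x y * (inner ℝ x h * inner ℝ x e)| ≤
      (L * R ^ 2 + 2 * P * R) * ‖h‖ * ‖e‖ * ‖x - x'‖ := by
    intro x x' hx'
    by_cases hx : p x y = 0
    · rw [hx, zero_mul, abs_zero]; positivity
    have hxR := (hp.norm_lt hy hx).le
    have h1 := hLip x x'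
    rw [hx', sub_zero] at h1
    rw [abs_mul, abs_mul]
    calc _ ≤ (L * ‖x - x'‖) * ((R * ‖h‖) * (R * ‖e‖)) := by
          gcongr
          · exact hin h hxR
          · exact hin e hxR
      _ = L * R ^ 2 * ‖h‖ * ‖e‖ * ‖x - x'‖ := by ring
      _ ≤ _ := by
          gcongr
          have : 0 ≤ 2 * P * R := by positivity
          linarith
  by_cases hx' : p x' y = 0
  · have := hout x x' hx'
    rwa [hx', zero_mul, sub_zero]
  by_cases hx : p x y = 0
  · have := hout x' x hx
    rwa [hx, zero_mul, zero_sub, abs_neg, norm_sub_rev]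
  have hxR := (hp.norm_lt hy hx).le
  have hxR' := (hp.norm_lt hy hx').le
  have hsplit : p x y * (inner ℝ x h * inner ℝ x e) - p x' y * (inner ℝ x' h * inner ℝ x' e) =
      (p x y - p x' y) * (inner ℝ x' h * inner ℝ x' e) +
      p x y * (inner ℝ (x - x') h * inner ℝ x e + inner ℝ x' h * inner ℝ (x - x') e) := by
    simp only [inner_sub_left]; ring
  rw [hsplit]
  have h1 : |(p x y - p x' y) * (inner ℝ x' h * inner ℝ x' e)| ≤
      (L * ‖x - x'‖) * ((R * ‖h‖) * (R * ‖e‖)) := by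
    rw [abs_mul, abs_mul]
    gcongr
    · exact hLip x x'
    · exact hin h hxR'
    · exact hin e hxR'
  have h2 : |p x y * (inner ℝ (x - x') h * inner ℝ x e + inner ℝ x' h * inner ℝ (x - x') e)| ≤
      P * ((‖x - x'‖ * ‖h‖) * (R * ‖e‖) + (R * ‖h‖) * (‖x - x'‖ * ‖e‖)) := by
    rw [abs_mul, abs_of_nonneg (hp.nonneg y hy x)]
    gcongr
    · exact hP x
    · refine (abs_add_le _ _).trans ?_
      rw [abs_mul, abs_mul]
      gcongr
      · exact abs_real_inner_le_norm _ _
      · exact hin e hxR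
      · exact hin h hxR'
      · exact abs_real_inner_le_norm _ _
  refine (abs_add_le _ _).trans ((add_le_add h1 h2).trans (le_of_eq ?_))
  ring

/-- The population Hessian of one label class is Lipschitz away from `w = 0`, uniformly in the
smoothing width: a linear change of variables moves the dependence on `w` from the concentrated
kernel to the density. -/
lemma exists_label_hess_sub_le (hp : IsDataDensity p R) : ∃ C : ℝ, 0 ≤ C ∧ ∀ y ∈ labels,
    ∀ w w' h e : Vec m, 1 / (4 * R) < ‖w‖ → ‖w' - w‖ ≤ 1 / (16 * R) → ∀ s, 0 < s →
    |(∫ x, p x y * hessKer s w' h e (x, y)) - ∫ x, p x y * hessKer s w h e (x, y)| ≤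
      C * ‖w' - w‖ * ‖h‖ * ‖e‖ := by
  have hR := hp.R_pos
  obtain ⟨P, hP0, hP⟩ := hp.exists_bound
  obtain ⟨L, hL⟩ := hp.lipschitz
  set V := (volume (Metric.ball (0 : Vec m) (2 * R + 1))).toReal with hV
  have hV' : volume (Metric.ball (0 : Vec m) (2 * R + 1)) = ENNReal.ofReal V :=
    (ENNReal.ofReal_toReal measure_ball_lt_top.ne).symm
  have hV0 : 0 ≤ V := ENNReal.toReal_nonneg
  set A : ℝ := (L * R ^ 2 + 2 * P * R) * (16 * R ^ 2) + 8 * R * (P * R ^ 2) with hA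
  have hA0 : 0 ≤ A := by positivity
  refine ⟨A * (V * (Real.pi * (4 * R))), by positivity, fun y hy w w' h e hw hww s hs => ?_⟩
  have hy1 := abs_eq_one_of_mem_labels hy
  have hy2 : y ^ 2 = 1 := by rw [← sq_abs, hy1]; norm_num
  have hwpos : 0 < ‖w‖ := lt_trans (by positivity) hw
  have hw0 : w ≠ 0 := norm_pos_iff.1 hwpos
  have hw'n : 1 / (8 * R) ≤ ‖w'‖ := by
    have h1 := norm_sub_norm_le w w'
    rw [norm_sub_rev] at h1
    have h2 : 1 / (4 * R) = 4 * (1 / (16 * R)) := by field_simp; norm_num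
    have h3 : 1 / (8 * R) = 2 * (1 / (16 * R)) := by field_simp; norm_num
    have h4 : 0 < 1 / (16 * R) := by positivity
    linarith
  have hw'pos : 0 < ‖w'‖ := lt_of_lt_of_le (by positivity) hw'n
  have hw'0 : w' ≠ 0 := norm_pos_iff.1 hw'pos
  set T := shear w w' with hT
  have hratio : ‖w' - w‖ / ‖w'‖ ≤ 8 * R * ‖w' - w‖ := by
    rw [div_le_iff₀ hw'pos]
    rw [div_le_iff₀ (by positivity)] at hw'n
    nlinarith [norm_nonneg (w' - w)]
  have hratio2 : ‖w' - w‖ / ‖w'‖ ≤ 1 / 2 := by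
    refine hratio.trans ?_
    calc 8 * R * ‖w' - w‖ ≤ 8 * R * (1 / (16 * R)) := by gcongr
      _ = 1 / 2 := by field_simp; norm_num
  have hdet := abs_det_shear_sub_one_le (w := w) hw'0
  have hdetpos : 0 < LinearMap.det T := by
    have := (abs_le.1 (hdet.trans hratio2)).1; linarith
  set G : Vec m → ℝ := fun x => p x y * (inner ℝ x h * inner ℝ x e) with hG
  set k : Vec m → Vec m → ℝ := fun w x => psiCurv (margin w (x, y) / s) / s with hk
  have hkc : ∀ w, Continuous (k w) := fun w =>
    (continuous_psiCurv.comp (((continuous_margin w).comp (by fun_prop)).div_const s)).div_const s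
  have hGc : Continuous G := (hp.continuous hy).mul (by fun_prop)
  have hker : ∀ w x, p x y * hessKer s w h e (x, y) = k w x * G x := fun w x => by
    simp only [hessKer, hk, hG, hy2]; ring
  simp only [hker]
  -- the change of variables `x = T z` replaces the kernel of `w'` by that of `w`
  have hcv : ∫ x, k w' x * G x = ∫ z, k w z * (LinearMap.det T * G (T z)) := by
    rw [integral_comp_linearMap (F := fun x => k w' x * G x) hdetpos.ne' ((hkc w').mul hGc),
      ← integral_const_mul]
    refine integral_congr_ae (Filter.Eventually.of_forall fun z => ?_)
    have : k w' (T z) = k w z := by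
      simp only [hk, margin, hT]; rw [inner_shear hw'0]
    simp only [this, abs_of_pos hdetpos]; ring
  rw [hcv]
  -- both integrands live on the ball of radius `2 R`
  have hTz : ∀ z, ‖T z - z‖ ≤ 1 / 2 * ‖z‖ := fun z =>
    (norm_shear_sub_le hw'0 z).trans (by gcongr)
  have hsupp : ∀ z, 2 * R ≤ ‖z‖ → G (T z) = 0 ∧ G z = 0 := by
    intro z hz
    have h1 := hTz z
    have h2 := norm_sub_norm_le z (T z)
    rw [norm_sub_rev] at h2
    have h3 : p (T z) y = 0 := hp.support y hy _ (by linarith)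
    have h4 : p z y = 0 := hp.support y hy _ (by linarith)
    simp [hG, h3, h4]
  have hGb : ∀ x, |G x| ≤ P * R ^ 2 * ‖h‖ * ‖e‖ := by
    intro x
    by_cases hx : p x y = 0
    · simp only [hG, hx, zero_mul, abs_zero]; positivity
    have hxR := (hp.norm_lt hy hx).le
    simp only [hG]
    rw [abs_mul, abs_mul, abs_of_nonneg (hp.nonneg y hy x)]
    calc _ ≤ P * ((R * ‖h‖) * (R * ‖e‖)) := by
          gcongr
          · exact hP y hy x
          · exact (abs_real_inner_le_norm _ _).trans (by gcongr)
          · exact (abs_real_inner_le_norm _ _).trans (by gcongr)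
      _ = _ := by ring
  have hdiff : ∀ z, |LinearMap.det T * G (T z) - G z| ≤
      (Metric.ball (0 : Vec m) (2 * R)).indicator (fun _ => A * ‖w' - w‖ * ‖h‖ * ‖e‖) z := by
    intro z
    by_cases hz : z ∈ Metric.ball (0 : Vec m) (2 * R)
    swap
    · have h1 := hsupp z (by simpa using hz)
      rw [Set.indicator_of_notMem hz, h1.1, h1.2]; simp
    rw [Set.indicator_of_mem hz]
    have hzn : ‖z‖ ≤ 2 * R := by simpa using (Metric.mem_ball.1 hz).le
    have h1 : LinearMap.det T * G (T z) - G z =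
        (LinearMap.det T - 1) * G (T z) + (G (T z) - G z) := by ring
    have h2 : |(LinearMap.det T - 1) * G (T z)| ≤ (8 * R * ‖w' - w‖) * (P * R ^ 2 * ‖h‖ * ‖e‖) := by
      rw [abs_mul]
      gcongr
      · exact hdet.trans hratio
      · exact hGb _
    have h3 : |G (T z) - G z| ≤ (L * R ^ 2 + 2 * P * R) * ‖h‖ * ‖e‖ *
        ((8 * R * ‖w' - w‖) * (2 * R)) := by
      refine (abs_moment_sub_le hp hy (hL y hy) (hP y hy) h e _ _).trans ?_
      gcongr
      exact (norm_shear_sub_le hw'0 z).trans (by gcongr)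
    rw [h1]
    refine (abs_add_le _ _).trans ((add_le_add h2 h3).trans (le_of_eq ?_))
    rw [hA]; ring
  set b : Vec m → ℝ := (Metric.ball (0 : Vec m) (2 * R)).indicator
    (fun z => bump (margin w (z, y) / s)) with hb
  have hbm : Measurable fun z : Vec m => bump (margin w (z, y) / s) :=
    (measurable_bump_margin w s).comp (by fun_prop)
  have hbi : Integrable b := by
    rw [hb, integrable_indicator_iff Metric.isOpen_ball.measurableSet]
    have : IsFiniteMeasure (volume.restrict (Metric.ball (0 : Vec m) (2 * R))) :=
      ⟨by rw [Measure.restrict_apply_univ]; exact measure_ball_lt_top⟩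
    exact Integrable.of_bound hbm.aestronglyMeasurable 1
      (Filter.Eventually.of_forall fun z => by rw [Real.norm_eq_abs]; exact abs_bump_le_one _)
  have hbint : ∫ z, b z ≤ V * (Real.pi * (4 * R)) * s := by
    have hb0 : 0 ≤ ∫ z, b z := integral_nonneg fun z =>
      Set.indicator_nonneg (fun _ _ => (bump_pos _).le) _
    have h1 : ENNReal.ofReal (∫ z, b z) ≤ ENNReal.ofReal (V * (Real.pi * (4 * R)) * s) := by
      rw [ofReal_integral_eq_lintegral_ofReal hbi (Filter.Eventually.of_forall fun z =>
        Set.indicator_nonneg (fun _ _ => (bump_pos _).le) _)]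
      have h2 : ∫⁻ z, ENNReal.ofReal (b z) =
          ∫⁻ z in Metric.ball (0 : Vec m) (2 * R), ENNReal.ofReal (bump (margin w (z, y) / s)) := by
        rw [← lintegral_indicator Metric.isOpen_ball.measurableSet]
        refine lintegral_congr fun z => ?_
        simp only [hb, Set.indicator]
        split_ifs <;> simp
      rw [h2]
      refine (lintegral_ball_bump_le hw0 hy1 hs (2 * R)).trans ?_
      rw [hV', ← ENNReal.ofReal_mul hV0]
      refine ENNReal.ofReal_le_ofReal ?_
      have h3 : s / ‖w‖ ≤ 4 * R * s := by
        rw [div_le_iff₀ hwpos]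
        rw [div_lt_iff₀ (by positivity)] at hw
        nlinarith
      calc V * (Real.pi * (s / ‖w‖)) ≤ V * (Real.pi * (4 * R * s)) := by gcongr
        _ = _ := by ring
    exact (ENNReal.ofReal_le_ofReal_iff (by positivity)).1 h1
  have hkb : ∀ z, |k w z| ≤ bump (margin w (z, y) / s) / s := fun z => by
    simp only [hk]
    rw [abs_of_nonneg (div_nonneg (psiCurv_nonneg _) hs.le)]
    gcongr
    linarith [psiCurv_le_bump (margin w (z, y) / s), bump_pos (margin w (z, y) / s)]
  have hint : ∀ F : Vec m → ℝ, Continuous F → (∀ z, 2 * R ≤ ‖z‖ → F z = 0) →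
      (∃ B, ∀ z, |F z| ≤ B) → Integrable fun z => k w z * F z := by
    rintro F hF hF0 ⟨B, hB⟩
    have hB0 : 0 ≤ B := (abs_nonneg _).trans (hB 0)
    refine Integrable.mono' (hbi.const_mul (B / s)) ((hkc w).mul hF).aestronglyMeasurable
      (Filter.Eventually.of_forall fun z => ?_)
    rw [Real.norm_eq_abs]
    by_cases hz : z ∈ Metric.ball (0 : Vec m) (2 * R)
    · simp only [hb, Set.indicator_of_mem hz]
      rw [abs_mul]
      calc |k w z| * |F z| ≤ (bump (margin w (z, y) / s) / s) * B := by
            gcongr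
            · exact div_nonneg (bump_pos _).le hs.le
            · exact hkb z
            · exact hB z
        _ = _ := by ring
    · rw [hF0 z (by simpa using hz)]
      simp [hb, Set.indicator_of_notMem hz]
  have hTc : Continuous T := T.continuous_of_finiteDimensional
  rw [← integral_sub
    (hint (fun z => LinearMap.det T * G (T z)) (continuous_const.mul (hGc.comp hTc))
      (fun z hz => by simp only [(hsupp z hz).1, mul_zero])
      ⟨|LinearMap.det T| * (P * R ^ 2 * ‖h‖ * ‖e‖), fun z => by
        rw [abs_mul]; gcongr; exact hGb _⟩)
    (hint _ hGc (fun z hz => (hsupp z hz).2) ⟨_, hGb⟩)]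
  have hfin := norm_integral_le_of_norm_le (μ := (volume : Measure (Vec m)))
    (f := fun z => k w z * (LinearMap.det T * G (T z)) - k w z * G z)
    (hbi.const_mul (A * ‖w' - w‖ * ‖h‖ * ‖e‖ / s)) (Filter.Eventually.of_forall fun z => by
      rw [← mul_sub, Real.norm_eq_abs, abs_mul]
      have h1 := hdiff z
      by_cases hz : z ∈ Metric.ball (0 : Vec m) (2 * R)
      · rw [Set.indicator_of_mem hz] at h1
        simp only [hb, Set.indicator_of_mem hz]
        calc _ ≤ (bump (margin w (z, y) / s) / s) * (A * ‖w' - w‖ * ‖h‖ * ‖e‖) := by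
              gcongr
              · exact div_nonneg (bump_pos _).le hs.le
              · exact hkb z
          _ = _ := by ring
      · rw [Set.indicator_of_notMem hz] at h1
        rw [le_antisymm h1 (abs_nonneg _)]
        simp [hb, Set.indicator_of_notMem hz])
  rw [Real.norm_eq_abs, integral_const_mul] at hfin
  refine hfin.trans ?_
  calc A * ‖w' - w‖ * ‖h‖ * ‖e‖ / s * ∫ z, b z
      ≤ A * ‖w' - w‖ * ‖h‖ * ‖e‖ / s * (V * (Real.pi * (4 * R)) * s) := by gcongr
    _ = _ := by field_simp

/-- The population Hessian is Lipschitz, up to an error of the order of the smoothing width. -/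
lemma exists_integral_hessKer_sub_le (hp : IsDataDensity p R) : ∃ C r₁ : ℝ, 0 < C ∧ 0 < r₁ ∧
    ∀ w w' h e : Vec m, ‖w' - w‖ ≤ r₁ → ∀ s, 0 < s →
    |(∫ q, hessKer s w' h e q ∂dataLaw p) - ∫ q, hessKer s w h e q ∂dataLaw p| ≤
      C * (‖w' - w‖ + s) * ‖h‖ * ‖e‖ := by
  have := isProbabilityMeasure_dataLaw hp
  have hR := hp.R_pos
  obtain ⟨C, hC, hlab⟩ := exists_label_hess_sub_le hp
  refine ⟨2 * C + 8 * R ^ 2, 1 / (16 * R), by positivity, by positivity,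
    fun w w' h e hww s hs => ?_⟩
  rcases le_or_gt ‖w‖ (1 / (4 * R)) with hw | hw
  -- if `w` is small, then no data point is near the margin and both Hessians are `O(s)`
  · have hsmall : ∀ w : Vec m, ‖w‖ ≤ 1 / (2 * R) →
        |∫ q, hessKer s w h e q ∂dataLaw p| ≤ 4 * R ^ 2 * s * ‖h‖ * ‖e‖ := by
      intro w hw
      have h1 := norm_integral_le_of_norm_le_const (μ := dataLaw p) (f := hessKer s w h e)
        (C := 4 * R ^ 2 * s * ‖h‖ * ‖e‖) ((ae_mem_dataRange hp).mono fun q hq => by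
          rw [Real.norm_eq_abs]
          refine (abs_hessKer_le_bump hq hs w h e).trans ?_
          calc _ ≤ R ^ 2 / s * ‖h‖ * ‖e‖ * (4 * s ^ 2) := by
                gcongr; exact bump_margin_le_of_small hR hw hs hq
            _ = _ := by field_simp)
      simpa using h1
    have h4 : 1 / (4 * R) = 4 * (1 / (16 * R)) := by field_simp; norm_num
    have h2 : 1 / (2 * R) = 8 * (1 / (16 * R)) := by field_simp; norm_num
    have h16 : 0 < 1 / (16 * R) := by positivity
    have h1 := hsmall w (by linarith)
    have h3 := hsmall w' (by
      have := norm_sub_norm_le w' w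
      linarith)
    have h5 := abs_sub (∫ q, hessKer s w' h e q ∂dataLaw p) (∫ q, hessKer s w h e q ∂dataLaw p)
    refine h5.trans ((add_le_add h3 h1).trans ?_)
    calc 4 * R ^ 2 * s * ‖h‖ * ‖e‖ + 4 * R ^ 2 * s * ‖h‖ * ‖e‖ =
        (0 + 8 * R ^ 2) * (0 + s) * ‖h‖ * ‖e‖ := by ring
      _ ≤ _ := by gcongr <;> positivity
  · have hm := fun w : Vec m => (continuous_hessKer s w h e).measurable
    have hb := fun w : Vec m => integral_dataLaw hp (hm w) fun q hq => abs_hessKer_le hq hs w h e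
    rw [hb, hb, ← Finset.sum_sub_distrib]
    refine (Finset.abs_sum_le_sum_abs _ _).trans ?_
    refine (Finset.sum_le_sum fun y hy => hlab y hy w w' h e hw hww s hs).trans ?_
    have hcard : labels.card = 2 := by rw [labels, Finset.card_pair (by norm_num)]
    rw [Finset.sum_const, hcard, nsmul_eq_mul]
    push_cast
    calc 2 * (C * ‖w' - w‖ * ‖h‖ * ‖e‖) = (2 * C + 0) * (‖w' - w‖ + 0) * ‖h‖ * ‖e‖ := by ring
      _ ≤ _ := by gcongr; positivity

/-- Taylor expansion of the expected gradient, uniform in the smoothing width. -/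
lemma exists_integral_gradKer_taylor (hp : IsDataDensity p R) : ∃ C r₁ : ℝ, 0 < C ∧ 0 < r₁ ∧
    ∀ w v e : Vec m, ‖v‖ ≤ r₁ → ∀ s, 0 < s →
    |(∫ q, gradKer s (w + v) e q ∂dataLaw p) - (∫ q, gradKer s w e q ∂dataLaw p) +
      ∫ q, hessKer s w v e q ∂dataLaw p| ≤ C * ‖v‖ * (‖v‖ + s) * ‖e‖ := by
  obtain ⟨C, r₁, hC, hr₁, hH⟩ := exists_integral_hessKer_sub_le hp
  refine ⟨C, r₁, hC, hr₁, fun w v e hv s hs => ?_⟩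
  set F : ℝ → ℝ := fun t => (∫ q, gradKer s (w + t • v) e q ∂dataLaw p) +
    t * ∫ q, hessKer s w v e q ∂dataLaw p with hF
  have hd : ∀ t, HasDerivAt F (-(∫ q, hessKer s (w + t • v) v e q ∂dataLaw p) +
      ∫ q, hessKer s w v e q ∂dataLaw p) t := fun t => by
    have h1 : HasDerivAt (fun t : ℝ => t * ∫ q, hessKer s w v e q ∂dataLaw p)
        (∫ q, hessKer s w v e q ∂dataLaw p) t := by
      simpa using (hasDerivAt_id t).mul_const (∫ q, hessKer s w v e q ∂dataLaw p)
    exact (hasDerivAt_integral_gradKer hp hs w v e t).add h1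
  have h1 := norm_image_sub_le_of_norm_deriv_le_segment_01' (f := F)
    (C := C * ‖v‖ * (‖v‖ + s) * ‖e‖) (fun t _ => (hd t).hasDerivWithinAt) (fun t ht => by
      have htv : ‖w + t • v - w‖ ≤ ‖v‖ := by
        rw [add_sub_cancel_left, norm_smul, Real.norm_eq_abs, abs_of_nonneg ht.1]
        exact mul_le_of_le_one_left (norm_nonneg _) ht.2.le
      have h2 := hH w (w + t • v) v e (htv.trans hv) s hs
      rw [neg_add_eq_sub, Real.norm_eq_abs, abs_sub_comm]
      refine h2.trans ?_
      calc C * (‖w + t • v - w‖ + s) * ‖v‖ * ‖e‖ ≤ C * (‖v‖ + s) * ‖v‖ * ‖e‖ := by gcongr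
        _ = _ := by ring)
  rw [Real.norm_eq_abs] at h1
  simp only [hF, one_smul, zero_smul, add_zero, one_mul, zero_mul] at h1
  convert h1 using 2
  ring

end

/-! ### Anticoncentration of sums of independent vectors -/

section
variable {Ω : Type*} [MeasurableSpace Ω] {μ : Measure Ω} [IsProbabilityMeasure μ] {N : ℕ}

/-- An event that does not depend on the coordinates selected by `q` decouples from the factors of a
product that belong to these coordinates. -/
lemma norm_setIntegral_prod_le {Bad : Set (Fin N → Ω)} (hBad : MeasurableSet Bad)
    (q : Fin N → Prop) [DecidablePred q]
    (hdep : ∀ D D' : Fin N → Ω, (∀ i, ¬ q i → D i = D' i) → D ∈ Bad → D' ∈ Bad)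
    {f : Ω → ℂ} (hf1 : ∀ z, ‖f z‖ ≤ 1) :
    ‖∫ D in Bad, ∏ i, f (D i) ∂(Measure.pi fun _ : Fin N => μ)‖ ≤
      (Measure.pi fun _ : Fin N => μ).real Bad * ‖∫ z, f z ∂μ‖ ^ Fintype.card {i // q i} := by
  set e := MeasurableEquiv.piEquivPiSubtypeProd (fun _ : Fin N => Ω) q with he
  have hmp := (measurePreserving_piEquivPiSubtypeProd (fun _ : Fin N => μ) q).symm
  obtain ⟨z₀⟩ : Nonempty Ω := nonempty_of_isProbabilityMeasure μ
  have hsymm : ∀ (a : {i // q i} → Ω) (b : {i // ¬ q i} → Ω) (i : Fin N),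
      e.symm (a, b) i = if h : q i then a ⟨i, h⟩ else b ⟨i, h⟩ := fun a b i => rfl
  have hinv : ∀ (a a' : {i // q i} → Ω) (b : {i // ¬ q i} → Ω),
      e.symm (a, b) ∈ Bad → e.symm (a', b) ∈ Bad := fun a a' b h =>
    hdep _ _ (fun i hi => by rw [hsymm, hsymm, dif_neg hi, dif_neg hi]) h
  set a₀ : {i // q i} → Ω := fun _ => z₀ with ha₀
  set Bad₂ : Set ({i // ¬ q i} → Ω) := {b | e.symm (a₀, b) ∈ Bad} with hBad₂
  have hBad₂m : MeasurableSet Bad₂ :=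
    hBad.preimage (e.symm.measurable.comp (by fun_prop))
  have hpre : e.symm ⁻¹' Bad = Set.univ ×ˢ Bad₂ := by
    ext ⟨a, b⟩
    simp only [Set.mem_preimage, Set.mem_prod, Set.mem_univ, true_and, hBad₂, Set.mem_ofPred_eq]
    exact ⟨hinv a a₀ b, hinv a₀ a b⟩
  have hprod : ∀ (a : {i // q i} → Ω) (b : {i // ¬ q i} → Ω),
      ∏ i, f (e.symm (a, b) i) = (∏ i, f (a i)) * ∏ i, f (b i) := by
    intro a b
    rw [← Fintype.prod_subtype_mul_prod_subtype q fun i => f (e.symm (a, b) i)]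
    congr 1
    · exact Finset.prod_congr rfl fun i _ => by rw [hsymm, dif_pos i.2]
    · exact Finset.prod_congr rfl fun i _ => by rw [hsymm, dif_neg i.2]
  have hmeas : (Measure.pi fun _ : Fin N => μ).real Bad =
      (Measure.pi fun _ : {i // ¬ q i} => μ).real Bad₂ := by
    rw [measureReal_def, ← hmp.measure_preimage hBad.nullMeasurableSet, hpre, Measure.prod_prod]
    simp [measureReal_def]
  rw [← hmp.setIntegral_preimage_emb e.symm.measurableEmbedding, hpre,
    setIntegral_congr_fun (MeasurableSet.univ.prod hBad₂m) fun x _ => hprod x.1 x.2]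
  rw [setIntegral_prod_mul (fun a : {i // q i} → Ω => ∏ i, f (a i))
    (fun b : {i // ¬ q i} → Ω => ∏ i, f (b i)), setIntegral_univ, norm_mul, mul_comm, hmeas]
  rw [integral_fintype_prod_eq_prod (fun _ : {i // q i} => f)]
  simp only [Finset.prod_const, norm_pow, Finset.card_univ]
  gcongr
  have h1 := norm_setIntegral_le_of_norm_le_const
    (μ := Measure.pi fun _ : {i // ¬ q i} => μ) (s := Bad₂)
    (f := fun b => ∏ i, f (b i)) (C := 1) (measure_lt_top _ _)
    (fun b _ => by
      rw [norm_prod]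
      exact Finset.prod_le_one (fun _ _ => norm_nonneg _) fun _ _ => hf1 _)
  simpa using h1

end

section
variable {m : ℕ}

/-- The constant in the anticoncentration bound. -/
def anticoncConst (m : ℕ) : ℝ := 4 / (volume (Metric.ball (0 : Vec m) 1)).toReal

lemma anticoncConst_pos (m : ℕ) : 0 < anticoncConst m :=
  div_pos (by norm_num) (ENNReal.toReal_pos (Metric.measure_ball_pos volume _ one_pos).ne'
    measure_ball_lt_top.ne)

/-- The average of the characters of frequency below `1 / ρ` is bounded below on the ball of radius
`ρ`, where the phases are at most one. -/
lemma half_le_norm_integral_exp {ρ : ℝ} (hρ : 0 < ρ) {z : Vec m} (hz : ‖z‖ ≤ ρ) :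
    (volume.real (Metric.ball (0 : Vec m) ρ⁻¹)) / 2 ≤
      ‖∫ u in Metric.ball (0 : Vec m) ρ⁻¹, Complex.exp (((inner ℝ u z : ℝ) : ℂ) * Complex.I)‖ := by
  set B := Metric.ball (0 : Vec m) ρ⁻¹
  have : IsFiniteMeasure (volume.restrict B) :=
    ⟨by rw [Measure.restrict_apply_univ]; exact measure_ball_lt_top⟩
  have hint : Integrable (fun u : Vec m => Complex.exp (((inner ℝ u z : ℝ) : ℂ) * Complex.I))
      (volume.restrict B) :=
    Integrable.of_bound (by fun_prop) 1 (Filter.Eventually.of_forall fun u => by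
      rw [Complex.norm_exp_ofReal_mul_I])
  refine le_trans ?_ (Complex.re_le_norm _)
  have hre := (integral_re (𝕜 := ℂ) hint)
  simp only [RCLike.re_to_complex, Complex.exp_ofReal_mul_I_re] at hre
  rw [← hre]
  have h1 : ∀ u ∈ B, (1 : ℝ) / 2 ≤ Real.cos (inner ℝ u z) := by
    intro u hu
    have h2 : |inner ℝ u z| ≤ 1 := by
      refine (abs_real_inner_le_norm _ _).trans ?_
      have h3 : ‖u‖ ≤ ρ⁻¹ := by simpa using (Metric.mem_ball.1 hu).le
      calc ‖u‖ * ‖z‖ ≤ ρ⁻¹ * ρ := by gcongr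
        _ = 1 := inv_mul_cancel₀ hρ.ne'
    have h4 := Real.one_sub_sq_div_two_le_cos (x := inner ℝ u z)
    have h5 := (sq_le_one_iff_abs_le_one _).2 h2
    linarith
  have hB : MeasurableSet B := Metric.isOpen_ball.measurableSet
  calc volume.real B / 2 = ∫ u in B, (1 : ℝ) / 2 := by
        rw [setIntegral_const, smul_eq_mul]; ring
    _ ≤ _ := setIntegral_mono_on (integrable_const _)
        (Integrable.of_bound (by fun_prop) 1 (Filter.Eventually.of_forall fun u => by
          rw [Real.norm_eq_abs]; exact Real.abs_cos_le_one _)) hB h1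

variable {Ω : Type*} [MeasurableSpace Ω] {μ : Measure Ω} [IsProbabilityMeasure μ] {N : ℕ}

/-- A sum of independent vectors is unlikely to fall into a given small ball, even on an event
that involves part of the sample: the indicator of the ball is dominated by the squared modulus of
an average of characters, whose expectation is controlled by the characteristic function. -/
lemma measure_bad_inter_sum_le {Bad : Set (Fin N → Ω)} (hBad : MeasurableSet Bad)
    (S : Finset (Fin N)) (hdep : ∀ D D' : Fin N → Ω, (∀ i ∉ S, D i = D' i) → D ∈ Bad → D' ∈ Bad)
    {Y : Ω → Vec m} (hY : Measurable Y) {c t₀ ρ : ℝ} (hc : 0 < c) (hS : 0 < S.card)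
    (hρ : 0 < ρ) (hρt : 2 / ρ ≤ t₀)
    (hφ : ∀ t : Vec m, ‖t‖ ≤ t₀ →
      ‖∫ z, Complex.exp (((inner ℝ t (Y z) : ℝ) : ℂ) * Complex.I) ∂μ‖ ≤ Real.exp (-c * ‖t‖ ^ 2)) :
    (Measure.pi fun _ : Fin N => μ).real (Bad ∩ {D | ‖∑ i, Y (D i)‖ ≤ ρ}) ≤
      (Measure.pi fun _ : Fin N => μ).real Bad *
        (anticoncConst m * (ρ * √(Real.pi / (c * S.card))) ^ m) := by
  set P := Measure.pi fun _ : Fin N => μ with hP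
  set B := Metric.ball (0 : Vec m) ρ⁻¹ with hB
  set ν : Measure (Vec m) := volume.restrict B with hν
  have hνfin : IsFiniteMeasure ν :=
    ⟨by rw [hν, Measure.restrict_apply_univ]; exact measure_ball_lt_top⟩
  set b : ℝ := volume.real B with hb
  have hb0 : 0 < b := ENNReal.toReal_pos
    (Metric.measure_ball_pos volume _ (by positivity)).ne' measure_ball_lt_top.ne
  have hνu : ν.real Set.univ = b := by simp [hν, hb, measureReal_def]
  set Zs : (Fin N → Ω) → Vec m := fun D => ∑ i, Y (D i) with hZs
  have hZm : Measurable Zs := by fun_prop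
  set χ : Vec m → Vec m → ℂ := fun t z => Complex.exp (((inner ℝ t z : ℝ) : ℂ) * Complex.I) with hχ
  have hχ1 : ∀ t z, ‖χ t z‖ = 1 := fun t z => Complex.norm_exp_ofReal_mul_I _
  set Φ : Vec m → ℂ := fun z => ∫ u, χ u z ∂ν with hΦ
  set n := S.card with hn
  have hn0 : (0 : ℝ) < n := by exact_mod_cast hS
  -- the squared modulus of the average as a double integral
  have hsq : ∀ z, ((‖Φ z‖ ^ 2 : ℝ) : ℂ) = ∫ x : Vec m × Vec m, χ (x.1 - x.2) z ∂(ν.prod ν) := by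
    intro z
    have h1 : ((‖Φ z‖ ^ 2 : ℝ) : ℂ) = Φ z * (starRingEnd ℂ) (Φ z) := by
      rw [Complex.mul_conj, Complex.normSq_eq_norm_sq]
    rw [h1, hΦ]
    simp only
    rw [← integral_conj, ← integral_prod_mul]
    refine integral_congr_ae (Filter.Eventually.of_forall fun x => ?_)
    simp only [hχ]
    rw [← Complex.exp_conj, ← Complex.exp_add]
    congr 1
    simp [inner_sub_left]
    ring
  have hjoint : Measurable fun q : (Fin N → Ω) × (Vec m × Vec m) => χ (q.2.1 - q.2.2) (Zs q.1) := by
    simp only [hχ]; fun_prop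
  have hintF : Integrable (fun q : (Fin N → Ω) × (Vec m × Vec m) => χ (q.2.1 - q.2.2) (Zs q.1))
      ((P.restrict Bad).prod (ν.prod ν)) :=
    Integrable.of_bound hjoint.aestronglyMeasurable 1
      (Filter.Eventually.of_forall fun q => (hχ1 _ _).le)
  have hcube : Integrable (fun x : Vec m × Vec m => Real.exp (-(c * n) * ‖x.1 - x.2‖ ^ 2))
      (ν.prod ν) :=
    Integrable.of_bound (by fun_prop) 1 (Filter.Eventually.of_forall fun x => by
      rw [Real.norm_eq_abs, abs_of_pos (Real.exp_pos _), Real.exp_le_one_iff]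
      have : 0 ≤ c * n * ‖x.1 - x.2‖ ^ 2 := by positivity
      linarith)
  -- the expectation of the squared modulus on the bad event
  have hE : ∫ D in Bad, ‖Φ (Zs D)‖ ^ 2 ∂P ≤ P.real Bad * (b * (Real.pi / (c * n)) ^ ((m : ℝ) / 2)) := by
    have h1 : ((∫ D in Bad, ‖Φ (Zs D)‖ ^ 2 ∂P : ℝ) : ℂ) =
        ∫ x : Vec m × Vec m, (∫ D in Bad, χ (x.1 - x.2) (Zs D) ∂P) ∂(ν.prod ν) := by
      rw [← integral_integral_swap hintF, ← integral_complex_ofReal]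
      exact integral_congr_ae (Filter.Eventually.of_forall fun D => hsq (Zs D))
    have h2 : ∀ᵐ x ∂(ν.prod ν), ‖∫ D in Bad, χ (x.1 - x.2) (Zs D) ∂P‖ ≤
        P.real Bad * Real.exp (-(c * n) * ‖x.1 - x.2‖ ^ 2) := by
      have hmemB : ∀ᵐ x ∂(ν.prod ν), x ∈ B ×ˢ B := by
        rw [hν, Measure.prod_restrict]
        exact ae_restrict_mem (Metric.isOpen_ball.measurableSet.prod Metric.isOpen_ball.measurableSet)
      filter_upwards [hmemB] with x hx
      have hx1 : ‖x.1‖ < ρ⁻¹ := by simpa [hB] using hx.1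
      have hx2 : ‖x.2‖ < ρ⁻¹ := by simpa [hB] using hx.2
      have ht : ‖x.1 - x.2‖ ≤ t₀ := by
        refine le_trans ?_ hρt
        have := norm_sub_le x.1 x.2
        rw [div_eq_mul_inv]; linarith
      have h3 : ∀ D, χ (x.1 - x.2) (Zs D) = ∏ i, χ (x.1 - x.2) (Y (D i)) := fun D => by
        simp only [hχ, hZs, inner_sum]
        rw [← Complex.exp_sum]
        push_cast
        rw [Finset.sum_mul]
      simp only [h3]
      refine (norm_setIntegral_prod_le hBad (· ∈ S) hdep (f := fun z => χ (x.1 - x.2) (Y z))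
        (fun z => (hχ1 _ _).le)).trans ?_
      have h4 := hφ _ ht
      rw [hP]
      refine mul_le_mul_of_nonneg_left ?_ measureReal_nonneg
      calc _ ≤ Real.exp (-c * ‖x.1 - x.2‖ ^ 2) ^ n := by
            rw [Fintype.card_coe]; exact pow_le_pow_left₀ (norm_nonneg _) h4 _
        _ = _ := by rw [← Real.exp_nat_mul]; congr 1; ring
    have h5 : ∫ D in Bad, ‖Φ (Zs D)‖ ^ 2 ∂P ≤
        ∫ x : Vec m × Vec m, P.real Bad * Real.exp (-(c * n) * ‖x.1 - x.2‖ ^ 2) ∂(ν.prod ν) := by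
      refine le_trans (le_abs_self _) ?_
      rw [← Real.norm_eq_abs, ← Complex.norm_real, h1]
      exact norm_integral_le_of_norm_le (hcube.const_mul _) h2
    refine h5.trans ?_
    rw [integral_const_mul]
    refine mul_le_mul_of_nonneg_left ?_ measureReal_nonneg
    rw [integral_prod _ hcube]
    have hcn : 0 < c * n := by positivity
    have hgauss := GaussianFourier.integral_rexp_neg_mul_sq_norm (V := Vec m) hcn
    rw [finrank_euclideanSpace_fin] at hgauss
    have hgi : Integrable fun v : Vec m => Real.exp (-(c * n) * ‖v‖ ^ 2) := by
      by_contra hni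
      rw [integral_undef hni] at hgauss
      have : 0 < (Real.pi / (c * n)) ^ ((m : ℝ) / 2) := by positivity
      linarith
    have h6 : ∀ x : Vec m, ∫ x', Real.exp (-(c * n) * ‖x - x'‖ ^ 2) ∂ν ≤
        (Real.pi / (c * n)) ^ ((m : ℝ) / 2) := by
      intro x
      rw [← hgauss, ← integral_sub_left_eq_self (fun v : Vec m => Real.exp (-(c * n) * ‖v‖ ^ 2))
        volume x]
      exact setIntegral_le_integral (hgi.comp_sub_left x)
        (Filter.Eventually.of_forall fun v => (Real.exp_pos _).le)
    calc ∫ x, (∫ x', Real.exp (-(c * n) * ‖x - x'‖ ^ 2) ∂ν) ∂ν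
        ≤ ∫ x, (Real.pi / (c * n)) ^ ((m : ℝ) / 2) ∂ν :=
          integral_mono hcube.integral_prod_left (integrable_const _) h6
      _ = _ := by rw [integral_const, hνu, smul_eq_mul]
  -- on the small ball the squared modulus is at least `(b / 2) ^ 2`
  have hΦm : StronglyMeasurable Φ :=
    StronglyMeasurable.integral_prod_right' (f := fun q : Vec m × Vec m => χ q.2 q.1)
      (by simp only [hχ]; exact Measurable.stronglyMeasurable (by fun_prop))
  have hΦb : ∀ z, ‖Φ z‖ ≤ b := fun z => by
    have := norm_integral_le_of_norm_le_const (μ := ν) (f := fun u => χ u z) (C := 1)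
      (Filter.Eventually.of_forall fun u => (hχ1 _ _).le)
    rwa [one_mul, hνu] at this
  have hmarkov := mul_meas_ge_le_integral_of_nonneg (μ := P.restrict Bad)
    (f := fun D => ‖Φ (Zs D)‖ ^ 2) (Filter.Eventually.of_forall fun D => sq_nonneg _)
    (Integrable.of_bound (((hΦm.comp_measurable hZm).norm.pow 2).aestronglyMeasurable) (b ^ 2)
      (Filter.Eventually.of_forall fun D => by
        rw [Real.norm_eq_abs, abs_of_nonneg (sq_nonneg _)]
        have := hΦb (Zs D)
        gcongr)) ((b / 2) ^ 2)
  have hincl : P.real (Bad ∩ {D | ‖∑ i, Y (D i)‖ ≤ ρ}) ≤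
      (P.restrict Bad).real {D | (b / 2) ^ 2 ≤ ‖Φ (Zs D)‖ ^ 2} := by
    have hmeasset : MeasurableSet {D : Fin N → Ω | (b / 2) ^ 2 ≤ ‖Φ (Zs D)‖ ^ 2} :=
      measurableSet_le measurable_const ((hΦm.comp_measurable hZm).norm.pow 2).measurable
    rw [measureReal_restrict_apply hmeasset, Set.inter_comm]
    refine measureReal_mono ?_ (measure_ne_top _ _)
    rintro D ⟨hD, hDB⟩
    refine ⟨?_, hDB⟩
    have := half_le_norm_integral_exp hρ (z := Zs D) hD
    show (b / 2) ^ 2 ≤ ‖Φ (Zs D)‖ ^ 2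
    gcongr
  have h7 := (mul_le_mul_of_nonneg_left hincl (by positivity : 0 ≤ (b / 2) ^ 2)).trans
    (hmarkov.trans hE)
  have hbv : b = ρ⁻¹ ^ m * (volume (Metric.ball (0 : Vec m) 1)).toReal := by
    rw [hb, measureReal_def, hB, Measure.addHaar_ball_of_pos _ _ (by positivity)]
    rw [ENNReal.toReal_mul, ENNReal.toReal_ofReal (by positivity), finrank_euclideanSpace_fin]
  have hpow : (Real.pi / (c * n)) ^ ((m : ℝ) / 2) = √(Real.pi / (c * n)) ^ m := by
    rw [Real.sqrt_eq_rpow, ← Real.rpow_natCast, ← Real.rpow_mul (by positivity)]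
    congr 1; ring
  have h8 : (b / 2) ^ 2 * P.real (Bad ∩ {D | ‖∑ i, Y (D i)‖ ≤ ρ}) ≤ (b / 2) ^ 2 *
      (P.real Bad * (4 / b * √(Real.pi / (c * n)) ^ m)) := by
    refine h7.trans (le_of_eq ?_)
    rw [hpow]; field_simp; norm_num
  have h9 := le_of_mul_le_mul_left h8 (by positivity)
  refine h9.trans (le_of_eq ?_)
  rw [anticoncConst, hbv, mul_pow, inv_pow]
  have hv : 0 < (volume (Metric.ball (0 : Vec m) 1)).toReal := ENNReal.toReal_pos
    (Metric.measure_ball_pos volume _ one_pos).ne' measure_ball_lt_top.ne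
  field_simp

end

/-! ### Lower bounds for the Hessian -/

section
variable {m N : ℕ} {p : Vec m → ℝ → ℝ} {R : ℝ} {wst : Vec m} {y r c₀ : ℝ} {Z : Finset (Vec m)}

/-- Enough data near the margin hyperplane of a nearby point `q`, in every piece, bound the Hessian
at `w` from below. -/
lemma hess_ge_of_localBump (h : IsSpanning p wst y Z r c₀) {lam s ρ κ : ℝ} (hlam : 0 ≤ lam)
    (hs : 0 < s) (hsρ : s ≤ ρ) (hN : 0 < N) {D : Dataset m N} (hD : ∀ i, D i ∈ dataRange m R)
    {w q : Vec m} (hwq : ‖w - q‖ ≤ ρ) (T : Finset (Fin N))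
    (hT : ∀ z ∈ Z, κ * (N * ρ) ≤ ∑ i ∈ T, localBump z r y ρ q (D i)) (e : Vec m) :
    (s / ρ) ^ 3 * (κ * r ^ 2 / (8 * (1 + R ^ 2) ^ 2)) * ‖e‖ ^ 2 ≤
      inner ℝ (hess lam s D w e) e := by
  have hρ := hs.trans_le hsρ
  have hN' : (0 : ℝ) < N := by exact_mod_cast hN
  obtain ⟨z, hz, hdir⟩ := h.direction e
  have hr := h.r_pos
  set a : ℝ := (1 / 2) * ((s / ρ) ^ 2 / (2 * (1 + R ^ 2))) ^ 2 * (1 / s) * (r * ‖e‖) ^ 2 with ha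
  have ha0 : 0 ≤ a := by positivity
  have hterm : ∀ i, 0 ≤ psiCurv (margin w (D i) / s) * ((D i).2 ^ 2 / s) *
      (inner ℝ (D i).1 e * inner ℝ (D i).1 e) := fun i =>
    mul_nonneg (mul_nonneg (psiCurv_nonneg _) (by positivity)) (mul_self_nonneg _)
  have hpt : ∀ i, a * localBump z r y ρ q (D i) ≤
      psiCurv (margin w (D i) / s) * ((D i).2 ^ 2 / s) *
      (inner ℝ (D i).1 e * inner ℝ (D i).1 e) := by
    intro i
    by_cases hi : D i ∈ piece z r y
    swap
    · rw [localBump, Set.indicator_of_notMem hi, mul_zero]; exact hterm i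
    have hy2 : (D i).2 ^ 2 = 1 := by rw [← sq_abs, (hD i).1]; norm_num
    rw [localBump, Set.indicator_of_mem hi, hy2, ← sq, ← sq_abs (inner ℝ (D i).1 e)]
    have h1 : bump (margin q (D i) / ρ) ≤ 2 * (1 + R ^ 2) * bump (margin w (D i) / ρ) := by
      have h2 := bump_le_bump_add (margin q (D i) / ρ) ((margin w (D i) - margin q (D i)) / ρ)
      rw [← add_div, add_sub_cancel] at h2
      refine h2.trans ?_
      have h3 : ((margin w (D i) - margin q (D i)) / ρ) ^ 2 ≤ R ^ 2 := by
        have h4 := (abs_margin_sub_le (w := w) (v := q) (hD i)).trans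
          (mul_le_mul_of_nonneg_right hwq (R_nonneg_of_mem (hD i)))
        rw [sq_le_sq, abs_div, abs_of_pos hρ, div_le_iff₀ hρ, abs_of_nonneg (R_nonneg_of_mem (hD i))]
        linarith
      have := bump_pos (margin w (D i) / ρ)
      gcongr
    have h5 := bump_div_ge (u := margin w (D i)) hs hsρ
    have h6 : (s / ρ) ^ 2 / (2 * (1 + R ^ 2)) * bump (margin q (D i) / ρ) ≤
        bump (margin w (D i) / s) := by
      refine le_trans ?_ h5
      rw [div_mul_eq_mul_div, mul_div_assoc]
      gcongr
      rw [div_le_iff₀ (by positivity)]; linarith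
    have h7 := bump_sq_le_psiCurv (margin w (D i) / s)
    have h8 := hdir (D i).1 hi.1
    have hb := bump_pos (margin q (D i) / ρ)
    calc a * bump (margin q (D i) / ρ) ^ 2
        = (((s / ρ) ^ 2 / (2 * (1 + R ^ 2)) * bump (margin q (D i) / ρ)) ^ 2 / 2) * (1 / s) *
          (r * ‖e‖) ^ 2 := by rw [ha]; ring
      _ ≤ psiCurv (margin w (D i) / s) * (1 / s) * |inner ℝ (D i).1 e| ^ 2 := by
          have : 0 ≤ psiCurv (margin w (D i) / s) := psiCurv_nonneg _
          gcongr
          exact le_trans (by gcongr) h7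
  rw [inner_hess hs]
  have h1 : a * (κ * (N * ρ)) ≤ ∑ i, psiCurv (margin w (D i) / s) * ((D i).2 ^ 2 / s) *
      (inner ℝ (D i).1 e * inner ℝ (D i).1 e) := by
    calc a * (κ * (N * ρ)) ≤ a * ∑ i ∈ T, localBump z r y ρ q (D i) := by gcongr; exact hT z hz
      _ ≤ ∑ i ∈ T, psiCurv (margin w (D i) / s) * ((D i).2 ^ 2 / s) *
          (inner ℝ (D i).1 e * inner ℝ (D i).1 e) := by
          rw [Finset.mul_sum]; exact Finset.sum_le_sum fun i _ => hpt i
      _ ≤ _ := Finset.sum_le_sum_of_subset_of_nonneg (Finset.subset_univ _) fun i _ _ => hterm i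
  have h2 : (s / ρ) ^ 3 * (κ * r ^ 2 / (8 * (1 + R ^ 2) ^ 2)) * ‖e‖ ^ 2 =
      (1 / (N : ℝ)) * (a * (κ * (N * ρ))) := by
    rw [ha]; field_simp; ring
  rw [h2, empMean]
  have h3 : 0 ≤ lam * inner ℝ e e := mul_nonneg hlam real_inner_self_nonneg
  have h4 := mul_le_mul_of_nonneg_left h1 (by positivity : 0 ≤ 1 / (N : ℝ))
  linarith

/-- At a fixed point near `w⋆`, every piece of the slab of width `s` contains its share of the
data. -/
lemma exists_measure_localBump_lt_le (hp : IsDataDensity p R) (h : IsSpanning p wst y Z r c₀) :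
    ∃ κ C r₁ s₁ : ℝ, 0 < κ ∧ 0 < C ∧ 0 < r₁ ∧ 0 < s₁ ∧ ∀ N : ℕ, 0 < N → ∀ w, ‖w - wst‖ ≤ r₁ →
      ∀ s, 0 < s → s ≤ s₁ → ∀ T : Finset (Fin N), (N : ℝ) / 2 ≤ T.card →
      sampleLaw p N {D | ∃ z ∈ Z, ∑ i ∈ T, localBump z r y s w (D i) < κ * (N * s)} ≤
        ENNReal.ofReal (C / (N * s)) := by
  have := isProbabilityMeasure_dataLaw hp
  obtain ⟨c, r₁, s₁, hc, hr₁, hs₁, hlow⟩ := exists_integral_localBump_ge hp h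
  obtain ⟨CU, hCU, hU⟩ := exists_integral_bump_le hp
  refine ⟨c / 4, (Z.card + 1) * (8 * CU / c ^ 2), r₁, s₁, by positivity, by positivity, hr₁, hs₁,
    fun N hN w hw s hs hss T hT => ?_⟩
  have hN' : (0 : ℝ) < N := by exact_mod_cast hN
  have hTpos : (0 : ℝ) < T.card := lt_of_lt_of_le (by positivity) hT
  have hz : ∀ z ∈ Z, sampleLaw p N {D | ∑ i ∈ T, localBump z r y s w (D i) < c / 4 * (N * s)} ≤
      ENNReal.ofReal (8 * CU / c ^ 2 / (N * s)) := by
    intro z hz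
    set μ₁ := ∫ q, localBump z r y s w q ∂dataLaw p with hμ₁
    have h1 := hlow w hw s hs hss z hz
    have hb1 : ∀ q ∈ dataRange m R, |localBump z r y s w q| ≤ 1 := fun q _ => by
      rw [abs_of_nonneg (localBump_nonneg ..)]; exact localBump_le_one ..
    have hmem := memLp_dataLaw hp (measurable_localBump z r y s w) hb1
    have hint := integrable_dataLaw hp (measurable_localBump z r y s w) hb1
    have hsq : ∫ q, localBump z r y s w q ^ 2 ∂dataLaw p ≤ CU * s := by
      refine le_trans (integral_mono_of_nonneg (Filter.Eventually.of_forall fun q => sq_nonneg _)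
        (integrable_dataLaw hp (measurable_bump_margin w s) (B := 1) fun q _ => abs_bump_le_one _)
        (Filter.Eventually.of_forall fun q => ?_)) (hU w s hs)
      have h2 := localBump_nonneg z r y s w q
      have h3 := localBump_le_one z r y s w q
      have h4 := localBump_le z r y s w q
      show localBump z r y s w q ^ 2 ≤ bump (margin w q / s)
      nlinarith
    have ht : 0 < T.card * (c * s / 2) := by positivity
    refine (measure_mono fun D hD => ?_).trans ((pi_chebyshev hmem T ht).trans
      (ENNReal.ofReal_le_ofReal ?_))
    · have h5 : ∑ i ∈ T, localBump z r y s w (D i) < c / 4 * (N * s) := hD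
      show T.card * (c * s / 2) ≤ |∑ i ∈ T, localBump z r y s w (D i) - T.card * μ₁|
      refine le_trans ?_ (neg_le_abs _)
      have h6 : T.card * (c * s) ≤ T.card * μ₁ := by gcongr
      have h7 : (N : ℝ) / 2 * (c * s) ≤ T.card * (c * s) := by gcongr
      nlinarith
    · calc T.card * (∫ q, localBump z r y s w q ^ 2 ∂dataLaw p) / (T.card * (c * s / 2)) ^ 2
          ≤ T.card * (CU * s) / (T.card * (c * s / 2)) ^ 2 := by gcongr
        _ = 4 * CU / c ^ 2 / (T.card * s) := by field_simp; norm_num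
        _ ≤ 4 * CU / c ^ 2 / ((N : ℝ) / 2 * s) := by gcongr
        _ = _ := by field_simp; norm_num
  have hset : {D : Dataset m N | ∃ z ∈ Z, ∑ i ∈ T, localBump z r y s w (D i) < c / 4 * (N * s)} =
      ⋃ z ∈ Z, {D | ∑ i ∈ T, localBump z r y s w (D i) < c / 4 * (N * s)} := by
    ext D; simp
  rw [hset]
  refine (measure_biUnion_finset_le _ _).trans ((Finset.sum_le_sum hz).trans ?_)
  rw [Finset.sum_const, nsmul_eq_mul, ← ENNReal.ofReal_natCast, ← ENNReal.ofReal_mul (by positivity)]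
  refine ENNReal.ofReal_le_ofReal ?_
  rw [← mul_div_assoc]
  gcongr
  linarith

end

/-! ### The characteristic function of a Newton step -/

section
variable {Ω : Type*} [MeasurableSpace Ω] {μ : Measure Ω} [IsProbabilityMeasure μ]

/-- If a random phase takes well separated values with positive probability, then its character has
modulus less than one. -/
lemma norm_integral_exp_sq_le {F : Ω → ℝ} (hF : Measurable F) {A B : Set Ω} (hA : MeasurableSet A)
    (hB : MeasurableSet B) {δ : ℝ} (hδ : 0 ≤ δ)
    (hAB : ∀ a ∈ A, ∀ b ∈ B, δ ≤ |F a - F b| ∧ |F a - F b| ≤ Real.pi) :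
    ‖∫ z, Complex.exp (((F z : ℝ) : ℂ) * Complex.I) ∂μ‖ ^ 2 ≤
      1 - 2 / Real.pi ^ 2 * δ ^ 2 * (μ.real A * μ.real B) := by
  have hsq : ((‖∫ z, Complex.exp (((F z : ℝ) : ℂ) * Complex.I) ∂μ‖ ^ 2 : ℝ) : ℂ) =
      ∫ x : Ω × Ω, Complex.exp (((F x.1 - F x.2 : ℝ) : ℂ) * Complex.I) ∂(μ.prod μ) := by
    rw [← Complex.normSq_eq_norm_sq, ← Complex.mul_conj, ← integral_conj, ← integral_prod_mul]
    refine integral_congr_ae (Filter.Eventually.of_forall fun x => ?_)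
    simp only
    rw [← Complex.exp_conj, ← Complex.exp_add]
    congr 1
    simp
    ring
  have hint : Integrable (fun x : Ω × Ω => Complex.exp (((F x.1 - F x.2 : ℝ) : ℂ) * Complex.I))
      (μ.prod μ) :=
    Integrable.of_bound (by fun_prop) 1 (Filter.Eventually.of_forall fun x => by
      rw [Complex.norm_exp_ofReal_mul_I])
  have hre := integral_re (𝕜 := ℂ) hint
  simp only [RCLike.re_to_complex, Complex.exp_ofReal_mul_I_re] at hre
  rw [← hsq, Complex.ofReal_re] at hre
  rw [← hre]
  have hI : Integrable ((A ×ˢ B).indicator fun _ : Ω × Ω => 2 / Real.pi ^ 2 * δ ^ 2) (μ.prod μ) :=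
    (integrable_const _).indicator (hA.prod hB)
  calc ∫ x : Ω × Ω, Real.cos (F x.1 - F x.2) ∂(μ.prod μ)
      ≤ ∫ x : Ω × Ω, (1 - (A ×ˢ B).indicator (fun _ => 2 / Real.pi ^ 2 * δ ^ 2) x) ∂(μ.prod μ) := by
        refine integral_mono (Integrable.of_bound (by fun_prop) 1
          (Filter.Eventually.of_forall fun x => by
            rw [Real.norm_eq_abs]; exact Real.abs_cos_le_one _)) ((integrable_const _).sub hI)
          fun x => ?_
        by_cases hx : x ∈ A ×ˢ B
        · simp only [Set.indicator_of_mem hx]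
          obtain ⟨h1, h2⟩ := hAB x.1 hx.1 x.2 hx.2
          refine (Real.cos_le_one_sub_mul_cos_sq h2).trans ?_
          have h3 : δ ^ 2 ≤ (F x.1 - F x.2) ^ 2 := by
            rw [← sq_abs (F x.1 - F x.2)]; gcongr
          gcongr
        · simp only [Set.indicator_of_notMem hx, sub_zero]; exact Real.cos_le_one _
    _ = _ := by
        rw [integral_sub (integrable_const _) hI, integral_indicator (hA.prod hB),
          setIntegral_const, measureReal_prod_prod]
        simp; ring

end

/-- The contribution of a data point to `∇f̂ + Hess f̂ · b`, the gradient predicted by the Newton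
model at the displacement `b`. -/
def newtonKer {m : ℕ} (s : ℝ) (w b : Vec m) (q : Vec m × ℝ) : Vec m :=
  (psiCurv (margin w q / s) * (q.2 ^ 2 / s) * inner ℝ q.1 b - psiDeriv (margin w q / s) * q.2) • q.1

section
variable {m N : ℕ} {p : Vec m → ℝ → ℝ} {R : ℝ} {wst : Vec m} {y r c₀ : ℝ} {Z : Finset (Vec m)}

lemma continuous_newtonKer (s : ℝ) (w b : Vec m) : Continuous (newtonKer s w b) := by
  unfold newtonKer
  have h1 := continuous_psiCurv.comp ((continuous_margin w).div_const s)
  have h2 := continuous_psiDeriv.comp ((continuous_margin w).div_const s)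
  exact (((h1.mul (by fun_prop)).mul (by fun_prop)).sub (h2.mul continuous_snd)).smul continuous_fst

lemma sum_newtonKer {s : ℝ} (hs : 0 < s) (hN : 0 < N) (D : Dataset m N) (w b : Vec m) :
    ∑ i, newtonKer s w b (D i) = (N : ℝ) • (grad 0 s D w + hess 0 s D w b) := by
  have hN' : (N : ℝ) ≠ 0 := by exact_mod_cast hN.ne'
  refine ext_inner_right ℝ fun e => ?_
  rw [inner_smul_left, inner_add_left, inner_grad hs, inner_hess hs, sum_inner, empMean, empMean,
    RCLike.conj_to_real, zero_mul, zero_mul, zero_sub, zero_add, ← sub_eq_neg_add, ← mul_sub,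
    ← Finset.sum_sub_distrib, ← mul_assoc, mul_one_div_cancel hN', one_mul]
  refine Finset.sum_congr rfl fun i _ => ?_
  rw [newtonKer, inner_smul_left, RCLike.conj_to_real]; ring

lemma dataLaw_real_piece_ge (hp : IsDataDensity p R) (hy : y ∈ labels) (hc₀ : 0 ≤ c₀) {z : Vec m}
    {ρ : ℝ} (hd : ∀ x ∈ Metric.ball z ρ, c₀ ≤ p x y) :
    c₀ * (volume (Metric.ball (0 : Vec m) ρ)).toReal ≤ (dataLaw p).real (piece z ρ y) := by
  have := isProbabilityMeasure_dataLaw hp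
  have h1 := lintegral_piece_ge hp hy hd (f := 1) measurable_one
  rw [lintegral_indicator_one (measurableSet_piece z ρ y)] at h1
  simp only [Pi.one_apply, setLIntegral_one] at h1
  rw [Measure.addHaar_ball_center] at h1
  have h2 := ENNReal.toReal_mono (measure_ne_top _ _) h1
  rwa [ENNReal.toReal_mul, ENNReal.toReal_ofReal hc₀] at h2

/-- Points of a ball on the far side of the margin see the loss as linear, so that the sum of their
contributions is spread out in all directions. -/
lemma exists_charFun_newtonKer_le (hp : IsDataDensity p R) (h : IsSpanning p wst y Z r c₀) :
    ∃ c t₀ r₁ s₁ : ℝ, 0 < c ∧ 0 < t₀ ∧ 0 < r₁ ∧ 0 < s₁ ∧ ∀ w, ‖w - wst‖ ≤ r₁ → ∀ b : Vec m,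
      ‖b‖ ≤ 1 → ∀ s, 0 < s → s ≤ s₁ → ∀ t : Vec m, ‖t‖ ≤ t₀ →
      ‖∫ q, Complex.exp (((inner ℝ t (newtonKer s w b q) : ℝ) : ℂ) * Complex.I) ∂dataLaw p‖ ≤
        Real.exp (-c * ‖t‖ ^ 2) := by
  have := isProbabilityMeasure_dataLaw hp
  have hR := hp.R_pos
  have hr := h.r_pos
  have hc₀ := h.c_pos
  have hn : 0 < ‖wst‖ := norm_pos_iff.2 h.wst_ne_zero
  obtain ⟨z, hz, -⟩ := h.direction 0
  have hy1 := abs_eq_one_of_mem_labels h.label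
  have hyy : y * y = 1 := by rw [← abs_mul_abs_self, hy1]; norm_num
  have hy2 : y ^ 2 = 1 := by rw [sq, hyy]
  set V := (volume (Metric.ball (0 : Vec m) (r / 16))).toReal with hV
  have hV0 : 0 < V := ENNReal.toReal_pos
    (Metric.measure_ball_pos volume _ (by positivity)).ne' measure_ball_lt_top.ne
  set u := ‖wst‖⁻¹ • wst with hu
  have hun : ‖u‖ = 1 := norm_self_unit h.wst_ne_zero
  -- the centre of a ball on which the margin is positive
  set z' := z - (r / 2 * y) • u with hz'
  set κ := r * ‖wst‖ / 8 with hκ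
  have hκ0 : 0 < κ := by positivity
  have hsub : ∀ x ∈ Metric.ball z' (r / 4), x ∈ Metric.ball z r := by
    intro x hx
    rw [Metric.mem_ball, dist_eq_norm] at hx ⊢
    have h1 : ‖(r / 2 * y) • u‖ = r / 2 := by
      rw [norm_smul, hun, Real.norm_eq_abs, abs_mul, hy1, mul_one, mul_one, abs_of_pos (by positivity)]
    calc ‖x - z‖ = ‖(x - z') - (r / 2 * y) • u‖ := by rw [hz']; congr 1; abel
      _ ≤ ‖x - z'‖ + ‖(r / 2 * y) • u‖ := norm_sub_le _ _
      _ < r := by rw [h1]; linarith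
  have hxR : ∀ x ∈ Metric.ball z r, ‖x‖ ≤ R := fun x hx =>
    (hp.norm_lt h.label (by have := h.density z hz x hx; linarith)).le
  have hmargin : ∀ w, ‖w - wst‖ ≤ r * ‖wst‖ / (8 * R) → ∀ x ∈ Metric.ball z' (r / 4),
      κ ≤ margin w (x, y) := by
    intro w hw x hx
    have h1 := abs_margin_sub_le (R := R) (w := w) (v := wst) (q := (x, y)) ⟨hy1, hxR x (hsub x hx)⟩
    have h2 : ‖w - wst‖ * R ≤ r * ‖wst‖ / 8 := by
      calc ‖w - wst‖ * R ≤ r * ‖wst‖ / (8 * R) * R := by gcongr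
        _ = _ := by field_simp
    have h3 : margin wst (x, y) = r / 2 * ‖wst‖ - y * inner ℝ wst (x - z') := by
      have : x = z + (-((r / 2 * y) • u) + (x - z')) := by rw [hz']; abel
      conv_lhs => rw [this]
      rw [margin_add, h.margin_eq z hz, inner_add_right, inner_neg_right, inner_smul_right, hu,
        inner_self_unit h.wst_ne_zero]
      linear_combination (r / 2 * ‖wst‖) * hyy
    have h4 : |y * inner ℝ wst (x - z')| ≤ ‖wst‖ * (r / 4) := by
      rw [abs_mul, hy1, one_mul]
      refine (abs_real_inner_le_norm _ _).trans ?_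
      rw [Metric.mem_ball, dist_eq_norm] at hx
      gcongr
    have h5 := (abs_le.1 h1).1
    have h6 := (abs_le.1 h4).2
    rw [hκ]; linarith
  clear_value κ z'
  set s₁ : ℝ := min 1 (r * κ ^ 2 / (32 * (R + R ^ 2))) with hs₁
  set g := c₀ * V with hg
  have hg0 : 0 < g := by positivity
  refine ⟨1 / Real.pi ^ 2 * (r / 16) ^ 2 * (g * g), 1 / (R + r), r * ‖wst‖ / (8 * R), s₁,
    by positivity, by positivity, by positivity, by positivity,
    fun w hw b hb s hs hss t ht => ?_⟩
  have hs1 : s ≤ 1 := hss.trans (min_le_left _ _)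
  have hs2 : s ≤ r * κ ^ 2 / (32 * (R + R ^ 2)) := hss.trans (min_le_right _ _)
  set c := 1 / Real.pi ^ 2 * (r / 16) ^ 2 * (g * g) with hc
  rcases eq_or_ne t 0 with rfl | ht0
  · simp
  have htn : 0 < ‖t‖ := norm_pos_iff.2 ht0
  -- the kernel is almost linear on the ball around `z'`
  have hlin : ∀ x ∈ Metric.ball z' (r / 4),
      |inner ℝ t (newtonKer s w b (x, y)) + y * inner ℝ t x| ≤ ‖t‖ * (r / 32) := by
    intro x hx
    have hm := hmargin w hw x hx
    have hR' := hxR x (hsub x hx)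
    have hbump2 : bump (margin w (x, y) / s) ≤ s ^ 2 / κ ^ 2 := by
      unfold bump
      rw [inv_le_comm₀ (by positivity) (by positivity), inv_div, div_pow]
      have : κ ^ 2 / s ^ 2 ≤ margin w (x, y) ^ 2 / s ^ 2 := by gcongr
      linarith
    have hbump : bump (margin w (x, y) / s) ≤ s / κ ^ 2 := by
      refine hbump2.trans ?_
      gcongr
      nlinarith
    have h1 := one_sub_psiDeriv_le (u := margin w (x, y) / s) (div_nonneg (hκ0.le.trans hm) hs.le)
    have h2 := psiDeriv_le_one (margin w (x, y) / s)
    have h3 := psiCurv_le_bump (margin w (x, y) / s)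
    have h4 := psiCurv_nonneg (margin w (x, y) / s)
    have hxb : |inner ℝ x b| ≤ R := (abs_real_inner_le_norm _ _).trans (by nlinarith [norm_nonneg b])
    have htx : |inner ℝ t x| ≤ ‖t‖ * R := (abs_real_inner_le_norm _ _).trans (by gcongr)
    have heq : inner ℝ t (newtonKer s w b (x, y)) + y * inner ℝ t x =
        (psiCurv (margin w (x, y) / s) * (1 / s) * inner ℝ x b +
          y * (1 - psiDeriv (margin w (x, y) / s))) * inner ℝ t x := by
      rw [newtonKer, inner_smul_right]
      simp only [hy2]; ring
    have h5 : |psiCurv (margin w (x, y) / s) * (1 / s) * inner ℝ x b +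
          y * (1 - psiDeriv (margin w (x, y) / s))| ≤ s / κ ^ 2 * (1 + R) := by
      refine (abs_add_le _ _).trans ?_
      rw [abs_mul, abs_mul, abs_of_nonneg h4, abs_of_pos (one_div_pos.2 hs), abs_mul y, hy1, one_mul,
        abs_of_nonneg (by linarith : 0 ≤ 1 - psiDeriv (margin w (x, y) / s))]
      have h6 : psiCurv (margin w (x, y) / s) * (1 / s) * |inner ℝ x b| ≤
          s ^ 2 / κ ^ 2 * (1 / s) * R := by
        have : psiCurv (margin w (x, y) / s) ≤ s ^ 2 / κ ^ 2 := by
          have := bump_pos (margin w (x, y) / s); linarith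
        gcongr
      have h7 : s ^ 2 / κ ^ 2 * (1 / s) * R = s / κ ^ 2 * R := by field_simp
      have := bump_pos (margin w (x, y) / s)
      linarith
    rw [heq, abs_mul]
    calc _ ≤ (s / κ ^ 2 * (1 + R)) * (‖t‖ * R) := by gcongr
      _ = ‖t‖ * (s * (R + R ^ 2) / κ ^ 2) := by ring
      _ ≤ ‖t‖ * (r / 32) := by
        refine mul_le_mul_of_nonneg_left ?_ htn.le
        rw [div_le_iff₀ (by positivity)]
        rw [le_div_iff₀ (by positivity)] at hs2
        linarith
  set v := ‖t‖⁻¹ • t with hv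
  have hvn : ‖v‖ = 1 := norm_self_unit ht0
  have htv : inner ℝ t v = ‖t‖ := inner_self_unit ht0
  -- two small balls, separated in the direction of `t`
  have hballs : ∀ σ : ℝ, |σ| = 1 → ∀ x ∈ Metric.ball (z' + (σ * (r / 8)) • v) (r / 16),
      x ∈ Metric.ball z' (r / 4) ∧ |inner ℝ t x - inner ℝ t z' - σ * (r / 8) * ‖t‖| ≤ ‖t‖ * (r / 16) := by
    intro σ hσ x hx
    rw [Metric.mem_ball, dist_eq_norm] at hx
    constructor
    · rw [Metric.mem_ball, dist_eq_norm]
      have h1 : ‖(σ * (r / 8)) • v‖ = r / 8 := by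
        rw [norm_smul, hvn, Real.norm_eq_abs, abs_mul, hσ, one_mul, mul_one, abs_of_pos (by positivity)]
      calc ‖x - z'‖ = ‖(x - (z' + (σ * (r / 8)) • v)) + (σ * (r / 8)) • v‖ := by congr 1; abel
        _ ≤ ‖x - (z' + (σ * (r / 8)) • v)‖ + ‖(σ * (r / 8)) • v‖ := norm_add_le _ _
        _ < r / 4 := by rw [h1]; linarith
    · have h1 : inner ℝ t x - inner ℝ t z' - σ * (r / 8) * ‖t‖ =
          inner ℝ t (x - (z' + (σ * (r / 8)) • v)) := by
        rw [inner_sub_right, inner_add_right, inner_smul_right, htv]; ring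
      rw [h1]
      refine (abs_real_inner_le_norm _ _).trans (by gcongr)
  have hdens : ∀ σ : ℝ, |σ| = 1 →
      g ≤ (dataLaw p).real (piece (z' + (σ * (r / 8)) • v) (r / 16) y) := fun σ hσ =>
    dataLaw_real_piece_ge hp h.label hc₀.le fun x hx =>
      h.density z hz x (hsub x (hballs σ hσ x hx).1)
  have hsep : ∀ a ∈ piece (z' + ((1 : ℝ) * (r / 8)) • v) (r / 16) y,
      ∀ a' ∈ piece (z' + ((-1 : ℝ) * (r / 8)) • v) (r / 16) y,
      ‖t‖ * (r / 16) ≤ |inner ℝ t (newtonKer s w b a) - inner ℝ t (newtonKer s w b a')| ∧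
      |inner ℝ t (newtonKer s w b a) - inner ℝ t (newtonKer s w b a')| ≤ Real.pi := by
    rintro ⟨x, y₁⟩ ⟨hx, hy₁⟩ ⟨x', y₂⟩ ⟨hx', hy₂⟩
    simp only at hx hy₁ hx' hy₂
    rw [hy₁, hy₂]
    obtain ⟨h1, h2⟩ := hballs 1 (by simp) x hx
    obtain ⟨h3, h4⟩ := hballs (-1) (by simp) x' hx'
    have h5 := abs_le.1 (hlin x h1)
    have h6 := abs_le.1 (hlin x' h3)
    have h7 := abs_le.1 h2
    have h8 := abs_le.1 h4
    have hpi : ‖t‖ * (R + r) ≤ 1 := by rwa [← le_div_iff₀ (by positivity)]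
    have hpi3 := Real.pi_gt_three
    have htR : 0 < ‖t‖ * R := by positivity
    have htr : 0 < ‖t‖ * r := by positivity
    rcases mem_labels.1 h.label with hy' | hy'
    · rw [hy'] at h5 h6 ⊢
      have hneg : inner ℝ t (newtonKer s w b (x, 1)) - inner ℝ t (newtonKer s w b (x', 1)) ≤ 0 := by
        linarith
      rw [abs_of_nonpos hneg]
      constructor <;> linarith
    · rw [hy'] at h5 h6 ⊢
      have hpos : 0 ≤ inner ℝ t (newtonKer s w b (x, -1)) - inner ℝ t (newtonKer s w b (x', -1)) := by
        linarith
      rw [abs_of_nonneg hpos]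
      constructor <;> linarith
  have key := norm_integral_exp_sq_le (μ := dataLaw p)
    (F := fun q => inner ℝ t (newtonKer s w b q))
    (((continuous_const.inner (continuous_newtonKer s w b))).measurable)
    (measurableSet_piece _ _ _) (measurableSet_piece _ _ _) (by positivity) hsep
  have h9 : g * g ≤ (dataLaw p).real (piece (z' + ((1 : ℝ) * (r / 8)) • v) (r / 16) y) *
      (dataLaw p).real (piece (z' + ((-1 : ℝ) * (r / 8)) • v) (r / 16) y) :=
    mul_le_mul (hdens 1 (by simp)) (hdens (-1) (by simp)) hg0.le measureReal_nonneg
  have h10 : ‖∫ q, Complex.exp (((inner ℝ t (newtonKer s w b q) : ℝ) : ℂ) * Complex.I)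
      ∂dataLaw p‖ ^ 2 ≤ Real.exp (-c * ‖t‖ ^ 2) ^ 2 := by
    refine key.trans ?_
    rw [← Real.exp_nat_mul]
    refine le_trans ?_ (Real.add_one_le_exp _)
    have h11 : 2 / Real.pi ^ 2 * (‖t‖ * (r / 16)) ^ 2 * (g * g) ≤ 2 / Real.pi ^ 2 *
        (‖t‖ * (r / 16)) ^ 2 * ((dataLaw p).real (piece (z' + ((1 : ℝ) * (r / 8)) • v) (r / 16) y) *
      (dataLaw p).real (piece (z' + ((-1 : ℝ) * (r / 8)) • v) (r / 16) y)) := by gcongr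
    have h12 : ((2 : ℕ) : ℝ) * (-c * ‖t‖ ^ 2) =
        -(2 / Real.pi ^ 2 * (‖t‖ * (r / 16)) ^ 2 * (g * g)) := by
      rw [hc]; push_cast; ring
    linarith
  exact le_of_sq_le_sq h10 (Real.exp_pos _).le

end

/-! ### Coercivity of the Hessian at the end of a Newton step -/

section
variable {m : ℕ} {p : Vec m → ℝ → ℝ} {R : ℝ} {wst : Vec m} {y r c₀ : ℝ} {Z : Finset (Vec m)}

lemma card_filter_lt_half (N : ℕ) :
    (Finset.univ.filter fun i : Fin N => (i : ℕ) < N / 2).card = N / 2 := by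
  have h := Fin.card_filter_val_lt (n := N) (m := N / 2)
  rw [h]
  omega

/-- The grid of mesh `s` that covers a ball of radius `M / √N` has about `(1 / x) ^ m` points with
`x = s √N`, and each of them is hit with probability of order `min 1 x ^ m`. -/
lemma grid_mul_hit_le (m : ℕ) {M K L x P b : ℝ} (hM : 0 ≤ M) (hK : 0 ≤ K) (hL : 0 ≤ L)
    (hx : 0 < x) (hb : 0 ≤ b) (h1 : P ≤ b) (h2 : P ≤ b * (K * (L * x) ^ m)) :
    (2 * (m + 1) * (M / x) + 1) ^ m * P ≤
      (2 * (m + 1) * M + 1) ^ m * (1 + K * L ^ m) * b := by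
  have hKL : 0 ≤ K * L ^ m := by positivity
  rcases le_total 1 x with h | h
  · have h3 : M / x ≤ M := div_le_self hM h
    calc (2 * (m + 1) * (M / x) + 1) ^ m * P
        ≤ (2 * (m + 1) * (M / x) + 1) ^ m * b := mul_le_mul_of_nonneg_left h1 (by positivity)
      _ ≤ (2 * (m + 1) * M + 1) ^ m * ((1 + K * L ^ m) * b) := by
        refine mul_le_mul ?_ (by nlinarith) hb (by positivity)
        gcongr
      _ = (2 * (m + 1) * M + 1) ^ m * (1 + K * L ^ m) * b := by ring
  · calc (2 * (m + 1) * (M / x) + 1) ^ m * P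
        ≤ (2 * (m + 1) * (M / x) + 1) ^ m * (b * (K * (L * x) ^ m)) := by gcongr
      _ = ((2 * (m + 1) * (M / x) + 1) * x) ^ m * (K * L ^ m) * b := by
        rw [mul_pow L, mul_pow]; ring
      _ = (2 * (m + 1) * M + x) ^ m * (K * L ^ m) * b := by
        congr 3; field_simp
      _ ≤ (2 * (m + 1) * M + 1) ^ m * (1 + K * L ^ m) * b := by
        gcongr
        linarith

/-- The Hessian is coercive at the end of a full Newton step. The end point depends on the data,
and at the scale `s` it ranges over far too many places for a union bound. However, it can only be
within `s` of a given point `q` if the sum of the linearized gradients at `q` is small, which has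
small probability by the anti-concentration bound, while the degeneracy of the Hessian near `q` is
witnessed by one half of the data alone. -/
lemma exists_measure_newton_end_degenerate_le (hp : IsDataDensity p R)
    (h : IsSpanning p wst y Z r c₀) {M : ℝ} (hM : 1 ≤ M) {ε : ℝ} (hε : 0 < ε) :
    ∃ c r₂ s₁ : ℝ, 0 < c ∧ 0 < r₂ ∧ 0 < s₁ ∧ ∃ C : ℝ, 0 < C ∧ ∀ N : ℕ, ∀ w q₀ : Vec m,
      ‖w - wst‖ ≤ r₂ → ∀ s, 0 < s → s ≤ s₁ → C ≤ N * s →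
      ‖q₀ - w‖ + M / √N + s ≤ r₂ →
      sampleLaw p N {D | (∀ i, D i ∈ dataRange m R) ∧ (hess 0 s D w).IsInvertible ∧
        (∀ v, ‖hess 0 s D w v‖ ≤ M * ‖v‖) ∧ ‖w + newtonDir 0 s D w - q₀‖ ≤ M / √N ∧
        ¬ ∀ e, c * ‖e‖ ^ 2 ≤ inner ℝ (hess 0 s D (w + newtonDir 0 s D w) e) e} ≤
        ENNReal.ofReal ε := by
  have := isProbabilityMeasure_dataLaw hp
  obtain ⟨κ, C₁, r₁, s₁, hκ, hC₁, hr₁, hs₁, hbad⟩ := exists_measure_localBump_lt_le hp h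
  obtain ⟨c', t₀, r₁', s₁', hc', ht₀, hr₁', hs₁', hchar⟩ := exists_charFun_newtonKer_le hp h
  set K := anticoncConst m
  have hK : 0 < K := anticoncConst_pos m
  set L := M * √(4 * Real.pi / c') with hL
  set Q := (2 * (m + 1) * M + 1) ^ m * (1 + K * L ^ m) with hQ
  have hL0 : 0 ≤ L := by positivity
  have hQ0 : 0 < Q := by positivity
  refine ⟨κ * r ^ 2 / (8 * (1 + R ^ 2) ^ 2), min (min (r₁ / 2) r₁') 1, min (min s₁ s₁') 1,
    by have := h.r_pos; positivity, by positivity, by positivity,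
    max (Q * C₁ / ε) (2 / t₀) + 2, by positivity, fun N w q₀ hw s hs hss hNs hq₀ => ?_⟩
  have hw1 : ‖w - wst‖ ≤ r₁ / 2 := hw.trans ((min_le_left _ _).trans (min_le_left _ _))
  have hw2 : ‖w - wst‖ ≤ r₁' := hw.trans ((min_le_left _ _).trans (min_le_right _ _))
  have hq1 : ‖q₀ - w‖ + M / √N + s ≤ r₁ / 2 :=
    hq₀.trans ((min_le_left _ _).trans (min_le_left _ _))
  have hq2 : ‖q₀ - w‖ + M / √N + s ≤ 1 := hq₀.trans (min_le_right _ _)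
  have hsa : s ≤ s₁ := hss.trans ((min_le_left _ _).trans (min_le_left _ _))
  have hsb : s ≤ s₁' := hss.trans ((min_le_left _ _).trans (min_le_right _ _))
  have hsc : s ≤ 1 := hss.trans (min_le_right _ _)
  have hC1 : Q * C₁ / ε ≤ N * s := (le_max_left _ _).trans (by linarith)
  have hC2 : 2 / t₀ ≤ N * s := (le_max_right _ _).trans (by linarith)
  have hC3 : 2 ≤ N * s := by
    have : 0 ≤ max (Q * C₁ / ε) (2 / t₀) := le_max_of_le_right (by positivity)
    linarith
  have hN2 : (2 : ℝ) ≤ N := by nlinarith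
  have hN2' : 2 ≤ N := by exact_mod_cast hN2
  have hN0 : 0 < N := by omega
  have hNr : (0 : ℝ) < N := by linarith
  have hsq : 0 < √(N : ℝ) := Real.sqrt_pos.2 hNr
  -- one half of the data
  set S := Finset.univ.filter fun i : Fin N => (i : ℕ) < N / 2 with hSdef
  have hSc : S.card = N / 2 := card_filter_lt_half N
  have hS1 : (N : ℝ) / 4 ≤ S.card := by
    have : N ≤ 4 * (N / 2) := by omega
    have : (N : ℝ) ≤ 4 * ((N / 2 : ℕ) : ℝ) := by exact_mod_cast this
    rw [hSc]; linarith
  have hS0 : 0 < S.card := by rw [hSc]; omega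
  have hT : (N : ℝ) / 2 ≤ (Sᶜ).card := by
    have : N ≤ 2 * (Sᶜ).card := by rw [Finset.card_compl, hSc, Fintype.card_fin]; omega
    have : (N : ℝ) ≤ 2 * (Sᶜ).card := by exact_mod_cast this
    linarith
  -- `A w₁ D`: the Newton step ends at `w₁`, where the Hessian is degenerate; `A' q D`: what remains
  -- of this at a grid point `q` near `w₁`
  set A : Vec m → Dataset m N → Prop := fun w₁ D => (∀ i, D i ∈ dataRange m R) ∧
    (∀ v, ‖hess 0 s D w v‖ ≤ M * ‖v‖) ∧ grad 0 s D w + hess 0 s D w (w₁ - w) = 0 ∧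
    ¬ ∀ e, κ * r ^ 2 / (8 * (1 + R ^ 2) ^ 2) * ‖e‖ ^ 2 ≤ inner ℝ (hess 0 s D w₁ e) e with hA
  set A' : Vec m → Dataset m N → Prop := fun q D =>
    (∃ z ∈ Z, ∑ i ∈ Sᶜ, localBump z r y s q (D i) < κ * (N * s)) ∧
      ‖∑ i, newtonKer s w (q - w) (D i)‖ ≤ N * (M * s) with hA'
  have hstep := measure_exists_le_of_grid (sampleLaw p N) q₀ (ρ := M / √N) (s := s)
    (κ := min (C₁ / (N * s)) (C₁ / (N * s) * (K * (L * (s * √N)) ^ m)))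
    (by positivity) hs (A := A) (A' := A') ?_ ?_
  · refine (measure_mono ?_).trans (hstep.trans (ENNReal.ofReal_le_ofReal ?_))
    · rintro D ⟨hD, hinv, hb, hd, hc⟩
      refine ⟨w + newtonDir 0 s D w, hd, hD, hb, ?_, hc⟩
      rw [add_sub_cancel_left, hess_newtonDir hinv, add_neg_cancel]
    · have h1 : M / √N / s = M / (s * √N) := by rw [div_div, mul_comm]
      rw [h1]
      refine (grid_mul_hit_le m (b := C₁ / (N * s)) (by linarith) hK.le hL0 (by positivity)
        (by positivity) (min_le_left _ _) (min_le_right _ _)).trans ?_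
      change Q * (C₁ / (N * s)) ≤ ε
      rw [mul_div_assoc', div_le_iff₀ (by positivity)]
      rw [div_le_iff₀ hε] at hC1
      linarith
  · rintro w₁ q D hwq - ⟨hD, hb, hd, hc⟩
    refine ⟨?_, ?_⟩
    · by_contra hcon
      push Not at hcon
      refine hc fun e => ?_
      have h1 := hess_ge_of_localBump h le_rfl hs le_rfl hN0 hD hwq Sᶜ hcon e
      rwa [div_self hs.ne', one_pow, one_mul] at h1
    · have h1 : grad 0 s D w + hess 0 s D w (q - w) = hess 0 s D w (q - w₁) := by
        have h2 : q - w = (w₁ - w) + (q - w₁) := by abel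
        rw [h2, map_add, ← add_assoc, hd, zero_add]
      rw [sum_newtonKer hs hN0, h1, norm_smul, Real.norm_eq_abs, abs_of_pos hNr]
      gcongr
      refine (hb _).trans ?_
      rw [norm_sub_rev]
      gcongr
  · intro q hq
    have hqw : ‖q - w‖ ≤ ‖q₀ - w‖ + M / √N + s := by
      have : q - w = (q - q₀) + (q₀ - w) := by abel
      rw [this]; refine (norm_add_le _ _).trans (by linarith)
    have hqs : ‖q - wst‖ ≤ r₁ := by
      have : q - wst = (q - w) + (w - wst) := by abel
      rw [this]; refine (norm_add_le _ _).trans (by linarith)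
    -- `Bad` only involves the data outside `S`; those in `S` still make the sum spread out
    set Bad : Set (Dataset m N) :=
      {D | ∃ z ∈ Z, ∑ i ∈ Sᶜ, localBump z r y s q (D i) < κ * (N * s)} with hBad
    have hBm : MeasurableSet Bad := by
      have : Bad = ⋃ z ∈ Z, {D | ∑ i ∈ Sᶜ, localBump z r y s q (D i) < κ * (N * s)} := by
        ext D; simp [hBad]
      rw [this]
      refine Finset.measurableSet_biUnion _ fun z _ => measurableSet_lt ?_ measurable_const
      exact Finset.measurable_sum _ fun i _ =>
        (measurable_localBump z r y s q).comp (measurable_pi_apply i)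
    have hPB : (sampleLaw p N).real Bad ≤ C₁ / (N * s) :=
      ENNReal.toReal_le_of_le_ofReal (by positivity) (hbad N hN0 q hqs s hs hsa Sᶜ hT)
    have hkey := measure_bad_inter_sum_le (μ := dataLaw p) hBm S (fun D D' hDD hD => ?_)
      (continuous_newtonKer s w (q - w)).measurable hc' hS0 (t₀ := t₀)
      (ρ := N * (M * s)) (by positivity) ?_
      (hchar w hw2 (q - w) (hqw.trans hq2) s hs hsb)
    · have hset : {D | A' q D} = Bad ∩ {D | ‖∑ i, newtonKer s w (q - w) (D i)‖ ≤ N * (M * s)} := rfl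
      have : IsProbabilityMeasure (sampleLaw p N) := by unfold sampleLaw; infer_instance
      rw [hset, ← ofReal_measureReal]
      refine ENNReal.ofReal_le_ofReal (le_min ?_ ?_)
      · exact (measureReal_mono Set.inter_subset_left).trans hPB
      · refine hkey.trans ?_
        have h1 : N * (M * s) * √(Real.pi / (c' * S.card)) ≤ L * (s * √N) := by
          have h2 : √(Real.pi / (c' * S.card)) ≤ √(4 * Real.pi / c') / √N := by
            rw [← Real.sqrt_div' _ hNr.le]
            refine Real.sqrt_le_sqrt ?_
            rw [div_div, div_le_div_iff₀ (by positivity) (by positivity)]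
            nlinarith [mul_pos Real.pi_pos hc']
          calc N * (M * s) * √(Real.pi / (c' * S.card))
              ≤ N * (M * s) * (√(4 * Real.pi / c') / √N) := by gcongr
            _ = L * (s * (N / √N)) := by rw [hL]; ring
            _ = L * (s * √N) := by rw [Real.div_sqrt]
        change (sampleLaw p N).real Bad * _ ≤ _
        gcongr
    · obtain ⟨z, hz, hlt⟩ := hD
      refine ⟨z, hz, ?_⟩
      rwa [Finset.sum_congr rfl fun i hi => by rw [← hDD i (Finset.mem_compl.1 hi)]]
    · rw [div_le_iff₀ (by positivity)]
      rw [div_le_iff₀ ht₀] at hC2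
      have : N * s * t₀ ≤ t₀ * (N * (M * s)) := by
        have : N * s * t₀ * 1 ≤ N * s * t₀ * M := by gcongr
        linarith
      linarith
end

/-! ### Deviations of gradient and Hessian from their expectations -/

section
variable {m N : ℕ} {p : Vec m → ℝ → ℝ} {R : ℝ}

/-- The deviation of the empirical mean of `f` from its expectation. -/
def meanDev (p : Vec m → ℝ → ℝ) (D : Dataset m N) (f : Vec m × ℝ → ℝ) : ℝ :=
  empMean D f - ∫ q, f q ∂dataLaw p

lemma meanDev_add {f g : Vec m × ℝ → ℝ} (hf : Integrable f (dataLaw p))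
    (hg : Integrable g (dataLaw p)) (D : Dataset m N) :
    meanDev p D (fun q => f q + g q) = meanDev p D f + meanDev p D g := by
  unfold meanDev
  rw [empMean_add, integral_add hf hg]; ring

lemma meanDev_sum_mul {ι : Type*} (S : Finset ι) (c : ι → ℝ) {f : ι → Vec m × ℝ → ℝ}
    (hf : ∀ i ∈ S, Integrable (f i) (dataLaw p)) (D : Dataset m N) :
    meanDev p D (fun q => ∑ i ∈ S, c i * f i q) = ∑ i ∈ S, c i * meanDev p D (f i) := by
  unfold meanDev empMean
  rw [integral_finsetSum _ fun i hi => (hf i hi).const_mul _, Finset.sum_comm, Finset.mul_sum,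
    ← Finset.sum_sub_distrib]
  refine Finset.sum_congr rfl fun i _ => ?_
  rw [integral_const_mul, ← Finset.mul_sum]; ring

lemma measure_meanDev_ge_le (hp : IsDataDensity p R) (hN : 0 < N) {f : Vec m × ℝ → ℝ}
    (hf : Measurable f) {B V : ℝ} (hB : ∀ q ∈ dataRange m R, |f q| ≤ B)
    (hV : ∫ q, f q ^ 2 ∂dataLaw p ≤ V) {t : ℝ} (ht : 0 < t) :
    sampleLaw p N {D | t ≤ |meanDev p D f|} ≤ ENNReal.ofReal (V / (N * t ^ 2)) := by
  have := isProbabilityMeasure_dataLaw hp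
  have hNr : (0 : ℝ) < N := by exact_mod_cast hN
  have h := pi_chebyshev (μ := dataLaw p) (N := N) (memLp_dataLaw hp hf hB) Finset.univ
    (t := N * t) (by positivity)
  refine (measure_mono fun D hD => ?_).trans (h.trans (ENNReal.ofReal_le_ofReal ?_))
  · simp only [Set.mem_ofPred_eq, Finset.card_univ, Fintype.card_fin] at hD ⊢
    have h1 : (∑ i, f (D i)) - N * ∫ z, f z ∂dataLaw p = N * meanDev p D f := by
      unfold meanDev empMean; field_simp
    rw [h1, abs_mul, abs_of_pos hNr]
    gcongr
  · rw [Finset.card_univ, Fintype.card_fin]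
    calc N * (∫ z, f z ^ 2 ∂dataLaw p) / (N * t) ^ 2 ≤ N * V / (N * t) ^ 2 := by gcongr
      _ = V / (N * t ^ 2) := by field_simp

/-- The standard basis vectors. -/
def unitVec (k : Fin m) : Vec m := EuclideanSpace.basisFun (Fin m) ℝ k

lemma norm_unitVec (k : Fin m) : ‖unitVec k‖ = 1 := (EuclideanSpace.basisFun (Fin m) ℝ).norm_eq_one k

lemma linear_eq_sum {f : Vec m → ℝ} (hf : IsLinearMap ℝ f) (e : Vec m) :
    f e = ∑ k, e k * f (unitVec k) := by
  have h := (EuclideanSpace.basisFun (Fin m) ℝ).sum_repr e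
  have h1 := congrArg (hf.mk' f) h
  rw [map_sum] at h1
  simpa [unitVec] using h1.symm

lemma abs_le_of_linear {f : Vec m → ℝ} (hf : ∀ e, f e = ∑ k, e k * f (unitVec k)) {t : ℝ}
    (ht : 0 ≤ t) (h : ∀ k, |f (unitVec k)| ≤ t / (m + 1)) (e : Vec m) : |f e| ≤ t * ‖e‖ := by
  rw [hf]
  refine (Finset.abs_sum_le_sum_abs _ _).trans ?_
  calc ∑ k, |e k * f (unitVec k)| ≤ ∑ _k : Fin m, ‖e‖ * (t / (m + 1)) := by
        refine Finset.sum_le_sum fun k _ => ?_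
        rw [abs_mul]
        have h1 : |e k| ≤ ‖e‖ := by simpa using PiLp.norm_apply_le e k
        exact mul_le_mul h1 (h k) (abs_nonneg _) (norm_nonneg _)
    _ = m * (‖e‖ * (t / (m + 1))) := by simp
    _ = m / (m + 1) * (t * ‖e‖) := by field_simp
    _ ≤ t * ‖e‖ := by
        refine mul_le_of_le_one_left (by positivity) ?_
        rw [div_le_one (by positivity)]; linarith

lemma measure_exists_fin_le {Ω : Type*} [MeasurableSpace Ω] (μ : Measure Ω) {A : Fin m → Ω → Prop}
    {κ : ℝ} (h : ∀ k, μ {D | A k D} ≤ ENNReal.ofReal κ) :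
    μ {D | ∃ k, A k D} ≤ ENNReal.ofReal (m * κ) := by
  have : {D | ∃ k, A k D} = ⋃ k, {D | A k D} := by ext; simp
  rw [this]
  refine (measure_iUnion_fintype_le _ _).trans ((Finset.sum_le_sum fun k _ => h k).trans ?_)
  rw [Finset.sum_const, Finset.card_univ, Fintype.card_fin, nsmul_eq_mul,
    ENNReal.ofReal_mul (by positivity), ENNReal.ofReal_natCast]

/-- Chebyshev's inequality for a data-dependent linear form, uniformly on the unit ball. -/
lemma measure_linear_meanDev_le (hp : IsDataDensity p R) (hN : 0 < N)
    {F : Vec m → Vec m × ℝ → ℝ} (hF : ∀ q, IsLinearMap ℝ fun e => F e q)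
    (hm : ∀ e, Measurable (F e)) {B V : ℝ}
    (hB : ∀ e, ‖e‖ = 1 → ∀ q ∈ dataRange m R, |F e q| ≤ B)
    (hV : ∀ e, ‖e‖ = 1 → ∫ q, F e q ^ 2 ∂dataLaw p ≤ V) {t : ℝ} (ht : 0 < t) :
    sampleLaw p N {D | ∃ e, t * ‖e‖ < |meanDev p D (F e)|} ≤
      ENNReal.ofReal (m * (m + 1) ^ 2 * V / (N * t ^ 2)) := by
  have key : ∀ k : Fin m, sampleLaw p N {D | t / (m + 1) ≤ |meanDev p D (F (unitVec k))|} ≤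
      ENNReal.ofReal ((m + 1) ^ 2 * V / (N * t ^ 2)) := fun k => by
    have h := measure_meanDev_ge_le hp hN (hm (unitVec k)) (hB _ (norm_unitVec k))
      (hV _ (norm_unitVec k)) (t := t / (m + 1)) (by positivity)
    refine h.trans (ENNReal.ofReal_le_ofReal (le_of_eq ?_))
    field_simp
  have := measure_exists_fin_le _ key
  refine (measure_mono ?_).trans (this.trans (ENNReal.ofReal_le_ofReal (le_of_eq (by ring))))
  rintro D ⟨e, he⟩
  by_contra hcon
  simp only [Set.mem_ofPred_eq, not_exists, not_le] at hcon
  refine he.not_ge (abs_le_of_linear (f := fun e => meanDev p D (F e)) (fun e => ?_) ht.le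
    (fun k => (hcon k).le) e)
  simp only
  rw [← meanDev_sum_mul _ _ fun k _ => integrable_dataLaw hp (hm _) (hB _ (norm_unitVec k))]
  congr 1
  funext q
  exact linear_eq_sum (hF q) e

lemma isLinearMap_gradKer (s : ℝ) (w : Vec m) (q : Vec m × ℝ) :
    IsLinearMap ℝ fun e => gradKer s w e q :=
  ⟨fun e e' => by simp only [gradKer, inner_add_right]; ring,
    fun c e => by simp only [gradKer, inner_smul_right, smul_eq_mul]; ring⟩

lemma isLinearMap_hessKer (s : ℝ) (w v : Vec m) (q : Vec m × ℝ) :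
    IsLinearMap ℝ fun e => hessKer s w v e q :=
  ⟨fun e e' => by simp only [hessKer, inner_add_right]; ring,
    fun c e => by simp only [hessKer, inner_smul_right, smul_eq_mul]; ring⟩

lemma hessKer_comm (s : ℝ) (w v e : Vec m) (q : Vec m × ℝ) :
    hessKer s w v e q = hessKer s w e v q := by simp only [hessKer]; ring

/-- At a fixed point the gradient deviates from its expectation by `O(1 / √N)`. -/
lemma measure_gradKer_meanDev_le (hp : IsDataDensity p R) (hN : 0 < N) (s : ℝ) (w : Vec m) {t : ℝ}
    (ht : 0 < t) : sampleLaw p N {D | ∃ e, t * ‖e‖ < |meanDev p D (gradKer s w e)|} ≤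
      ENNReal.ofReal (m * (m + 1) ^ 2 * R ^ 2 / (N * t ^ 2)) := by
  have := isProbabilityMeasure_dataLaw hp
  refine measure_linear_meanDev_le hp hN (isLinearMap_gradKer s w)
    (fun e => (continuous_gradKer s w e).measurable) (B := R) (fun e he q hq => ?_) (fun e he => ?_) ht
  · simpa [he] using abs_gradKer_le hq s w e
  · have h := integral_dataLaw_mono hp (f := fun q => gradKer s w e q ^ 2) (g := fun _ => R ^ 2)
      measurable_const (B := R ^ 2) (fun q hq => ?_) fun _ _ => le_rfl
    · simpa using (le_abs_self _).trans h
    · rw [abs_of_nonneg (by positivity), sq_le_sq, abs_of_pos hp.R_pos]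
      simpa [he] using abs_gradKer_le hq s w e

/-- At a fixed point the Hessian deviates from its expectation by `O(1 / √(N s))`: its terms are of
size `1 / s`, but only a fraction `O(s)` of them matters. -/
lemma exists_measure_hessKer_meanDev_le (hp : IsDataDensity p R) :
    ∃ C : ℝ, 0 < C ∧ ∀ N : ℕ, 0 < N → ∀ s, 0 < s → ∀ w : Vec m, ∀ t, 0 < t →
      sampleLaw p N {D | ∃ v e, t * ‖v‖ * ‖e‖ < |meanDev p D (hessKer s w v e)|} ≤
        ENNReal.ofReal (C / (N * s * t ^ 2)) := by
  obtain ⟨C, hC, hb⟩ := exists_integral_bump_le hp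
  have hR := hp.R_pos
  refine ⟨m * (m * (m + 1) ^ 4 * (R ^ 4 * C)) + 1, by positivity, fun N hN s hs w t ht => ?_⟩
  have hNr : (0 : ℝ) < N := by exact_mod_cast hN
  have key : ∀ k : Fin m, sampleLaw p N
      {D | ∃ e, t / (m + 1) * ‖e‖ < |meanDev p D (hessKer s w (unitVec k) e)|} ≤
      ENNReal.ofReal (m * (m + 1) ^ 2 * (R ^ 4 * C / s) / (N * (t / (m + 1)) ^ 2)) := fun k => by
    refine measure_linear_meanDev_le hp hN (isLinearMap_hessKer s w _)
      (fun e => (continuous_hessKer s w _ e).measurable) (B := R ^ 2 / s)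
      (fun e he q hq => ?_) (fun e he => ?_) (by positivity)
    · simpa [he, norm_unitVec] using abs_hessKer_le hq hs w (unitVec k) e
    · have h := integral_dataLaw_mono hp (f := fun q => hessKer s w (unitVec k) e q ^ 2)
        (g := fun q => (R ^ 2 / s) ^ 2 * bump (margin w q / s))
        ((measurable_bump_margin w s).const_mul _) (B := (R ^ 2 / s) ^ 2)
        (fun q hq => ?_) fun q _ => mul_le_of_le_one_right (by positivity) (bump_le_one _)
      · refine ((le_abs_self _).trans h).trans ?_
        rw [integral_const_mul]
        calc (R ^ 2 / s) ^ 2 * ∫ q, bump (margin w q / s) ∂dataLaw p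
            ≤ (R ^ 2 / s) ^ 2 * (C * s) := by gcongr; exact hb w s hs
          _ = R ^ 4 * C / s := by field_simp
      · have h1 := abs_hessKer_le_bump hq hs w (unitVec k) e
        rw [he, norm_unitVec, mul_one, mul_one] at h1
        rw [abs_of_nonneg (by positivity), ← sq_abs]
        calc |hessKer s w (unitVec k) e q| ^ 2 ≤ (R ^ 2 / s * bump (margin w q / s)) ^ 2 := by gcongr
          _ = (R ^ 2 / s) ^ 2 * bump (margin w q / s) ^ 2 := by ring
          _ ≤ _ := by gcongr; exact bump_sq_le _
  have := measure_exists_fin_le _ key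
  refine (measure_mono ?_).trans (this.trans (ENNReal.ofReal_le_ofReal ?_))
  · rintro D ⟨v, e, hve⟩
    by_contra hcon
    simp only [Set.mem_ofPred_eq, not_exists, not_lt] at hcon
    have h1 := abs_le_of_linear (f := fun v => meanDev p D (hessKer s w v e)) (fun v => ?_)
      (t := t * ‖e‖) (by positivity) (fun k => (hcon k e).trans (le_of_eq (by ring))) v
    · refine hve.not_ge (h1.trans (le_of_eq (by ring)))
    · simp only
      rw [← meanDev_sum_mul _ _ fun k _ => integrable_dataLaw hp
        (continuous_hessKer s w _ e).measurable fun q hq => abs_hessKer_le hq hs w _ e]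
      congr 1
      funext q
      simp only [hessKer_comm s w _ e q]
      exact linear_eq_sum (isLinearMap_hessKer s w e q) v
  · have : (m : ℝ) * (m * (m + 1) ^ 2 * (R ^ 4 * C / s) / (N * (t / (m + 1)) ^ 2)) =
        m * (m * (m + 1) ^ 4 * (R ^ 4 * C)) / (N * s * t ^ 2) := by field_simp
    rw [this]
    gcongr
    linarith

/-- Only data within `τ` of the margin contribute to a gradient increment over a distance of order
`τ ≥ s`. -/
lemma abs_gradKer_sub_le {q : Vec m × ℝ} (hq : q ∈ dataRange m R) {s τ : ℝ} (hs : 0 < s)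
    (hsτ : s ≤ τ) {w v : Vec m} (hvw : ‖v - w‖ * R ≤ τ) (e : Vec m) :
    |gradKer s v e q - gradKer s w e q| ≤ 3 * R * ‖e‖ * bump (margin w q / τ) := by
  have h1 := abs_psiDeriv_sub_le hs hsτ ((abs_margin_sub_le hq).trans hvw)
  have h2 := abs_inner_le_of_mem hq e
  have h3 : gradKer s v e q - gradKer s w e q =
      (psiDeriv (margin v q / s) - psiDeriv (margin w q / s)) * q.2 * inner ℝ q.1 e := by
    unfold gradKer; ring
  rw [h3, abs_mul, abs_mul, hq.1, mul_one]
  calc _ ≤ 3 * bump (margin w q / τ) * (R * ‖e‖) := by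
        gcongr
        have := bump_pos (margin w q / τ); positivity
    _ = _ := by ring

/-- The fluctuations of the gradient increments on a ball around `w` of radius `r ≫ s` are `o(r)`,
uniformly on the ball, as soon as `r ≫ 1 / N`. -/
lemma exists_measure_gradKer_increment_le (hp : IsDataDensity p R) {θ ε : ℝ} (hθ : 0 < θ)
    (hε : 0 < ε) : ∃ C : ℝ, 0 < C ∧ ∀ N : ℕ, ∀ s r, 0 < s → C * s ≤ r → C ≤ N * r →
      ∀ w : Vec m, sampleLaw p N {D | (∀ i, D i ∈ dataRange m R) ∧ ∃ v e, ‖v‖ ≤ r ∧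
        θ * r * ‖e‖ < |meanDev p D (fun q => gradKer s (w + v) e q - gradKer s w e q)|} ≤
        ENNReal.ofReal ε := by
  obtain ⟨C, hC, hb⟩ := exists_integral_bump_le hp
  have hprob := isProbabilityMeasure_dataLaw hp
  have hR := hp.R_pos
  -- the mesh of the grid is `δ r`
  set δ := min 1 (θ / (24 * R ^ 2 * C)) with hδ
  have hδ0 : 0 < δ := by positivity
  have hδ1 : δ ≤ 1 := min_le_left _ _
  set G := (2 * ((m : ℝ) + 1) * (1 / δ) + 1) ^ m with hG
  have hG0 : 0 < G := by positivity
  set V := m * (m + 1) ^ 2 * (9 * R ^ 2 * (C * (2 * R + 1))) * 16 / θ ^ 2 with hVdef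
  have hV0 : 0 ≤ V := by positivity
  refine ⟨1 + 24 * R * C / θ + G * (V + 24 * R / θ) / ε, by positivity,
    fun N s r hs hsr hNr w => ?_⟩
  have hc1 : 0 ≤ 24 * R * C / θ := by positivity
  have hc2 : 0 ≤ G * (V + 24 * R / θ) / ε := by positivity
  have hs1 : s ≤ r := by nlinarith
  have hs2 : 24 * R * C / θ * s ≤ r := by nlinarith
  have hr : 0 < r := hs.trans_le hs1
  have hN0 : 0 < N := by
    rcases Nat.eq_zero_or_pos N with rfl | h
    · simp only [Nat.cast_zero, zero_mul] at hNr; linarith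
    · exact h
  have hNr0 : (0 : ℝ) < N := by exact_mod_cast hN0
  have hN3 : G * (V + 24 * R / θ) / ε ≤ N * r := by linarith
  set τ := θ * r / (24 * R * C) with hτdef
  have hτ0 : 0 < τ := by positivity
  have hsτ : s ≤ τ := by
    rw [hτdef, le_div_iff₀ (by positivity)]
    rw [div_mul_eq_mul_div, div_le_iff₀ hθ] at hs2
    linarith
  have hδτ : δ * r * R ≤ τ := by
    have : δ ≤ θ / (24 * R ^ 2 * C) := min_le_right _ _
    calc δ * r * R ≤ θ / (24 * R ^ 2 * C) * r * R := by gcongr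
      _ = τ := by rw [hτdef]; field_simp
  set b := θ * r / (12 * R) with hbdef
  have hb0 : 0 < b := by positivity
  have hCτ : C * τ = b / 2 := by rw [hτdef, hbdef]; field_simp; ring
  have hgi : ∀ w' e : Vec m, Integrable (gradKer s w' e) (dataLaw p) := fun w' e =>
    integrable_dataLaw hp (continuous_gradKer s w' e).measurable
      fun q hq => abs_gradKer_le hq s w' e
  have hstep := measure_exists_le_of_grid (sampleLaw p N) w (ρ := r) (s := δ * r)
    (κ := (V + 24 * R / θ) / (N * r)) hr.le (by positivity)
    (A := fun w₁ D => (∀ i, D i ∈ dataRange m R) ∧ ∃ e, θ * r * ‖e‖ <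
      |meanDev p D (fun q => gradKer s w₁ e q - gradKer s w e q)|)
    (A' := fun q₁ D => (∃ e, θ * r / 4 * ‖e‖ <
      |meanDev p D (fun q => gradKer s q₁ e q - gradKer s w e q)|) ∨
      b / 2 ≤ |meanDev p D (fun q => bump (margin q₁ q / τ))|) ?_ ?_
  · refine (measure_mono ?_).trans (hstep.trans (ENNReal.ofReal_le_ofReal ?_))
    · rintro D ⟨hD, v, e, hv, he⟩
      exact ⟨w + v, by simpa using hv, hD, e, he⟩
    · have h1 : r / (δ * r) = 1 / δ := by field_simp
      rw [h1]
      change G * ((V + 24 * R / θ) / (N * r)) ≤ ε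
      rw [mul_div_assoc', div_le_iff₀ (by positivity)]
      rw [div_le_iff₀ hε] at hN3
      linarith
  -- a large increment at `w₁` entails a large increment, or many data near the margin, at a grid
  -- point `q₁`
  · rintro w₁ q₁ D hwq - ⟨hD, e, he⟩
    by_contra hcon
    simp only [not_or, not_exists, not_lt, not_le] at hcon
    obtain ⟨hc1, hc2⟩ := hcon
    have hvw : ‖w₁ - q₁‖ * R ≤ τ := le_trans (by gcongr) hδτ
    have h1 : meanDev p D (fun q => gradKer s w₁ e q - gradKer s w e q) =
        meanDev p D (fun q => gradKer s q₁ e q - gradKer s w e q) +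
          meanDev p D (fun q => gradKer s w₁ e q - gradKer s q₁ e q) := by
      rw [← meanDev_add (f := fun q => gradKer s q₁ e q - gradKer s w e q)
        (g := fun q => gradKer s w₁ e q - gradKer s q₁ e q)
        ((hgi _ _).sub (hgi _ _)) ((hgi _ _).sub (hgi _ _))]
      congr 1; funext q; ring
    have h2 : |empMean D (fun q => gradKer s w₁ e q - gradKer s q₁ e q)| ≤
        3 * R * ‖e‖ * empMean D (fun q => bump (margin q₁ q / τ)) := by
      rw [← empMean_const_mul]
      exact abs_empMean_le fun i => abs_gradKer_sub_le (hD i) hs hsτ hvw e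
    have h3 : |∫ q, (gradKer s w₁ e q - gradKer s q₁ e q) ∂dataLaw p| ≤
        3 * R * ‖e‖ * ∫ q, bump (margin q₁ q / τ) ∂dataLaw p := by
      rw [← integral_const_mul]
      refine integral_dataLaw_mono hp ((measurable_bump_margin q₁ τ).const_mul _)
        (B := 3 * R * ‖e‖) (fun q hq => abs_gradKer_sub_le hq hs hsτ hvw e)
        fun q _ => mul_le_of_le_one_right (by positivity) (bump_le_one _)
    have h4 : |meanDev p D (fun q => gradKer s w₁ e q - gradKer s q₁ e q)| ≤
        3 * R * ‖e‖ * (empMean D (fun q => bump (margin q₁ q / τ)) +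
          ∫ q, bump (margin q₁ q / τ) ∂dataLaw p) := by
      rw [mul_add]
      exact (abs_sub _ _).trans (add_le_add h2 h3)
    have h5 := hb q₁ τ hτ0
    have h6 : empMean D (fun q => bump (margin q₁ q / τ)) +
        ∫ q, bump (margin q₁ q / τ) ∂dataLaw p ≤ 3 * (b / 2) := by
      have := (abs_lt.1 hc2).2
      unfold meanDev at this
      linarith
    have h7 : 3 * R * ‖e‖ * (3 * (b / 2)) = 3 / 8 * (θ * r * ‖e‖) := by
      rw [hbdef]; field_simp; ring
    have h8 : 3 * R * ‖e‖ * (empMean D (fun q => bump (margin q₁ q / τ)) +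
          ∫ q, bump (margin q₁ q / τ) ∂dataLaw p) ≤ 3 / 8 * (θ * r * ‖e‖) := by
      rw [← h7]; gcongr
    have h9 := hc1 e
    rw [h1] at he
    have h10 := abs_add_le (meanDev p D (fun q => gradKer s q₁ e q - gradKer s w e q))
      (meanDev p D (fun q => gradKer s w₁ e q - gradKer s q₁ e q))
    have h11 : 0 ≤ θ * r * ‖e‖ := by positivity
    linarith
  -- Chebyshev's inequality at a grid point: the increment has variance `O(r)`
  · intro q₁ hq₁
    have hqr : ‖q₁ - w‖ ≤ 2 * r := hq₁.trans (by nlinarith)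
    have hqτ : ‖q₁ - w‖ * R ≤ r * (2 * R + 1) := by nlinarith
    have hsτ' : s ≤ r * (2 * R + 1) := by nlinarith
    have e1 := measure_linear_meanDev_le hp hN0 (t := θ * r / 4)
      (F := fun e q => gradKer s q₁ e q - gradKer s w e q) (B := 3 * R)
      (V := 9 * R ^ 2 * (C * (r * (2 * R + 1))))
      (fun q => ⟨fun e e' => by
          simp only [(isLinearMap_gradKer s _ q).map_add]; ring,
        fun c e => by simp only [(isLinearMap_gradKer s _ q).map_smul, smul_eq_mul]; ring⟩)
      (fun e => ((continuous_gradKer s q₁ e).sub (continuous_gradKer s w e)).measurable)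
      (fun e he q hq => ?_) (fun e he => ?_) (by positivity)
    · have e2 := measure_meanDev_ge_le hp hN0 (f := fun q => bump (margin q₁ q / τ))
        (measurable_bump_margin q₁ τ) (B := 1) (V := b / 2) (fun q _ => abs_bump_le_one _) ?_
        (t := b / 2) (by positivity)
      · refine (measure_union_le _ _).trans ((add_le_add e1 e2).trans ?_)
        rw [← ENNReal.ofReal_add (by positivity) (by positivity)]
        refine ENNReal.ofReal_le_ofReal (le_of_eq ?_)
        rw [hVdef, hbdef]
        field_simp
        ring
      · refine le_trans ?_ ((hb q₁ τ hτ0).trans hCτ.le)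
        refine integral_mono_of_nonneg (Filter.Eventually.of_forall fun q => by positivity) ?_
          (Filter.Eventually.of_forall fun q => bump_sq_le _)
        exact integrable_dataLaw hp (measurable_bump_margin q₁ τ) (B := 1)
          fun q _ => abs_bump_le_one _
    · have h1 := abs_gradKer_sub_le hq hs hsτ' hqτ e
      rw [he, mul_one] at h1
      exact h1.trans (mul_le_of_le_one_right (by positivity) (bump_le_one _))
    · have h := integral_dataLaw_mono hp (f := fun q => (gradKer s q₁ e q - gradKer s w e q) ^ 2)
        (g := fun q => 9 * R ^ 2 * bump (margin w q / (r * (2 * R + 1))))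
        ((measurable_bump_margin w _).const_mul _) (B := 9 * R ^ 2)
        (fun q hq => ?_) fun q _ => mul_le_of_le_one_right (by positivity) (bump_le_one _)
      · refine ((le_abs_self _).trans h).trans ?_
        rw [integral_const_mul]
        gcongr
        exact hb w _ (by positivity)
      · have h1 := abs_gradKer_sub_le hq hs hsτ' hqτ e
        rw [he, mul_one] at h1
        rw [abs_of_nonneg (by positivity), ← sq_abs]
        calc |gradKer s q₁ e q - gradKer s w e q| ^ 2
            ≤ (3 * R * bump (margin w q / (r * (2 * R + 1)))) ^ 2 := by gcongr
          _ = 9 * R ^ 2 * bump (margin w q / (r * (2 * R + 1))) ^ 2 := by ring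
          _ ≤ _ := by gcongr; exact bump_sq_le _
end

/-! ### Localization near the minimizer -/

section
variable {m N : ℕ} {p : Vec m → ℝ → ℝ} {R : ℝ} {wst : Vec m} {y r c₀ : ℝ} {Z : Finset (Vec m)}

lemma inner_grad_eq_gradKer {lam α : ℝ} {D : Dataset m N} (hα : 0 < α) (w e : Vec m) :
    inner ℝ (grad lam α D w) e = lam * inner ℝ w e - empMean D (gradKer α w e) :=
  inner_grad hα w e

lemma inner_hess_eq_hessKer {lam α : ℝ} {D : Dataset m N} (hα : 0 < α) (w v e : Vec m) :
    inner ℝ (hess lam α D w v) e = lam * inner ℝ v e + empMean D (hessKer α w v e) :=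
  inner_hess hα w v e

lemma norm_le_of_abs_inner_le {g : Vec m} {t : ℝ} (ht : 0 ≤ t)
    (h : ∀ e, |inner ℝ g e| ≤ t * ‖e‖) : ‖g‖ ≤ t := by
  rcases eq_or_ne g 0 with rfl | hg
  · simpa using ht
  · have h1 := h g
    rw [real_inner_self_eq_norm_sq, abs_of_nonneg (by positivity), sq] at h1
    exact le_of_mul_le_mul_right h1 (norm_pos_iff.2 hg)

/-- The part of a piece with margin of sign `σ` and of size comparable with `κ`. -/
def wedge (wst z : Vec m) (r y κ σ : ℝ) : Set (Vec m × ℝ) :=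
  {q | q ∈ piece z r y ∧ κ / 2 < σ * margin wst q ∧ σ * margin wst q < κ}

lemma measurableSet_wedge (wst z : Vec m) (r y κ σ : ℝ) : MeasurableSet (wedge wst z r y κ σ) :=
  (measurableSet_piece z r y).inter
    ((measurableSet_lt measurable_const ((continuous_margin wst).measurable.const_mul σ)).inter
      (measurableSet_lt ((continuous_margin wst).measurable.const_mul σ) measurable_const))

/-- A wedge contains a ball of radius comparable with `κ` on which the density is at least `c₀`. -/
lemma dataLaw_real_wedge_ge (hp : IsDataDensity p R) (h : IsSpanning p wst y Z r c₀) {κ σ : ℝ}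
    (hκ : 0 < κ) (hκr : κ ≤ r * ‖wst‖) (hσ : |σ| = 1) {z : Vec m} (hz : z ∈ Z) :
    c₀ * (volume (Metric.ball (0 : Vec m) (κ / (4 * ‖wst‖)))).toReal ≤
      (dataLaw p).real (wedge wst z r y κ σ) := by
  have hw0 : 0 < ‖wst‖ := norm_pos_iff.2 h.wst_ne_zero
  have hy := abs_eq_one_of_mem_labels h.label
  have hy2 : y * y = 1 := by rw [← abs_mul_abs_self, hy]; norm_num
  have hσ2 : σ * σ = 1 := by rw [← abs_mul_abs_self, hσ]; norm_num
  set ρ := κ / (4 * ‖wst‖) with hρ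
  have hρw : ρ * ‖wst‖ = κ / 4 := by rw [hρ]; field_simp
  set e : Vec m := (-(σ * y * (3 * ρ)) * ‖wst‖⁻¹) • wst with he
  have hen : ‖e‖ = 3 * ρ := by
    rw [he, norm_smul, norm_mul, norm_neg, norm_mul, norm_mul, Real.norm_eq_abs σ,
      Real.norm_eq_abs y, hσ, hy, norm_inv, norm_norm, Real.norm_of_nonneg (by positivity)]
    field_simp
  have hme : margin wst (z + e, y) = σ * (3 / 4 * κ) := by
    rw [margin_add, h.margin_eq z hz, he, inner_smul_right, real_inner_self_eq_norm_sq]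
    have : 0 - y * (-(σ * y * (3 * ρ)) * ‖wst‖⁻¹ * ‖wst‖ ^ 2) =
        (y * y) * σ * (3 * (ρ * ‖wst‖)) * (‖wst‖⁻¹ * ‖wst‖) := by ring
    rw [this, hy2, hρw, inv_mul_cancel₀ hw0.ne']; ring
  have hρr : 4 * ρ ≤ r := by
    rw [hρ, mul_div_assoc', div_le_iff₀ (by positivity)]; linarith
  have hsub : Metric.ball (z + e) ρ ⊆ Metric.ball z r := by
    intro x hx
    rw [Metric.mem_ball, dist_eq_norm] at hx ⊢
    have : x - z = (x - (z + e)) + e := by abel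
    rw [this]
    refine (norm_add_le _ _).trans_lt ?_
    linarith
  refine (dataLaw_real_piece_ge hp h.label h.c_pos.le fun x hx => h.density z hz x (hsub hx)).trans ?_
  have := isProbabilityMeasure_dataLaw hp
  refine measureReal_mono ?_
  rintro ⟨x, y'⟩ ⟨hx, rfl⟩
  have h1 : margin wst (x, y') = σ * (3 / 4 * κ) - y' * inner ℝ wst (x - (z + e)) := by
    rw [← hme, ← margin_add]; congr 2; abel
  have h2 : |σ * (y' * inner ℝ wst (x - (z + e)))| < κ / 4 := by
    rw [abs_mul, abs_mul, hσ, hy, one_mul, one_mul]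
    refine (abs_real_inner_le_norm _ _).trans_lt ?_
    rw [← hρw, mul_comm]
    gcongr
    simpa [dist_eq_norm] using hx
  have h3 := abs_lt.1 h2
  have h4 : σ * margin wst (x, y') = 3 / 4 * κ - σ * (y' * inner ℝ wst (x - (z + e))) := by
    rw [h1, mul_sub, ← mul_assoc, hσ2, one_mul]
  refine ⟨⟨hsub hx, rfl⟩, ?_, ?_⟩
  · change κ / 2 < σ * margin wst (x, y'); rw [h4]; linarith
  · rw [h4]; linarith

/-- Each wedge contains a fixed fraction of the data. -/
lemma measure_wedge_count_le (hp : IsDataDensity p R) (h : IsSpanning p wst y Z r c₀) {κ : ℝ}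
    (hκ : 0 < κ) (hκr : κ ≤ r * ‖wst‖) : ∃ μ₀ C : ℝ, 0 < μ₀ ∧ 0 < C ∧ ∀ N : ℕ, 0 < N →
      sampleLaw p N {D | ∃ z ∈ Z, ∃ σ ∈ labels,
        empMean D ((wedge wst z r y κ σ).indicator fun _ => 1) < μ₀} ≤ ENNReal.ofReal (C / N) := by
  have hprob := isProbabilityMeasure_dataLaw hp
  have hw0 : 0 < ‖wst‖ := norm_pos_iff.2 h.wst_ne_zero
  set μ := c₀ * (volume (Metric.ball (0 : Vec m) (κ / (4 * ‖wst‖)))).toReal with hμ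
  have hμ0 : 0 < μ := mul_pos h.c_pos (ENNReal.toReal_pos
    (Metric.measure_ball_pos volume 0 (by positivity)).ne' measure_ball_lt_top.ne)
  refine ⟨μ / 2, (Z ×ˢ labels).card * (4 / μ ^ 2) + 1, by positivity, by positivity,
    fun N hN => ?_⟩
  have hNr : (0 : ℝ) < N := by exact_mod_cast hN
  have key : ∀ a ∈ Z ×ˢ labels, sampleLaw p N
      {D | empMean D ((wedge wst a.1 r y κ a.2).indicator fun _ => 1) < μ / 2} ≤
      ENNReal.ofReal (1 / (N * (μ / 2) ^ 2)) := by
    rintro ⟨z, σ⟩ ha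
    rw [Finset.mem_product] at ha
    have hmeas : Measurable ((wedge wst z r y κ σ).indicator fun _ => (1 : ℝ)) :=
      measurable_const.indicator (measurableSet_wedge _ _ _ _ _ _)
    have h01 : ∀ q, |(wedge wst z r y κ σ).indicator (fun _ => (1 : ℝ)) q| ≤ 1 := fun q => by
      by_cases hq : q ∈ wedge wst z r y κ σ <;> simp [hq]
    have hint : ∫ q, (wedge wst z r y κ σ).indicator (fun _ => (1 : ℝ)) q ∂dataLaw p =
        (dataLaw p).real (wedge wst z r y κ σ) :=
      integral_indicator_one (measurableSet_wedge _ _ _ _ _ _)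
    have hge := dataLaw_real_wedge_ge hp h hκ hκr (abs_eq_one_of_mem_labels ha.2) ha.1
    refine (measure_mono fun D hD => ?_).trans (measure_meanDev_ge_le hp hN hmeas (B := 1) (V := 1)
      (fun q _ => h01 q) ?_ (t := μ / 2) (by positivity))
    · simp only [Set.mem_ofPred_eq] at hD ⊢
      unfold meanDev
      rw [hint]
      rw [abs_sub_comm]
      refine le_trans ?_ (le_abs_self _)
      linarith
    · have h2 := integral_dataLaw_mono hp (B := 1) (g := fun _ => 1)
        (f := fun q => (wedge wst z r y κ σ).indicator (fun _ => (1 : ℝ)) q ^ 2) measurable_const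
        (fun q _ => by rw [abs_pow]; exact pow_le_one₀ (abs_nonneg _) (h01 q)) (fun _ _ => le_rfl)
      simpa using (le_abs_self _).trans h2
  have hset : {D : Dataset m N | ∃ z ∈ Z, ∃ σ ∈ labels,
      empMean D ((wedge wst z r y κ σ).indicator fun _ => 1) < μ / 2} = ⋃ a ∈ Z ×ˢ labels,
      {D | empMean D ((wedge wst a.1 r y κ a.2).indicator fun _ => 1) < μ / 2} := by
    ext D; simp only [Set.mem_ofPred_eq, Set.mem_iUnion, Finset.mem_product]; constructor
    · rintro ⟨z, hz, σ, hσ, hlt⟩; exact ⟨(z, σ), ⟨hz, hσ⟩, hlt⟩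
    · rintro ⟨⟨z, σ⟩, ⟨hz, hσ⟩, hlt⟩; exact ⟨z, hz, σ, hσ, hlt⟩
  rw [hset]
  refine (measure_biUnion_finset_le _ _).trans ((Finset.sum_le_sum key).trans ?_)
  rw [Finset.sum_const, nsmul_eq_mul, ← ENNReal.ofReal_natCast, ← ENNReal.ofReal_mul (by positivity)]
  refine ENNReal.ofReal_le_ofReal ?_
  have : ((Z ×ˢ labels).card : ℝ) * (1 / (N * (μ / 2) ^ 2)) = ((Z ×ˢ labels).card * (4 / μ ^ 2)) / N := by
    field_simp; ring
  rw [this]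
  gcongr
  linarith

lemma margin_add_smul (w e : Vec m) (T : ℝ) (q : Vec m × ℝ) :
    margin (w + T • e) q = margin w q - T * (q.2 * inner ℝ q.1 e) := by
  unfold margin
  rw [inner_add_left, inner_smul_left, real_inner_comm q.1 e]
  simp only [RCLike.conj_to_real]
  ring

lemma psiDeriv_sub_ge_half {u v : ℝ} (hu : 2 ≤ u) (hv : v ≤ -2) : 1 / 2 ≤ psiDeriv u - psiDeriv v := by
  have h1 := one_sub_psiDeriv_le (u := 2) (by norm_num)
  have h2 := psiDeriv_le_of_nonpos (u := -2) (by norm_num)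
  have h3 := monotone_psiDeriv hu
  have h4 := monotone_psiDeriv hv
  unfold bump at h1 h2
  norm_num at h1 h2
  linarith

/-- Far from `wst`, the data in the wedges have changed sides. -/
lemma norm_grad_sub_ge_of_wedge (h : IsSpanning p wst y Z r c₀) {κ r₀ μ₀ α : ℝ}
    (hr₀ : 0 < r₀) (hκr : κ ≤ r₀ * r / 2) (hα : 0 < α) (hακ : α ≤ κ / 4)
    {D : Dataset m N} (hD : ∀ z ∈ Z, ∀ σ ∈ labels,
      μ₀ ≤ empMean D ((wedge wst z r y κ σ).indicator fun _ => 1))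
    {w : Vec m} (hw : r₀ ≤ ‖w - wst‖) :
    r / 2 * μ₀ ≤ ‖grad 0 α D w - grad 0 α D wst‖ := by
  set T := ‖w - wst‖ with hT
  have hT0 : 0 < T := hr₀.trans_le hw
  set e : Vec m := T⁻¹ • (w - wst) with he
  have hen : ‖e‖ = 1 := by
    rw [he, norm_smul, norm_inv, norm_norm, ← hT, inv_mul_cancel₀ hT0.ne']
  have hwe : w = wst + T • e := by
    rw [he, smul_smul, mul_inv_cancel₀ hT0.ne', one_smul]; abel
  clear_value T e
  obtain ⟨z, hz, hdir⟩ := h.direction e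
  rw [hen, mul_one] at hdir
  have hr := h.r_pos
  have hy := abs_eq_one_of_mem_labels h.label
  have hy2 : y * y = 1 := by rw [← abs_mul_abs_self, hy]; norm_num
  -- on the piece, `y xᵀe` has a constant sign `σ`
  obtain ⟨σ, hσ, hsign⟩ : ∃ σ ∈ labels, ∀ x ∈ Metric.ball z r, r ≤ σ * (y * inner ℝ x e) := by
    have habs : ∀ x ∈ Metric.ball z r, r ≤ |y * inner ℝ x e| := fun x hx => by
      rw [abs_mul, hy, one_mul]; exact hdir x hx
    have hcont : ContinuousOn (fun x : Vec m => y * inner ℝ x e) (Metric.ball z r) := by fun_prop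
    have hpre := (convex_ball z r).isPreconnected
    by_cases hpos : ∃ x ∈ Metric.ball z r, 0 < y * inner ℝ x e
    · obtain ⟨x₁, hx₁, hx₁p⟩ := hpos
      refine ⟨1, by simp [labels], fun x hx => ?_⟩
      rw [one_mul]
      rcases le_total 0 (y * inner ℝ x e) with h0 | h0
      · have := habs x hx; rwa [abs_of_nonneg h0] at this
      · obtain ⟨x₂, hx₂, hx₂0⟩ := hpre.intermediate_value hx hx₁ hcont ⟨h0, hx₁p.le⟩
        have h2 := habs x₂ hx₂
        simp only at hx₂0
        rw [hx₂0, abs_zero] at h2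
        linarith
    · push Not at hpos
      refine ⟨-1, by simp [labels], fun x hx => ?_⟩
      have := habs x hx
      rwa [abs_of_nonpos (hpos x hx), ← neg_one_mul] at this
  have h1 : inner ℝ (grad 0 α D w - grad 0 α D wst) e =
      empMean D (fun q => (psiDeriv (margin wst q / α) - psiDeriv (margin w q / α)) *
        (q.2 * inner ℝ q.1 e)) := by
    rw [inner_sub_left, inner_grad_eq_gradKer hα, inner_grad_eq_gradKer hα]
    have : empMean D (gradKer α wst e) - empMean D (gradKer α w e) =
      empMean D (fun q => gradKer α wst e q - gradKer α w e q) := (empMean_sub _ _ _).symm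
    rw [zero_mul, zero_mul, zero_sub, zero_sub, neg_sub_neg, this]
    exact empMean_congr fun i => by unfold gradKer; ring
  have h2 : empMean D (fun q => r / 2 * (wedge wst z r y κ σ).indicator (fun _ => 1) q) ≤
      empMean D (fun q => (psiDeriv (margin wst q / α) - psiDeriv (margin w q / α)) *
        (q.2 * inner ℝ q.1 e)) := by
    refine empMean_mono fun i => ?_
    set q := D i
    have hm : margin w q = margin wst q - T * (q.2 * inner ℝ q.1 e) := by
      rw [hwe, margin_add_smul]
    by_cases hq : q ∈ wedge wst z r y κ σ
    · rw [Set.indicator_of_mem hq, mul_one]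
      obtain ⟨⟨hqb, hqy⟩, hq1, hq2⟩ := hq
      have hs := hsign q.1 hqb
      rw [← hqy] at hs
      set a := q.2 * inner ℝ q.1 e
      set u := margin wst q
      have hTr : r₀ * r ≤ T * (σ * a) := mul_le_mul hw hs hr.le hT0.le
      have e1 : 2 ≤ κ / 2 / α := by rw [le_div_iff₀ hα]; linarith
      rcases mem_labels.1 hσ with rfl | rfl
      · simp only [one_mul] at hs hTr hq1 hq2
        have h3 : 1 / 2 ≤ psiDeriv (u / α) - psiDeriv (margin w q / α) := by
          refine psiDeriv_sub_ge_half ?_ ?_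
          · rw [le_div_iff₀ hα]; linarith
          · rw [div_le_iff₀ hα, hm]; linarith
        nlinarith
      · have h3 : 1 / 2 ≤ psiDeriv (margin w q / α) - psiDeriv (u / α) := by
          refine psiDeriv_sub_ge_half ?_ ?_
          · rw [le_div_iff₀ hα, hm]; linarith
          · rw [div_le_iff₀ hα]; linarith
        nlinarith
    · rw [Set.indicator_of_notMem hq, mul_zero]
      set a := q.2 * inner ℝ q.1 e
      rcases le_total 0 a with h0 | h0
      · refine mul_nonneg (sub_nonneg.2 (monotone_psiDeriv ?_)) h0
        gcongr; rw [hm]; nlinarith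
      · refine mul_nonneg_of_nonpos_of_nonpos (sub_nonpos.2 (monotone_psiDeriv ?_)) h0
        gcongr; rw [hm]; nlinarith
  rw [empMean_const_mul] at h2
  have h3 := real_inner_le_norm (grad 0 α D w - grad 0 α D wst) e
  rw [hen, mul_one, h1] at h3
  refine le_trans ?_ (h2.trans h3)
  gcongr
  exact hD z hz σ hσ
end

section
variable {m : ℕ} {p : Vec m → ℝ → ℝ} {R : ℝ} {wst : Vec m}

/-- `psi` is convex. -/
lemma psi_tangent_le (u v : ℝ) : psi v + psiDeriv v * (u - v) ≤ psi u := by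
  have hc : ConvexOn ℝ Set.univ psi := by
    refine Monotone.convexOn_univ_of_deriv (fun x => (hasDerivAt_psi x).differentiableAt) ?_
    rw [show deriv psi = psiDeriv from funext fun x => (hasDerivAt_psi x).deriv]
    exact monotone_psiDeriv
  rcases lt_trichotomy v u with h | rfl | h
  · have h1 := hc.le_slope_of_hasDerivAt (Set.mem_univ _) (Set.mem_univ _) h (hasDerivAt_psi v)
    rw [slope_def_field, le_div_iff₀ (by linarith)] at h1
    linarith
  · simp
  · have h1 := hc.slope_le_of_hasDerivAt (Set.mem_univ _) (Set.mem_univ _) h (hasDerivAt_psi v)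
    rw [slope_def_field, div_le_iff₀ (by linarith)] at h1
    linarith

lemma abs_margin_le {q : Vec m × ℝ} (hq : q ∈ dataRange m R) (w : Vec m) :
    |margin w q| ≤ 1 + ‖w‖ * R := by
  have h1 : |inner ℝ w q.1| ≤ ‖w‖ * R :=
    (abs_real_inner_le_norm _ _).trans (mul_le_mul_of_nonneg_left hq.2 (norm_nonneg _))
  unfold margin
  refine (abs_sub _ _).trans ?_
  rw [abs_one, abs_mul, hq.1, one_mul]
  gcongr

lemma expectedObjective_zero (hp : IsDataDensity p R) (w : Vec m) :
    expectedObjective p 0 w = ∫ q, max 0 (margin w q) ∂dataLaw p := by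
  rw [integral_dataLaw hp (f := fun q => max 0 (margin w q))
    (measurable_const.max (continuous_margin w).measurable) (B := 1 + ‖w‖ * R)
    fun q hq => ?_]
  · simp [expectedObjective, margin]
  · refine le_trans ?_ (abs_margin_le hq w)
    rw [abs_of_nonneg (le_max_left _ _)]
    exact max_le (abs_nonneg _) (le_abs_self _)

/-- The expected smoothed loss is nearly stationary at a minimizer of the expected loss: the
smoothing changes the loss by `O(α)`, and the curvature of the smoothed loss is bounded. -/
lemma exists_integral_gradKer_minimizer_le (hp : IsDataDensity p R)
    (hmin : ∀ v, expectedObjective p 0 wst ≤ expectedObjective p 0 v) :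
    ∃ C : ℝ, 0 < C ∧ ∀ α, 0 < α → α ≤ 1 → ∀ e : Vec m, ‖e‖ = 1 →
      |∫ q, gradKer α wst e q ∂dataLaw p| ≤ C * √α := by
  obtain ⟨C, hC, hb⟩ := exists_integral_bump_le hp
  have hR := hp.R_pos
  have hprob := isProbabilityMeasure_dataLaw hp
  refine ⟨1 + 3 * R * (C * (R + 1)), by positivity, fun α hα hα1 => ?_⟩
  have hsq := Real.sqrt_pos.2 hα
  have hαsq : α ≤ √α := Real.le_sqrt_of_sq_le (by nlinarith)
  have hss : √α * √α = α := Real.mul_self_sqrt hα.le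
  have one : ∀ e : Vec m, ‖e‖ = 1 →
      ∫ q, gradKer α wst e q ∂dataLaw p ≤ (1 + 3 * R * (C * (R + 1))) * √α := by
    intro e he
    -- moving by `√α` from the minimizer balances the two errors
    set w' := wst + √α • e with hw'
    have hww : ‖w' - wst‖ = √α := by
      rw [hw', add_sub_cancel_left, norm_smul, he, mul_one, Real.norm_of_nonneg hsq.le]
    have hi : ∀ w, Integrable (fun q => max 0 (margin w q)) (dataLaw p) := fun w =>
      integrable_dataLaw hp (measurable_const.max (continuous_margin w).measurable)
        (B := 1 + ‖w‖ * R) fun q hq => by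
          refine le_trans ?_ (abs_margin_le hq w)
          rw [abs_of_nonneg (le_max_left _ _)]
          exact max_le (abs_nonneg _) (le_abs_self _)
    have hg : ∀ w e, Integrable (gradKer α w e) (dataLaw p) := fun w e =>
      integrable_dataLaw hp (continuous_gradKer α w e).measurable fun q hq => abs_gradKer_le hq α w e
    have hpt : ∀ q, max 0 (margin w' q) + √α * gradKer α w' e q ≤ max 0 (margin wst q) + α := by
      intro q
      have h1 := abs_le.1 (abs_psi_scale_sub_le (u := margin w' q) hα)
      have h2 := abs_le.1 (abs_psi_scale_sub_le (u := margin wst q) hα)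
      have h3 := psi_tangent_le (margin wst q / α) (margin w' q / α)
      have h4 : margin wst q - margin w' q = √α * (q.2 * inner ℝ q.1 e) := by
        rw [hw', margin_add_smul]; ring
      have h5 : α * (psiDeriv (margin w' q / α) * (margin wst q / α - margin w' q / α)) =
          √α * gradKer α w' e q := by
        rw [← sub_div, h4]; unfold gradKer; field_simp
      have h6 := mul_le_mul_of_nonneg_left h3 hα.le
      rw [mul_add, h5] at h6
      linarith [h1.1, h2.2]
    have hI := integral_mono ((hi w').add ((hg w' e).const_mul _)) ((hi wst).add
      (integrable_const α)) hpt
    have e1 : ∫ q, (max 0 (margin w' q) + √α * gradKer α w' e q) ∂dataLaw p =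
        (∫ q, max 0 (margin w' q) ∂dataLaw p) + √α * ∫ q, gradKer α w' e q ∂dataLaw p := by
      rw [integral_add (hi w') ((hg w' e).const_mul _), integral_const_mul]
    have e2 : ∫ q, (max 0 (margin wst q) + α) ∂dataLaw p =
        (∫ q, max 0 (margin wst q) ∂dataLaw p) + α := by
      rw [integral_add (hi wst) (integrable_const α)]; simp
    have hI' : (∫ q, max 0 (margin w' q) ∂dataLaw p) + √α * ∫ q, gradKer α w' e q ∂dataLaw p ≤
        (∫ q, max 0 (margin wst q) ∂dataLaw p) + α := by
      rw [← e1, ← e2]; exact hI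
    have hm := hmin w'
    rw [expectedObjective_zero hp, expectedObjective_zero hp] at hm
    have h7 : ∫ q, gradKer α w' e q ∂dataLaw p ≤ √α := by
      refine le_of_mul_le_mul_left ?_ hsq
      rw [hss]; linarith
    have h8 : |∫ q, (gradKer α w' e q - gradKer α wst e q) ∂dataLaw p| ≤
        ∫ q, 3 * R * bump (margin wst q / ((R + 1) * √α)) ∂dataLaw p := by
      refine integral_dataLaw_mono hp ((measurable_bump_margin wst _).const_mul _) (B := 3 * R)
        (fun q hq => ?_) fun q _ => mul_le_of_le_one_right (by positivity) (bump_le_one _)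
      have := abs_gradKer_sub_le hq hα (τ := (R + 1) * √α) (by nlinarith) (w := wst) (v := w')
        (by rw [hww]; nlinarith) e
      rwa [he, mul_one] at this
    rw [integral_sub (hg w' e) (hg wst e), integral_const_mul] at h8
    have h9 := hb wst ((R + 1) * √α) (by positivity)
    have h10 : 3 * R * ∫ q, bump (margin wst q / ((R + 1) * √α)) ∂dataLaw p ≤
        3 * R * (C * ((R + 1) * √α)) := by gcongr
    have h11 := (abs_le.1 (h8.trans h10)).1
    linarith
  intro e he
  refine abs_le.2 ⟨?_, one e he⟩
  have h1 := one (-e) (by rwa [norm_neg])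
  have h2 : ∫ q, gradKer α wst (-e) q ∂dataLaw p = -∫ q, gradKer α wst e q ∂dataLaw p := by
    rw [← integral_neg]
    congr 1; funext q
    exact (isLinearMap_gradKer α wst q).map_neg e
  rw [h2] at h1
  linarith

/-- A point at which the empirical gradient is small is close to the minimizer of the expected
loss. -/
lemma exists_measure_localization_le {y r c₀ : ℝ} {Z : Finset (Vec m)} (hp : IsDataDensity p R)
    (h : IsSpanning p wst y Z r c₀)
    (hmin : ∀ v, expectedObjective p 0 wst ≤ expectedObjective p 0 v) {r₀ ε : ℝ} (hr₀ : 0 < r₀)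
    (hε : 0 < ε) : ∃ c C α₁ : ℝ, 0 < c ∧ 0 < C ∧ 0 < α₁ ∧ ∀ N : ℕ, C ≤ N → ∀ α, 0 < α → α ≤ α₁ →
      sampleLaw p N {D | ∃ w, r₀ ≤ ‖w - wst‖ ∧ ‖grad 0 α D w‖ ≤ c} ≤ ENNReal.ofReal ε := by
  have hr := h.r_pos
  have hR := hp.R_pos
  have hw0 : 0 < ‖wst‖ := norm_pos_iff.2 h.wst_ne_zero
  set κ := min (r₀ * r / 2) (r * ‖wst‖) with hκ
  have hκ0 : 0 < κ := by positivity
  obtain ⟨μ₀, C₁, hμ, hC₁, hcount⟩ := measure_wedge_count_le hp h hκ0 (min_le_right _ _)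
  obtain ⟨C₂, hC₂, hstat⟩ := exists_integral_gradKer_minimizer_le hp hmin
  set t := r * μ₀ / 16 with ht
  have ht0 : 0 < t := by positivity
  set V := (m : ℝ) * (m + 1) ^ 2 * R ^ 2 / t ^ 2 with hV
  have hV0 : 0 ≤ V := by positivity
  refine ⟨4 * t, (C₁ + V) / ε + 1, min (min 1 (κ / 4)) ((t / C₂) ^ 2), by positivity,
    by positivity, by positivity, fun N hN α hα hαs => ?_⟩
  have hα1 : α ≤ 1 := hαs.trans ((min_le_left _ _).trans (min_le_left _ _))
  have hα2 : α ≤ κ / 4 := hαs.trans ((min_le_left _ _).trans (min_le_right _ _))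
  have hα3 : √α ≤ t / C₂ := Real.sqrt_le_iff.2 ⟨by positivity, hαs.trans (min_le_right _ _)⟩
  have hq : 0 ≤ (C₁ + V) / ε := by positivity
  have hNr : (0 : ℝ) < N := by linarith
  have hN0 : 0 < N := by exact_mod_cast hNr
  have e1 := hcount N hN0
  have e2 := measure_gradKer_meanDev_le hp hN0 α wst ht0
  refine (measure_mono (t := _ ∪ _) ?_).trans ((measure_union_le _ _).trans
    ((add_le_add e1 e2).trans ?_))
  · rintro D ⟨w, hw, hg⟩
    by_contra hcon
    simp only [Set.mem_union, Set.mem_ofPred_eq, not_or, not_exists, not_and, not_lt] at hcon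
    obtain ⟨h1, h2⟩ := hcon
    have h3 := norm_grad_sub_ge_of_wedge h hr₀ (min_le_left _ _) hα hα2
      (fun z hz σ hσ => h1 z hz σ hσ) hw
    have h4 : ‖grad 0 α D wst‖ ≤ 2 * t := by
      rcases eq_or_ne (grad 0 α D wst) 0 with h0 | h0
      · rw [h0, norm_zero]; positivity
      set g := grad 0 α D wst
      have h5 : ‖‖g‖⁻¹ • g‖ = 1 := norm_self_unit h0
      have h6 : inner ℝ g (‖g‖⁻¹ • g) = ‖g‖ := inner_self_unit h0
      rw [inner_grad_eq_gradKer hα] at h6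
      have h7 := h2 (‖g‖⁻¹ • g)
      have h8 := hstat α hα hα1 _ h5
      rw [h5, mul_one] at h7
      have h9 : C₂ * √α ≤ t := by
        rw [le_div_iff₀ hC₂] at hα3; linarith
      unfold meanDev at h7
      have := (abs_le.1 h7).1
      have := (abs_le.1 h8).1
      rw [zero_mul] at h6
      linarith
    have h5 := norm_sub_le (grad 0 α D w) (grad 0 α D wst)
    have : r / 2 * μ₀ = 8 * t := by rw [ht]; ring
    linarith
  · rw [← ENNReal.ofReal_add (by positivity) (by positivity)]
    refine ENNReal.ofReal_le_ofReal ?_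
    have : C₁ / N + m * (m + 1) ^ 2 * R ^ 2 / (N * t ^ 2) = (C₁ + V) / N := by
      rw [hV]; field_simp
    rw [this, div_le_iff₀ hNr]
    have : (C₁ + V) / ε ≤ N := by linarith
    rw [div_le_iff₀ hε] at this
    linarith
end

/-! ### One full Newton step on a typical dataset -/

section
variable {m N : ℕ} {p : Vec m → ℝ → ℝ} {R lam s α : ℝ} {D : Dataset m N} {w : Vec m}

/-- Convergence of one full Newton step, for a Hessian that is coercive at both ends of the step and
a gradient that is affine up to `o(r)` on the ball of radius `r`. -/
lemma oneFullStepSuffices_of_increment {c₁ η c c' r κ : ℝ} (hs : 0 < s) (hc : 0 < c) (hc' : 0 < c')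
    (hc₁ : c₁ < 1 / 2) (hκ : 0 ≤ κ) (hr : 0 < r)
    (hH : ∀ e, c * ‖e‖ ^ 2 ≤ inner ℝ (hess lam s D w e) e)
    (hH' : ∀ e, c' * ‖e‖ ^ 2 ≤ inner ℝ (hess lam s D (w + newtonDir lam s D w) e) e)
    (hg : ‖grad lam s D w‖ ≤ c * r)
    (hΔ : ∀ v, ‖v‖ ≤ r → ‖grad lam s D (w + v) - grad lam s D w - hess lam s D w v‖ ≤ κ * r)
    (h1 : (κ * r) ^ 2 / c' < η * s) (h2 : r * (κ * r) ≤ (1 / 2 - c₁) * (η * s)) :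
    OneFullStepSuffices lam c₁ η s D w := by
  have hinv := isInvertible_of_coercive hc hH
  have hd : ‖newtonDir lam s D w‖ ≤ r :=
    (norm_newtonDir_le hc hH).trans (by rw [div_le_iff₀ hc]; linarith)
  have hHd := hess_newtonDir hinv
  refine ⟨hinv, stopTest_of_norm_grad hc' hH' ?_, fun hns => ?_⟩
  · have h3 := hΔ _ hd
    rw [hHd, sub_neg_eq_add, sub_add_cancel] at h3
    refine lt_of_le_of_lt ?_ h1
    gcongr
  · have h3 : η * s ≤ |inner ℝ (newtonDir lam s D w) (grad lam s D w)| := by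
      by_contra hlt
      exact hns ⟨hinv, not_le.1 hlt⟩
    refine armijo_one_of_remainder hs hinv (B := κ * r) (fun t ht => hΔ _ ?_) ?_ ?_
    · rw [norm_smul, Real.norm_of_nonneg ht.1]
      exact (mul_le_of_le_one_left (norm_nonneg _) ht.2).trans hd
    · calc ‖newtonDir lam s D w‖ * (κ * r) ≤ r * (κ * r) := by gcongr
        _ ≤ (1 / 2 - c₁) * (η * s) := h2
        _ ≤ _ := mul_le_mul_of_nonneg_left h3 (by linarith)
    · have h4 := hH (newtonDir lam s D w)
      rw [hHd, inner_neg_left, real_inner_comm] at h4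
      have : 0 ≤ c * ‖newtonDir lam s D w‖ ^ 2 := by positivity
      linarith

lemma inner_hess_self_le_of_bump (hα : 0 < α) (hD : ∀ i, D i ∈ dataRange m R) {M : ℝ}
    (hM : empMean D (fun q => bump (margin w q / α)) ≤ M * α) (v : Vec m) :
    inner ℝ (hess lam α D w v) v ≤ (lam + R ^ 2 * M) * ‖v‖ ^ 2 := by
  rw [inner_hess_eq_hessKer hα, real_inner_self_eq_norm_sq, add_mul]
  gcongr
  have h1 : empMean D (hessKer α w v v) ≤
      empMean D (fun q => R ^ 2 / α * ‖v‖ * ‖v‖ * bump (margin w q / α)) :=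
    empMean_mono fun i => (le_abs_self _).trans (abs_hessKer_le_bump (hD i) hα w v v)
  rw [empMean_const_mul] at h1
  refine h1.trans ?_
  calc R ^ 2 / α * ‖v‖ * ‖v‖ * empMean D (fun q => bump (margin w q / α))
      ≤ R ^ 2 / α * ‖v‖ * ‖v‖ * (M * α) := by gcongr
    _ = R ^ 2 * M * ‖v‖ ^ 2 := by field_simp

/-- The gradients at two smoothing parameters differ by the fraction of the data near the margin. -/
lemma norm_grad_sub_scale_le (hs : 0 < s) (hsα : s ≤ α) (hR : 0 ≤ R)
    (hD : ∀ i, D i ∈ dataRange m R) :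
    ‖grad lam s D w - grad lam α D w‖ ≤ R * empMean D (fun q => bump (margin w q / α)) := by
  have hb : 0 ≤ empMean D (fun q => bump (margin w q / α)) :=
    empMean_nonneg fun i => (bump_pos _).le
  refine norm_le_of_abs_inner_le (by positivity) fun e => ?_
  rw [inner_sub_left, inner_grad_eq_gradKer hs, inner_grad_eq_gradKer (hs.trans_le hsα),
    sub_sub_sub_cancel_left]
  have h1 : empMean D (gradKer α w e) - empMean D (gradKer s w e) =
    empMean D (fun q => gradKer α w e q - gradKer s w e q) := (empMean_sub _ _ _).symm
  rw [h1, mul_right_comm, ← empMean_const_mul]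
  refine abs_empMean_le fun i => ?_
  have h2 := abs_psiDeriv_scale_sub_le (u := margin w (D i)) hs hsα
  have h3 : gradKer α w e (D i) - gradKer s w e (D i) =
      -((psiDeriv (margin w (D i) / s) - psiDeriv (margin w (D i) / α)) * (D i).2 *
        inner ℝ (D i).1 e) := by unfold gradKer; ring
  rw [h3, abs_neg, abs_mul, abs_mul, (hD i).1, mul_one, mul_comm]
  exact mul_le_mul (abs_inner_le_of_mem (hD i) e) h2 (abs_nonneg _) (by positivity)

/-- The error of the Newton model is the sum of the fluctuation of the gradient increment, the
fluctuation of the Hessian, and the Taylor remainder of the expected gradient. -/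
lemma norm_grad_increment_le (hs : 0 < s) {v : Vec m} {r θ θ' : ℝ} (hθ : 0 ≤ θ)
    (hr : 0 ≤ r) (hv : ‖v‖ ≤ r) (hθθ : θ' ≤ θ)
    (h1 : ∀ e, |meanDev p D (fun q => gradKer s (w + v) e q - gradKer s w e q)| ≤ θ * r * ‖e‖)
    (h2 : ∀ e, |meanDev p D (hessKer s w v e)| ≤ θ' * ‖v‖ * ‖e‖)
    (h3 : ∀ e, |(∫ q, gradKer s (w + v) e q ∂dataLaw p) - (∫ q, gradKer s w e q ∂dataLaw p) +
      ∫ q, hessKer s w v e q ∂dataLaw p| ≤ θ * r * ‖e‖)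
    (hi : ∀ w e, Integrable (gradKer s w e) (dataLaw p)) :
    ‖grad lam s D (w + v) - grad lam s D w - hess lam s D w v‖ ≤ 3 * θ * r := by
  refine norm_le_of_abs_inner_le (by positivity) fun e => ?_
  have h4 : inner ℝ (grad lam s D (w + v) - grad lam s D w - hess lam s D w v) e =
      -(meanDev p D (fun q => gradKer s (w + v) e q - gradKer s w e q) +
        meanDev p D (hessKer s w v e) +
        ((∫ q, gradKer s (w + v) e q ∂dataLaw p) - (∫ q, gradKer s w e q ∂dataLaw p) +
          ∫ q, hessKer s w v e q ∂dataLaw p)) := by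
    unfold meanDev
    rw [empMean_sub, integral_sub (hi _ _) (hi _ _), inner_sub_left, inner_sub_left,
      inner_grad_eq_gradKer hs, inner_grad_eq_gradKer hs, inner_hess_eq_hessKer hs, inner_add_left]
    ring
  rw [h4, abs_neg]
  have h5 : θ' * ‖v‖ * ‖e‖ ≤ θ * r * ‖e‖ := by gcongr
  have h6 := h1 e
  have h7 := h2 e
  have h8 := h3 e
  have h9 := abs_add_three (meanDev p D (fun q => gradKer s (w + v) e q - gradKer s w e q))
    (meanDev p D (hessKer s w v e))
    ((∫ q, gradKer s (w + v) e q ∂dataLaw p) - (∫ q, gradKer s w e q ∂dataLaw p) +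
          ∫ q, hessKer s w v e q ∂dataLaw p)
  linarith

/-- For typical data the Hessian is bounded, uniformly in the smoothing width. -/
lemma norm_hess_le (hp : IsDataDensity p R) (hlam : 0 ≤ lam) (hs : 0 < s) {C θ : ℝ}
    (hC : ∫ q, bump (margin w q / s) ∂dataLaw p ≤ C * s) (hC0 : 0 ≤ C) (hθ : 0 ≤ θ)
    (h : ∀ v e, |meanDev p D (hessKer s w v e)| ≤ θ * ‖v‖ * ‖e‖) (v : Vec m) :
    ‖hess lam s D w v‖ ≤ (lam + R ^ 2 * C + θ) * ‖v‖ := by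
  refine norm_le_of_abs_inner_le (by positivity) fun e => ?_
  rw [inner_hess_eq_hessKer hs]
  have h1 := h v e
  have h2 : |∫ q, hessKer s w v e q ∂dataLaw p| ≤ R ^ 2 * C * ‖v‖ * ‖e‖ := by
    refine (integral_dataLaw_mono hp ((measurable_bump_margin w s).const_mul _)
      (B := R ^ 2 / s * ‖v‖ * ‖e‖) (fun q hq => abs_hessKer_le_bump hq hs w v e)
      fun q _ => mul_le_of_le_one_right (by positivity) (bump_le_one _)).trans ?_
    rw [integral_const_mul]
    calc R ^ 2 / s * ‖v‖ * ‖e‖ * ∫ q, bump (margin w q / s) ∂dataLaw p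
        ≤ R ^ 2 / s * ‖v‖ * ‖e‖ * (C * s) := by gcongr
      _ = R ^ 2 * C * ‖v‖ * ‖e‖ := by field_simp
  have h3 : |lam * inner ℝ v e| ≤ lam * (‖v‖ * ‖e‖) := by
    rw [abs_mul, abs_of_nonneg hlam]
    gcongr
    exact abs_real_inner_le_norm _ _
  have h4 : lam * inner ℝ v e + empMean D (hessKer s w v e) = lam * inner ℝ v e +
      meanDev p D (hessKer s w v e) + ∫ q, hessKer s w v e q ∂dataLaw p := by unfold meanDev; ring
  rw [h4]
  refine (abs_add_three _ _ _).trans ?_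
  linarith

/-- The Newton steps at `w` for two typical datasets are close to each other. -/
lemma norm_newtonDir_sub_le (hs : 0 < s) {D₀ : Dataset m N} {c t θ r : ℝ} (hc : 0 < c)
    (hθ : 0 ≤ θ) (ht : 0 ≤ t)
    (hH : ∀ e, c * ‖e‖ ^ 2 ≤ inner ℝ (hess lam s D w e) e)
    (hH₀ : ∀ e, c * ‖e‖ ^ 2 ≤ inner ℝ (hess lam s D₀ w e) e)
    (hg : ∀ e, |meanDev p D (gradKer s w e)| ≤ t * ‖e‖)
    (hg₀ : ∀ e, |meanDev p D₀ (gradKer s w e)| ≤ t * ‖e‖)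
    (hh : ∀ v e, |meanDev p D (hessKer s w v e)| ≤ θ * ‖v‖ * ‖e‖)
    (hh₀ : ∀ v e, |meanDev p D₀ (hessKer s w v e)| ≤ θ * ‖v‖ * ‖e‖)
    (hr : ‖newtonDir lam s D₀ w‖ ≤ r) :
    ‖newtonDir lam s D w - newtonDir lam s D₀ w‖ ≤ (2 * t + 2 * θ * r) / c := by
  set d := newtonDir lam s D w
  set d₀ := newtonDir lam s D₀ w
  rw [le_div_iff₀ hc, mul_comm]
  refine (norm_mul_le_of_coercive hH (d - d₀)).trans ?_
  have h1 : hess lam s D w (d - d₀) = (grad lam s D₀ w - grad lam s D w) +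
      (hess lam s D₀ w d₀ - hess lam s D w d₀) := by
    rw [map_sub, hess_newtonDir (isInvertible_of_coercive hc hH),
      hess_newtonDir (isInvertible_of_coercive hc hH₀)]
    abel
  rw [h1]
  refine (norm_add_le _ _).trans (add_le_add ?_ ?_)
  · refine norm_le_of_abs_inner_le (by positivity) fun e => ?_
    rw [inner_sub_left, inner_grad_eq_gradKer hs, inner_grad_eq_gradKer hs, sub_sub_sub_cancel_left]
    have h2 : empMean D (gradKer s w e) - empMean D₀ (gradKer s w e) =
        meanDev p D (gradKer s w e) - meanDev p D₀ (gradKer s w e) := by unfold meanDev; ring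
    rw [h2]
    refine (abs_sub _ _).trans ?_
    have := hg e
    have := hg₀ e
    linarith
  · have h0 : 0 ≤ r := (norm_nonneg _).trans hr
    refine norm_le_of_abs_inner_le (by positivity) fun e => ?_
    rw [inner_sub_left, inner_hess_eq_hessKer hs, inner_hess_eq_hessKer hs, add_sub_add_left_eq_sub]
    have h2 : empMean D₀ (hessKer s w d₀ e) - empMean D (hessKer s w d₀ e) =
        meanDev p D₀ (hessKer s w d₀ e) - meanDev p D (hessKer s w d₀ e) := by unfold meanDev; ring
    rw [h2]
    refine (abs_sub _ _).trans ?_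
    have h3 := hh d₀ e
    have h4 := hh₀ d₀ e
    have h5 : θ * ‖d₀‖ * ‖e‖ ≤ θ * r * ‖e‖ := by gcongr
    linarith
end

section
variable {m : ℕ} {p : Vec m → ℝ → ℝ} {R lam : ℝ}

/-- With high probability the Hessian is coercive at both ends of a Newton step, if the gradient at
the starting point is small. The end of the step is only known up to `M / √N`. -/
def CoerciveSteps (p : Vec m → ℝ → ℝ) (R lam : ℝ) : Prop :=
  ∀ ε : ℝ, 0 < ε → ∃ c : ℝ, 0 < c ∧ ∀ M : ℝ, 1 ≤ M → ∃ c' δ C : ℝ, 0 < c' ∧ 0 < δ ∧ 0 < C ∧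
    ∀ N : ℕ, ∀ w : Vec m, ∀ s α : ℝ, 0 < s → s ≤ α → α ≤ δ → C ≤ N * s →
      sampleLaw p N {D | (∀ i, D i ∈ dataRange m R) ∧ ‖grad lam α D w‖ ≤ δ ∧
        ¬ ∀ e, c * ‖e‖ ^ 2 ≤ inner ℝ (hess lam s D w e) e} ≤ ENNReal.ofReal ε ∧
      ∀ q₀ : Vec m, ‖q₀ - w‖ + M / √N + s ≤ δ →
        sampleLaw p N {D | (∀ i, D i ∈ dataRange m R) ∧ ‖grad lam α D w‖ ≤ δ ∧
          (hess lam s D w).IsInvertible ∧ (∀ v, ‖hess lam s D w v‖ ≤ M * ‖v‖) ∧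
          ‖w + newtonDir lam s D w - q₀‖ ≤ M / √N ∧
          ¬ ∀ e, c' * ‖e‖ ^ 2 ≤ inner ℝ (hess lam s D (w + newtonDir lam s D w) e) e} ≤
          ENNReal.ofReal ε

lemma coerciveSteps_of_pos (hlam : 0 < lam) : CoerciveSteps p R lam := by
  refine fun ε _ => ⟨lam, hlam, fun M _ => ⟨lam, 1, 1, hlam, one_pos, one_pos,
    fun N w s α hs _ _ _ => ⟨?_, fun q₀ _ => ?_⟩⟩⟩
  · rw [show {D : Dataset m N | _} = ∅ from Set.eq_empty_of_forall_notMem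
      fun D hD => hD.2.2 fun e => lam_mul_le_inner_hess_self hs _ _]
    simp
  · rw [show {D : Dataset m N | _} = ∅ from Set.eq_empty_of_forall_notMem
      fun D hD => hD.2.2.2.2.2 fun e => lam_mul_le_inner_hess_self hs _ _]
    simp

/-- Without regularization, a point with a small gradient is near the minimizer `wst`. There
Chebyshev's inequality gives enough data near the margin at the starting point, and
anticoncentration does so at the end point. -/
lemma coerciveSteps_of_isSpanning {wst : Vec m} {y r c₀ : ℝ} {Z : Finset (Vec m)}
    (hp : IsDataDensity p R) (h : IsSpanning p wst y Z r c₀)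
    (hmin : ∀ v, expectedObjective p 0 wst ≤ expectedObjective p 0 v) : CoerciveSteps p R 0 := by
  intro ε hε
  obtain ⟨κ, C₁, r₁, s₁, hκ, hC₁, hr₁, hs₁, hbad⟩ := exists_measure_localBump_lt_le hp h
  have hr := h.r_pos
  refine ⟨κ * r ^ 2 / (8 * (1 + R ^ 2) ^ 2), by positivity, fun M hM => ?_⟩
  obtain ⟨c', r₂, s₂, hc', hr₂, hs₂, C₂, hC₂, hend⟩ :=
    exists_measure_newton_end_degenerate_le hp h hM hε
  obtain ⟨c₃, C₃, α₃, hc₃, hC₃, hα₃, hloc⟩ := exists_measure_localization_le hp h hmin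
    (r₀ := min r₁ r₂) (by positivity) hε
  refine ⟨c', min (min (min s₁ s₂) (min r₂ α₃)) (min c₃ 1), C₁ / ε + C₂ + C₃, hc', by positivity,
    by positivity, fun N w s α hs hsα hα hN => ?_⟩
  have a1 : α ≤ s₁ := hα.trans ((min_le_left _ _).trans ((min_le_left _ _).trans (min_le_left _ _)))
  have a2 : α ≤ s₂ := hα.trans ((min_le_left _ _).trans ((min_le_left _ _).trans (min_le_right _ _)))
  have a3 : α ≤ α₃ := hα.trans ((min_le_left _ _).trans ((min_le_right _ _).trans (min_le_right _ _)))
  have a4 : α ≤ 1 := hα.trans ((min_le_right _ _).trans (min_le_right _ _))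
  have hq : 0 ≤ C₁ / ε := by positivity
  have hN0 : 0 < N := by
    rcases Nat.eq_zero_or_pos N with rfl | h
    · simp only [Nat.cast_zero, zero_mul] at hN; linarith
    · exact h
  have hNr : (0 : ℝ) < N := by exact_mod_cast hN0
  have hN3 : C₃ ≤ N := by nlinarith
  have hδ : ∀ x, x ≤ min (min (min s₁ s₂) (min r₂ α₃)) (min c₃ 1) → x ≤ c₃ ∧ x ≤ r₂ := fun x hx =>
    ⟨hx.trans ((min_le_right _ _).trans (min_le_left _ _)),
      hx.trans ((min_le_left _ _).trans ((min_le_right _ _).trans (min_le_left _ _)))⟩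
  -- away from `wst` a small gradient is itself unlikely
  rcases le_total (min r₁ r₂) ‖w - wst‖ with hfar | hnear
  · have hl : ∀ A : Set (Dataset m N), (∀ D ∈ A, ‖grad 0 α D w‖ ≤ c₃) →
        sampleLaw p N A ≤ ENNReal.ofReal ε := fun A hA =>
      (measure_mono (show A ⊆ {D | ∃ w, min r₁ r₂ ≤ ‖w - wst‖ ∧ ‖grad 0 α D w‖ ≤ c₃} from
        fun D hD => ⟨w, hfar, hA D hD⟩)).trans (hloc N hN3 α (hs.trans_le hsα) a3)
    exact ⟨hl _ fun D hD => (hδ _ hD.2.1).1, fun q₀ _ => hl _ fun D hD => (hδ _ hD.2.1).1⟩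
  · refine ⟨?_, fun q₀ hq₀ => ?_⟩
    · refine (measure_mono ?_).trans ((hbad N hN0 w (hnear.trans (min_le_left _ _)) s hs
        (hsα.trans a1) Finset.univ (by simp)).trans (ENNReal.ofReal_le_ofReal ?_))
      · rintro D ⟨hD, -, hnot⟩
        by_contra hcon
        simp only [Set.mem_ofPred_eq, not_exists, not_and, not_lt] at hcon
        refine hnot fun e => ?_
        have h1 := hess_ge_of_localBump h le_rfl hs le_rfl hN0 hD (w := w) (q := w)
          (by simpa using hs.le) Finset.univ hcon e
        rwa [div_self hs.ne', one_pow, one_mul] at h1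
      · rw [div_le_iff₀ (by positivity)]
        have : C₁ / ε ≤ N * s := by linarith
        rw [div_le_iff₀ hε] at this
        linarith
    · refine (measure_mono ?_).trans (hend N w q₀ (hnear.trans (min_le_right _ _)) s hs
        (hsα.trans a2) (by linarith) (hδ _ hq₀).2)
      rintro D ⟨hD, -, hrest⟩
      exact ⟨hD, hrest⟩
end

/-! ### The full Newton step at a fixed point -/

section
variable {m N : ℕ} {p : Vec m → ℝ → ℝ} {R lam η α s M₁ t τ c b : ℝ} {D D₀ : Dataset m N} {w : Vec m}

/-- The typical behaviour of the data near a fixed point `w` at which the smoothing parameter is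
reduced from `α` to `s`: few points near the margin, small deviations of gradient and Hessian from
their expectations, and a coercive Hessian. -/
structure IsTypical {N : ℕ} (p : Vec m → ℝ → ℝ) (R lam η α s M₁ t τ c : ℝ) (D : Dataset m N)
    (w : Vec m) : Prop where
  range : ∀ i, D i ∈ dataRange m R
  test : StopTest lam η α D w
  bump_le : empMean D (fun q => bump (margin w q / α)) ≤ M₁ * α
  grad_dev : ∀ e, |meanDev p D (gradKer s w e)| ≤ t * ‖e‖
  hess_dev : ∀ v e, |meanDev p D (hessKer s w v e)| ≤ τ * ‖v‖ * ‖e‖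
  coercive : ∀ e, c * ‖e‖ ^ 2 ≤ inner ℝ (hess lam s D w e) e

lemma le_mul_sqrt_of_sq_le {x a b : ℝ} (ha : 0 ≤ a) (h : x ^ 2 ≤ a ^ 2 * b) :
    x ≤ a * √b := by
  have h1 := Real.le_sqrt_of_sq_le h
  rwa [Real.sqrt_mul (sq_nonneg a), Real.sqrt_sq ha] at h1

lemma measure_union_le_ofReal {Ω : Type*} [MeasurableSpace Ω] {μ : Measure Ω} {A B : Set Ω}
    {a b : ℝ} (ha : 0 ≤ a) (hb : 0 ≤ b) (hA : μ A ≤ ENNReal.ofReal a)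
    (hB : μ B ≤ ENNReal.ofReal b) : μ (A ∪ B) ≤ ENNReal.ofReal (a + b) := by
  rw [ENNReal.ofReal_add ha hb]
  exact (measure_union_le _ _).trans (add_le_add hA hB)

/-- At a point that passes the stopping test the gradient is `O(√(η α))`, because the Hessian is
bounded. -/
lemma norm_grad_le_of_stopTest (hlam : 0 ≤ lam) (hα : 0 < α) (hR : 0 < R) (hM₁ : 0 < M₁)
    (hD : ∀ i, D i ∈ dataRange m R) (htest : StopTest lam η α D w)
    (hb : empMean D (fun q => bump (margin w q / α)) ≤ M₁ * α) :
    ‖grad lam α D w‖ ≤ √(lam + R ^ 2 * M₁) * √(η * α) := by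
  have h1 : ‖grad lam α D w‖ ^ 2 ≤ (lam + R ^ 2 * M₁) * (η * α) :=
    norm_grad_sq_le_of_stopTest hlam hα (by positivity) htest
      fun v => inner_hess_self_le_of_bump hα hD hb v
  refine le_mul_sqrt_of_sq_le (Real.sqrt_nonneg _) ?_
  rwa [Real.sq_sqrt (by positivity)]

/-- The reduction of the smoothing parameter changes the gradient by `O(α)`, so that for `α ≤ η` it
remains `O(√(η α))`. -/
lemma norm_grad_reduced_le_of_stopTest (hlam : 0 ≤ lam) (hs : 0 < s) (hsα : s ≤ α) (hR : 0 < R)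
    (hM₁ : 0 < M₁) (hαη : α ≤ η) (hD : ∀ i, D i ∈ dataRange m R) (htest : StopTest lam η α D w)
    (hb : empMean D (fun q => bump (margin w q / α)) ≤ M₁ * α) :
    ‖grad lam s D w‖ ≤ (√(lam + R ^ 2 * M₁) + R * M₁) * √(η * α) := by
  have hα := hs.trans_le hsα
  have hαb : α ≤ √(η * α) := Real.le_sqrt_of_sq_le (by nlinarith)
  have h2 := norm_grad_le_of_stopTest hlam hα hR hM₁ hD htest hb
  have h3 := norm_grad_sub_scale_le (lam := lam) (w := w) hs hsα hR.le hD
  have h4 : R * empMean D (fun q => bump (margin w q / α)) ≤ R * (M₁ * √(η * α)) := by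
    gcongr
    exact hb.trans (by gcongr)
  have h5 := norm_sub_norm_le (grad lam s D w) (grad lam α D w)
  linarith

lemma IsTypical.norm_newtonDir_le (h : IsTypical p R lam η α s M₁ t τ c D w) (hlam : 0 ≤ lam)
    (hs : 0 < s) (hsα : s ≤ α) (hR : 0 < R) (hM₁ : 0 < M₁) (hαη : α ≤ η) (hc : 0 < c) :
    ‖newtonDir lam s D w‖ ≤ (√(lam + R ^ 2 * M₁) + R * M₁) / c * √(η * α) := by
  refine (SmoothSVM.norm_newtonDir_le hc h.coercive).trans ?_
  rw [div_mul_eq_mul_div]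
  gcongr
  exact norm_grad_reduced_le_of_stopTest hlam hs hsα hR hM₁ hαη h.range h.test h.bump_le

/-- For typical data the Hessian is coercive at the end of the Newton step: all these steps end
close to the step of one typical dataset, which serves as the known centre. -/
lemma measure_isTypical_degenerate_le (hp : IsDataDensity p R) (hlam : 0 ≤ lam)
    (hs : 0 < s) (hsα : s ≤ α) (hM₁ : 0 < M₁) (hαη : α ≤ η) (hc : 0 < c) (ht : 0 ≤ t) (hτ : 0 ≤ τ)
    (hτ1 : τ ≤ 1) {r M c' δ ε CB : ℝ} (hCB : 0 ≤ CB)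
    (hr : (√(lam + R ^ 2 * M₁) + R * M₁) / c * √(η * α) ≤ r)
    (hbump : ∫ q, bump (margin w q / s) ∂dataLaw p ≤ CB * s)
    (hM : lam + R ^ 2 * CB + 1 ≤ M) (hMN : (2 * t + 2 * τ * r) / c ≤ M / √N)
    (hδ : √(lam + R ^ 2 * M₁) * √(η * α) ≤ δ) (hrδ : r + M / √N + s ≤ δ)
    (hend : ∀ q₀ : Vec m, ‖q₀ - w‖ + M / √N + s ≤ δ →
        sampleLaw p N {D | (∀ i, D i ∈ dataRange m R) ∧ ‖grad lam α D w‖ ≤ δ ∧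
          (hess lam s D w).IsInvertible ∧ (∀ v, ‖hess lam s D w v‖ ≤ M * ‖v‖) ∧
          ‖w + newtonDir lam s D w - q₀‖ ≤ M / √N ∧
          ¬ ∀ e, c' * ‖e‖ ^ 2 ≤ inner ℝ (hess lam s D (w + newtonDir lam s D w) e) e} ≤
          ENNReal.ofReal ε) :
    sampleLaw p N {D | IsTypical p R lam η α s M₁ t τ c D w ∧
      ¬ ∀ e, c' * ‖e‖ ^ 2 ≤ inner ℝ (hess lam s D (w + newtonDir lam s D w) e) e} ≤
      ENNReal.ofReal ε := by
  by_cases hex : ∃ D₀ : Dataset m N, IsTypical p R lam η α s M₁ t τ c D₀ w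
  · obtain ⟨D₀, hD₀⟩ := hex
    have hd₀ := (hD₀.norm_newtonDir_le hlam hs hsα hp.R_pos hM₁ hαη hc).trans hr
    refine (measure_mono ?_).trans (hend (w + newtonDir lam s D₀ w) ?_)
    · rintro D ⟨hD, hnot⟩
      refine ⟨hD.range, (norm_grad_le_of_stopTest hlam (hs.trans_le hsα) hp.R_pos hM₁ hD.range hD.test
        hD.bump_le).trans hδ, isInvertible_of_coercive hc hD.coercive, fun v => ?_, ?_, hnot⟩
      · refine (norm_hess_le hp hlam hs hbump hCB hτ hD.hess_dev v).trans ?_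
        gcongr
        linarith
      · rw [add_sub_add_left_eq_sub]
        exact (norm_newtonDir_sub_le hs hc hτ ht hD.coercive hD₀.coercive hD.grad_dev
          hD₀.grad_dev hD.hess_dev hD₀.hess_dev hd₀).trans hMN
    · rw [add_sub_cancel_left]
      linarith
  · rw [show {D : Dataset m N | _} = ∅ from Set.eq_empty_of_forall_notMem
      fun D hD => hex ⟨D, hD.1⟩]
    simp

lemma IsTypical.oneFullStepSuffices (h : IsTypical p R lam η α s M₁ t τ c D w)
    (hp : IsDataDensity p R) (hlam : 0 ≤ lam)
    (hs : 0 < s) (hsα : s ≤ α) (hM₁ : 0 < M₁) (hαη : α ≤ η) (hc : 0 < c)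
    {r c' c₁ θ CT : ℝ} (hr0 : 0 < r) (hc' : 0 < c') (hc₁ : c₁ < 1 / 2) (hθ : 0 ≤ θ) (hτθ : τ ≤ θ)
    (hr : (√(lam + R ^ 2 * M₁) + R * M₁) / c * √(η * α) ≤ r)
    (hend : ∀ e, c' * ‖e‖ ^ 2 ≤ inner ℝ (hess lam s D (w + newtonDir lam s D w) e) e)
    (hinc : ∀ v e, ‖v‖ ≤ r →
      |meanDev p D (fun q => gradKer s (w + v) e q - gradKer s w e q)| ≤ θ * r * ‖e‖)
    (htaylor : ∀ v e, ‖v‖ ≤ r →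
      |(∫ q, gradKer s (w + v) e q ∂dataLaw p) - (∫ q, gradKer s w e q ∂dataLaw p) +
        ∫ q, hessKer s w v e q ∂dataLaw p| ≤ CT * ‖v‖ * (‖v‖ + s) * ‖e‖)
    (hCT0 : 0 ≤ CT) (hCT : CT * (r + s) ≤ θ) (h1 : (3 * θ * r) ^ 2 / c' < η * s)
    (h2 : r * (3 * θ * r) ≤ (1 / 2 - c₁) * (η * s)) :
    OneFullStepSuffices lam c₁ η s D w := by
  refine oneFullStepSuffices_of_increment hs hc hc' hc₁ (κ := 3 * θ) (r := r)
    (by positivity) hr0 h.coercive hend ?_ (fun v hv => ?_) h1 h2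
  · refine (norm_grad_reduced_le_of_stopTest hlam hs hsα hp.R_pos hM₁ hαη h.range h.test
      h.bump_le).trans ?_
    rw [div_mul_eq_mul_div, div_le_iff₀ hc] at hr
    linarith
  · refine norm_grad_increment_le hs hθ hr0.le hv hτθ (fun e => hinc v e hv) (h.hess_dev v)
      (fun e => (htaylor v e hv).trans ?_) fun w e => integrable_dataLaw hp
        (continuous_gradKer s w e).measurable fun q hq => abs_gradKer_le hq s w e
    have h3 : CT * (‖v‖ + s) ≤ θ := le_trans (by gcongr) hCT
    calc CT * ‖v‖ * (‖v‖ + s) * ‖e‖ = CT * (‖v‖ + s) * ‖v‖ * ‖e‖ := by ring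
      _ ≤ θ * r * ‖e‖ := by gcongr

/-- The union bound behind the convergence at a fixed point. -/
lemma measure_stopTest_not_oneFullStep_le (hp : IsDataDensity p R) (hlam : 0 ≤ lam)
    (hs : 0 < s) (hsα : s ≤ α) (hM₁ : 0 < M₁) (hαη : α ≤ η) (hc : 0 < c)
    {r c' c₁ θ CT δ ε : ℝ} (hr0 : 0 < r) (hc' : 0 < c') (hc₁ : c₁ < 1 / 2) (hθ : 0 ≤ θ)
    (hτθ : τ ≤ θ) (hr : (√(lam + R ^ 2 * M₁) + R * M₁) / c * √(η * α) ≤ r)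
    (hδ : √(lam + R ^ 2 * M₁) * √(η * α) ≤ δ) (hε : 0 ≤ ε)
    (e1 : sampleLaw p N {D | M₁ * α ≤ empMean D (fun q => bump (margin w q / α))} ≤
      ENNReal.ofReal ε)
    (e2 : sampleLaw p N {D | ∃ e, t * ‖e‖ < |meanDev p D (gradKer s w e)|} ≤ ENNReal.ofReal ε)
    (e3 : sampleLaw p N {D | ∃ v e, τ * ‖v‖ * ‖e‖ < |meanDev p D (hessKer s w v e)|} ≤
      ENNReal.ofReal ε)
    (e4 : sampleLaw p N {D | (∀ i, D i ∈ dataRange m R) ∧ ∃ v e, ‖v‖ ≤ r ∧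
        θ * r * ‖e‖ < |meanDev p D (fun q => gradKer s (w + v) e q - gradKer s w e q)|} ≤
        ENNReal.ofReal ε)
    (e5 : sampleLaw p N {D | (∀ i, D i ∈ dataRange m R) ∧ ‖grad lam α D w‖ ≤ δ ∧
        ¬ ∀ e, c * ‖e‖ ^ 2 ≤ inner ℝ (hess lam s D w e) e} ≤ ENNReal.ofReal ε)
    (e6 : sampleLaw p N {D | IsTypical p R lam η α s M₁ t τ c D w ∧
      ¬ ∀ e, c' * ‖e‖ ^ 2 ≤ inner ℝ (hess lam s D (w + newtonDir lam s D w) e) e} ≤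
      ENNReal.ofReal ε)
    (htaylor : ∀ v e, ‖v‖ ≤ r →
      |(∫ q, gradKer s (w + v) e q ∂dataLaw p) - (∫ q, gradKer s w e q ∂dataLaw p) +
        ∫ q, hessKer s w v e q ∂dataLaw p| ≤ CT * ‖v‖ * (‖v‖ + s) * ‖e‖)
    (hCT0 : 0 ≤ CT) (hCT : CT * (r + s) ≤ θ) (h1 : (3 * θ * r) ^ 2 / c' < η * s)
    (h2 : r * (3 * θ * r) ≤ (1 / 2 - c₁) * (η * s)) :
    sampleLaw p N {D | StopTest lam η α D w ∧ ¬ OneFullStepSuffices lam c₁ η s D w} ≤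
      ENNReal.ofReal (6 * ε) := by
  have e0 : sampleLaw p N {D | ¬ ∀ i, D i ∈ dataRange m R} ≤ ENNReal.ofReal 0 := by
    rw [ENNReal.ofReal_zero]; exact (ae_iff.1 (ae_sampleLaw hp N)).le
  have hun := measure_union_le_ofReal le_rfl (by positivity) e0
    (measure_union_le_ofReal hε (by positivity) e1
    (measure_union_le_ofReal hε (by positivity) e2
    (measure_union_le_ofReal hε (by positivity) e3
    (measure_union_le_ofReal hε (by positivity) e4
    (measure_union_le_ofReal hε hε e5 e6)))))
  refine (measure_mono ?_).trans (hun.trans (ENNReal.ofReal_le_ofReal (by linarith)))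
  rintro D ⟨htest, hnot⟩
  by_contra hcon
  simp only [Set.mem_union, not_or] at hcon
  obtain ⟨h0, h1', h2', h3, h4, h5, h6⟩ := hcon
  have hD0 : ∀ i, D i ∈ dataRange m R := not_not.1 h0
  have hD1 : empMean D (fun q => bump (margin w q / α)) ≤ M₁ * α := (not_le.1 h1').le
  have hD5 : ∀ e, c * ‖e‖ ^ 2 ≤ inner ℝ (hess lam s D w e) e := by
    by_contra hneg
    exact h5 ⟨hD0, (norm_grad_le_of_stopTest hlam (hs.trans_le hsα) hp.R_pos hM₁ hD0 htest hD1).trans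
      hδ, hneg⟩
  have htyp : IsTypical p R lam η α s M₁ t τ c D w := ⟨hD0, htest, hD1,
    fun e => not_lt.1 fun hlt => h2' ⟨e, hlt⟩, fun v e => not_lt.1 fun hlt => h3 ⟨v, e, hlt⟩, hD5⟩
  have hD6 : ∀ e, c' * ‖e‖ ^ 2 ≤ inner ℝ (hess lam s D (w + newtonDir lam s D w) e) e := by
    by_contra hneg
    exact h6 ⟨htyp, hneg⟩
  exact hnot (htyp.oneFullStepSuffices hp hlam hs hsα hM₁ hαη hc hr0 hc' hc₁ hθ hτθ hr hD6
    (fun v e hv => not_lt.1 fun hlt => h4 ⟨hD0, v, e, hv, hlt⟩) htaylor hCT0 hCT h1 h2)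
end

section
variable {m : ℕ} {p : Vec m → ℝ → ℝ} {R lam : ℝ}

/-- One full Newton step after the reduction of the smoothing parameter, at a fixed point. -/
lemma exists_measure_stopTest_not_oneFullStep_le (hp : IsDataDensity p R) (hlam : 0 ≤ lam)
    (hcs : CoerciveSteps p R lam) {β c₁ ε : ℝ} (hβ0 : 0 < β) (hβ1 : β < 1) (hc₁ : c₁ < 1 / 2)
    (hε : 0 < ε) : ∃ C : ℝ, 0 < C ∧ ∀ η : ℝ, 0 < η → η < 1 → ∃ α₀ : ℝ, 0 < α₀ ∧ ∀ (N : ℕ) (α : ℝ),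
      0 < α → α ≤ α₀ → C ≤ N * (η ^ 2 * α) → ∀ w : Vec m, sampleLaw p N {D | StopTest lam η α D w ∧
        ¬ OneFullStepSuffices lam c₁ η (β * α) D w} ≤ ENNReal.ofReal ε := by
  have hR := hp.R_pos
  obtain ⟨ε', hε'e⟩ : ∃ x, x = ε / 6 := ⟨_, rfl⟩
  have hε' : 0 < ε' := by rw [hε'e]; positivity
  obtain ⟨CB, hCB, hbump⟩ := exists_integral_bump_le hp
  obtain ⟨CH, hCH, hhess⟩ := exists_measure_hessKer_meanDev_le hp
  obtain ⟨CT, rT, hCT, hrT, htaylor⟩ := exists_integral_gradKer_taylor hp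
  obtain ⟨c, hc, hcs⟩ := hcs ε' hε'
  have hCB0 : 0 < CB := by linarith only [hCB]
  -- `M₁`, `Mg` and `Mh` bound the bump, the gradient and the Hessian with probability `1 - ε'`;
  -- the Newton step has length at most `A √(η α)`, and `θ` is the admissible relative error of the
  -- Newton model on the ball of this radius
  obtain ⟨M₁, hM₁⟩ : ∃ x, x = CB / ε' := ⟨_, rfl⟩
  have hM₁0 : 0 < M₁ := by rw [hM₁]; positivity
  obtain ⟨VG, hVG⟩ : ∃ x, x = (m : ℝ) * (m + 1) ^ 2 * R ^ 2 := ⟨_, rfl⟩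
  have hVG0 : 0 ≤ VG := by rw [hVG]; positivity
  obtain ⟨Mg, hMg0, hMg2⟩ : ∃ x, 0 < x ∧ x ^ 2 = (VG + 1) / ε' :=
    ⟨√((VG + 1) / ε'), by positivity, Real.sq_sqrt (by positivity)⟩
  obtain ⟨Mh, hMh0, hMh2⟩ : ∃ x, 0 < x ∧ x ^ 2 = CH / ε' :=
    ⟨√(CH / ε'), by positivity, Real.sq_sqrt (by positivity)⟩
  obtain ⟨G, hG⟩ : ∃ x, x = √(lam + R ^ 2 * M₁) + R * M₁ := ⟨_, rfl⟩
  have hG0 : 0 < G := by rw [hG]; positivity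
  have hG1 : √(lam + R ^ 2 * M₁) ≤ G := by
    rw [hG]; have : 0 < R * M₁ := by positivity
    linarith only [this]
  obtain ⟨A, hA⟩ : ∃ x, x = G / c := ⟨_, rfl⟩
  have hA0 : 0 < A := by rw [hA]; positivity
  have hsβ : 0 < √β := Real.sqrt_pos.2 hβ0
  obtain ⟨M, hM1, hMa, hMb⟩ : ∃ M, 1 ≤ M ∧ lam + R ^ 2 * CB + 1 ≤ M ∧
      (2 * Mg + 2 * (Mh / √β) * A) / c ≤ M := by
    have h1 : 0 ≤ (2 * Mg + 2 * (Mh / √β) * A) / c := by positivity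
    have h2 : 0 ≤ R ^ 2 * CB := by positivity
    exact ⟨(lam + R ^ 2 * CB + 1) + (2 * Mg + 2 * (Mh / √β) * A) / c, by linarith only [h1, h2, hlam],
      by linarith only [h1], by linarith only [h2, hlam]⟩
  obtain ⟨c', δ, C₂, hc', hδ, hC₂, hcs⟩ := hcs M hM1
  have hc₁' : 0 < 1 / 2 - c₁ := by linarith only [hc₁]
  obtain ⟨θ, hθ0, hθ1, hθ2, hθ3⟩ : ∃ θ, 0 < θ ∧ θ ≤ 1 ∧ θ * (10 * A ^ 2) ≤ β * c' ∧
      θ * (3 * A ^ 2) ≤ (1 / 2 - c₁) * β := by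
    refine ⟨min 1 (min (β * c' / (10 * A ^ 2)) ((1 / 2 - c₁) * β / (3 * A ^ 2))), by positivity,
      min_le_left _ _, ?_, ?_⟩
    · rw [← le_div_iff₀ (by positivity)]; exact (min_le_right _ _).trans (min_le_left _ _)
    · rw [← le_div_iff₀ (by positivity)]; exact (min_le_right _ _).trans (min_le_right _ _)
  obtain ⟨C₃, hC₃, hinc⟩ := exists_measure_gradKer_increment_le hp hθ0 hε'
  have k1 : 0 ≤ C₂ / β := by positivity
  have k2 : 0 ≤ (Mh / θ) ^ 2 / β := by positivity
  have k3 : 0 ≤ C₃ / A := by positivity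
  refine ⟨1 + C₂ / β + (Mh / θ) ^ 2 / β + C₃ / A, by positivity, fun η hη hη1 => ?_⟩
  obtain ⟨B, hB⟩ : ∃ x, x = min (min (δ / (A + M + 1 + G)) (rT / A)) (θ / (CT * (A + 1))) :=
    ⟨_, rfl⟩
  have hM0 : 0 < M := by linarith only [hM1]
  have hB0 : 0 < B := by rw [hB]; positivity
  refine ⟨min (min (B ^ 2) 1) (min η ((A / C₃) ^ 2 * η)), by positivity,
    fun N α hα hαα hN w => ?_⟩
  have b1 : √α ≤ B := Real.sqrt_le_iff.2 ⟨hB0.le,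
    hαα.trans ((min_le_left _ _).trans (min_le_left _ _))⟩
  have b2 : α ≤ 1 := hαα.trans ((min_le_left _ _).trans (min_le_right _ _))
  have b3 : α ≤ η := hαα.trans ((min_le_right _ _).trans (min_le_left _ _))
  have b4 : α ≤ (A / C₃) ^ 2 * η := hαα.trans ((min_le_right _ _).trans (min_le_right _ _))
  have hsqα : 0 < √α := Real.sqrt_pos.2 hα
  rw [hB] at b1
  have b5 : (A + M + 1 + G) * √α ≤ δ := by
    rw [← le_div_iff₀' (by positivity)]
    exact b1.trans ((min_le_left _ _).trans (min_le_left _ _))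
  have b6 : A * √α ≤ rT := by
    rw [← le_div_iff₀' (by positivity)]
    exact b1.trans ((min_le_left _ _).trans (min_le_right _ _))
  have b7 : CT * ((A + 1) * √α) ≤ θ := by
    rw [← mul_assoc, ← le_div_iff₀' (by positivity)]
    exact b1.trans (min_le_right _ _)
  have hαsq : α ≤ √α := Real.le_sqrt_of_sq_le (by nlinarith only [hα, b2])
  obtain ⟨s, hs⟩ : ∃ x, x = β * α := ⟨_, rfl⟩
  rw [← hs]
  have hs0 : 0 < s := by rw [hs]; positivity
  have hsα : s ≤ α := by rw [hs]; exact mul_le_of_le_one_left hα.le hβ1.le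
  obtain ⟨b, hb⟩ : ∃ x, x = √(η * α) := ⟨_, rfl⟩
  have hb0 : 0 < b := by rw [hb]; positivity
  have hb2 : b ^ 2 = η * α := by rw [hb]; exact Real.sq_sqrt (by positivity)
  have hηα : η * α ≤ α := mul_le_of_le_one_left hα.le hη1.le
  have hbα : b ≤ √α := by rw [hb]; exact Real.sqrt_le_sqrt hηα
  have hηb : η * α ≤ b := by
    rw [hb]
    exact Real.le_sqrt_of_sq_le (pow_le_of_le_one (by positivity) (hηα.trans b2) two_ne_zero)
  have hαb' : C₃ * α ≤ A * b := by
    have h1 : α ≤ A / C₃ * b := by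
      rw [hb]
      exact le_mul_sqrt_of_sq_le (by positivity) (by
        rw [sq, ← mul_assoc]; exact mul_le_mul_of_nonneg_right b4 hα.le)
    rw [div_mul_eq_mul_div, le_div_iff₀ hC₃] at h1
    linarith only [h1]
  have hN0 : 0 < N := by
    rcases Nat.eq_zero_or_pos N with rfl | h
    · simp only [Nat.cast_zero, zero_mul] at hN; linarith only [hN, k1, k2, k3]
    · exact h
  have hNr : (0 : ℝ) < N := by exact_mod_cast hN0
  have hη2 : η ^ 2 * α ≤ η * α := by
    gcongr; exact pow_le_of_le_one hη.le hη1.le two_ne_zero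
  have hNηα : 1 + C₂ / β + (Mh / θ) ^ 2 / β + C₃ / A ≤ N * (η * α) := hN.trans (by gcongr)
  have hNα : N * (η * α) ≤ N * α := by gcongr
  have n1 : 1 ≤ N * α := by linarith only [hNηα, hNα, k1, k2, k3]
  have n2 : C₂ ≤ N * s := by
    have : C₂ / β ≤ N * α := by linarith only [hNηα, hNα, k1, k2, k3]
    rw [div_le_iff₀ hβ0] at this
    rw [hs]; linarith only [this]
  have n3 : (Mh / θ) ^ 2 ≤ N * s := by
    have : (Mh / θ) ^ 2 / β ≤ N * α := by linarith only [hNηα, hNα, k1, k2, k3]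
    rw [div_le_iff₀ hβ0] at this
    rw [hs]; linarith only [this]
  have n4 : C₃ ≤ N * (A * b) := by
    have h1 : C₃ / A ≤ N * (η * α) := by linarith only [hNηα, k1, k2, k3]
    have h3 : C₃ / A ≤ N * b := h1.trans (by gcongr)
    rw [div_le_iff₀ hA0] at h3
    linarith only [h3]
  have hsN : 0 < √(N : ℝ) := Real.sqrt_pos.2 hNr
  have hsNs : 0 < √(N * s) := by positivity
  have hτθ : Mh / √(N * s) ≤ θ := by
    rw [div_le_iff₀ hsNs, ← div_le_iff₀' hθ0]
    exact Real.le_sqrt_of_sq_le n3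
  -- the deviation of the Hessian changes the step by `O(1 / √N)`
  have hτb : Mh / √(N * s) * (A * b) ≤ (Mh / √β) * A / √N := by
    have h2 : √(N * s) = √N * (√β * √α) := by
      rw [Real.sqrt_mul hNr.le, hs, Real.sqrt_mul hβ0.le]
    rw [h2]
    calc Mh / (√N * (√β * √α)) * (A * b) ≤ Mh / (√N * (√β * √α)) * (A * √α) := by gcongr
      _ = (Mh / √β) * A / √N := by field_simp
  have hMN : M / √N ≤ M * √α := by
    rw [div_le_iff₀ hsN, mul_assoc, ← Real.sqrt_mul hα.le]
    refine le_mul_of_one_le_right hM0.le (Real.one_le_sqrt.2 ?_)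
    linarith only [n1]
  have hAb : A * b ≤ A * √α := by gcongr
  have hMα : 0 ≤ M * √α := by positivity
  have hGα : G * b ≤ G * √α := by gcongr
  have hG0' : 0 ≤ G * b := by positivity
  have hA0' : 0 ≤ A * b := by positivity
  have hr : (√(lam + R ^ 2 * M₁) + R * M₁) / c * √(η * α) ≤ A * b := by rw [← hG, ← hA, ← hb]
  have hGδ : √(lam + R ^ 2 * M₁) * √(η * α) ≤ δ := by
    rw [← hb]
    have h1 : √(lam + R ^ 2 * M₁) * b ≤ G * b := by gcongr
    linarith only [h1, hGα, hAb, hA0', hMα, b5, hsqα]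
  have hαδ : α ≤ δ := by linarith only [hGα, hG0', hAb, hA0', hMα, b5, hαsq]
  obtain ⟨e5, hend⟩ := hcs N w s α hs0 hsα hαδ n2
  have htot : 6 * ε' = ε := by rw [hε'e]; ring
  rw [← htot]
  refine measure_stopTest_not_oneFullStep_le hp hlam hs0 hsα hM₁0 b3 hc (t := Mg / √(N : ℝ))
    (τ := Mh / √(N * s)) (r := A * b) (θ := θ) (CT := CT) (by positivity) hc' hc₁ hθ0.le hτθ hr
    hGδ hε'.le ?_ ?_ ?_ ?_ e5 ?_ (fun v e hv => htaylor w v e (hv.trans (hAb.trans b6)) s hs0)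
    hCT.le ?_ ?_ ?_
  · have hprob := isProbabilityMeasure_dataLaw hp
    refine (pi_markov (integrable_dataLaw hp (measurable_bump_margin w α) (B := 1)
      fun q _ => abs_bump_le_one _) (fun q => (bump_pos _).le) (by positivity)).trans
      (ENNReal.ofReal_le_ofReal ?_)
    rw [div_le_iff₀ (by positivity)]
    refine (hbump w α hα).trans (le_of_eq ?_)
    rw [hM₁]; field_simp
  · refine (measure_gradKer_meanDev_le hp hN0 s w (by positivity)).trans
      (ENNReal.ofReal_le_ofReal ?_)
    have : N * (Mg / √(N : ℝ)) ^ 2 = (VG + 1) / ε' := by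
      rw [div_pow, Real.sq_sqrt hNr.le, hMg2]; field_simp
    rw [this, ← hVG, div_le_iff₀ (by positivity), mul_div_cancel₀ _ hε'.ne']
    linarith only
  · refine (hhess N hN0 s hs0 w _ (by positivity)).trans (ENNReal.ofReal_le_ofReal (le_of_eq ?_))
    have : N * s * (Mh / √(N * s)) ^ 2 = CH / ε' := by
      rw [div_pow, Real.sq_sqrt (by positivity), hMh2]; field_simp
    rw [this]; field_simp
  · exact hinc N s (A * b) hs0 ((mul_le_mul_of_nonneg_left hsα hC₃.le).trans hαb') n4 w
  · refine measure_isTypical_degenerate_le hp hlam hs0 hsα hM₁0 b3 hc (by positivity)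
      (by positivity) (hτθ.trans hθ1) hCB0.le hr (hbump w s hs0) hMa ?_ hGδ ?_ hend
    · calc (2 * (Mg / √(N : ℝ)) + 2 * (Mh / √(N * s)) * (A * b)) / c
          ≤ (2 * (Mg / √(N : ℝ)) + 2 * ((Mh / √β) * A / √N)) / c := by
            gcongr ?_ / c
            linarith only [hτb]
        _ = (2 * Mg + 2 * (Mh / √β) * A) / c / √N := by field_simp
        _ ≤ M / √N := by gcongr
    · linarith only [hAb, hMN, hsα, hαsq, b5, hG0', hGα]
  · refine le_trans ?_ b7
    gcongr
    linarith only [hAb, hsα, hαsq]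
  · rw [div_lt_iff₀ hc']
    have h7 : (3 * θ * (A * b)) ^ 2 = θ * (θ * (9 * A ^ 2)) * (η * α) := by rw [← hb2]; ring
    have h8 : θ * (θ * (9 * A ^ 2)) < β * c' := by
      have h9 : θ * (9 * A ^ 2) < θ * (10 * A ^ 2) := by gcongr; norm_num
      have h10 : θ * (θ * (9 * A ^ 2)) ≤ θ * (9 * A ^ 2) := mul_le_of_le_one_left (by positivity) hθ1
      linarith only [h9, h10, hθ2]
    rw [h7, hs]
    have := mul_lt_mul_of_pos_right h8 (mul_pos hη hα)
    linarith only [this]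
  · have h7 : A * b * (3 * θ * (A * b)) = θ * (3 * A ^ 2) * (η * α) := by rw [← hb2]; ring
    rw [h7, hs]
    have := mul_le_mul_of_nonneg_right hθ3 (mul_pos hη hα).le
    linarith only [this]
end

/-! ### The full Newton step uniformly over small gradients -/

section
variable {m : ℕ} {p : Vec m → ℝ → ℝ} {R lam : ℝ}

/-- The number of points of a grid whose mesh is a power of `a` is beaten by an exponential in
`1 / a`. -/
lemma exists_grid_mul_exp_le (m : ℕ) {A B κ ε : ℝ} (hA : 0 < A) (hB : 0 < B) (hκ : 0 < κ)
    (hε : 0 < ε) : ∃ a₀ : ℝ, 0 < a₀ ∧ a₀ ≤ 1 ∧ ∀ a X : ℝ, 0 < a → a ≤ a₀ → 1 / a ≤ X →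
      (A / a ^ 11 + 1) ^ m * (B * Real.exp (-(κ * X))) ≤ ε := by
  set n := 11 * m with hn
  set Q := (A + 1) ^ m * B * ((n + 1).factorial / κ ^ (n + 1)) with hQ
  have hQ0 : 0 < Q := by positivity
  refine ⟨min 1 (ε / Q), by positivity, min_le_left _ _, fun a X ha haa hX => ?_⟩
  have ha1 : a ≤ 1 := haa.trans (min_le_left _ _)
  have ha2 : Q * a ≤ ε := by
    rw [← le_div_iff₀' hQ0]; exact haa.trans (min_le_right _ _)
  have h1 : A / a ^ 11 + 1 ≤ (A + 1) * (1 / a ^ 11) := by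
    have : 1 ≤ 1 / a ^ 11 := by
      rw [le_div_iff₀ (by positivity), one_mul]; exact pow_le_one₀ ha.le ha1
    have h2 : A / a ^ 11 = A * (1 / a ^ 11) := by ring
    rw [h2]; linarith
  have h2 : Real.exp (-(κ * X)) ≤ (n + 1).factorial / (κ / a) ^ (n + 1) := by
    have h3 : κ / a ≤ κ * X := by
      rw [div_eq_mul_one_div]; gcongr
    have h4 := Real.pow_div_factorial_le_exp (κ / a) (by positivity) (n + 1)
    rw [Real.exp_neg]
    rw [inv_le_comm₀ (Real.exp_pos _) (by positivity), inv_div]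
    exact h4.trans (Real.exp_le_exp.2 h3)
  calc (A / a ^ 11 + 1) ^ m * (B * Real.exp (-(κ * X)))
      ≤ ((A + 1) * (1 / a ^ 11)) ^ m * (B * ((n + 1).factorial / (κ / a) ^ (n + 1))) := by gcongr
    _ = Q * a := by
      rw [hQ, hn]
      simp only [mul_pow, div_pow, one_pow, ← pow_mul]
      field_simp
      rw [pow_succ]
    _ ≤ ε := ha2

/-- Uniformly on a ball, the fraction of the data within `ρ` of the margin is `O(ρ)`. -/
lemma exists_measure_uniform_bump_gt_le (hp : IsDataDensity p R) : ∃ C : ℝ, 0 < C ∧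
    ∀ q₀ : Vec m, ∀ ρ₀, 0 < ρ₀ → ∀ ε, 0 < ε → ∃ a₀ : ℝ, 0 < a₀ ∧ ∀ (N : ℕ) (a ρ : ℝ),
      0 < a → a ≤ a₀ → 1 ≤ N * a ^ 12 → a ^ 11 ≤ ρ →
      sampleLaw p N {D | (∀ i, D i ∈ dataRange m R) ∧ ∃ w, ‖w - q₀‖ ≤ ρ₀ ∧
        C * ρ < empMean D (fun q => bump (margin w q / ρ))} ≤ ENNReal.ofReal ε := by
  have hprob := isProbabilityMeasure_dataLaw hp
  have hR := hp.R_pos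
  obtain ⟨CB, hCB, hbump⟩ := exists_integral_bump_le hp
  have hCB0 : 0 < CB := by linarith
  refine ⟨16 * CB, by positivity, fun q₀ ρ₀ hρ₀ ε hε => ?_⟩
  obtain ⟨a₀, ha₀, -, hexp⟩ := exists_grid_mul_exp_le m (A := 2 * (m + 1) * (ρ₀ * R)) (B := 1)
    (κ := 2 * CB) (by positivity) one_pos (by positivity) hε
  refine ⟨a₀, ha₀, fun N a ρ ha haa hN hρ => ?_⟩
  have hρ0 : 0 < ρ := lt_of_lt_of_le (by positivity) hρ
  have hN0 : 0 < N := by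
    rcases Nat.eq_zero_or_pos N with rfl | h
    · simp only [Nat.cast_zero, zero_mul] at hN; linarith
    · exact h
  have hNr : (0 : ℝ) < N := by exact_mod_cast hN0
  have hstep := measure_exists_le_of_grid (sampleLaw p N) q₀ (ρ := ρ₀) (s := ρ / R)
    (κ := Real.exp (-(2 * CB * (N * ρ)))) hρ₀.le (by positivity)
    (A := fun w D => (∀ i, D i ∈ dataRange m R) ∧
      16 * CB * ρ < empMean D (fun q => bump (margin w q / ρ)))
    (A' := fun q D => 4 * CB * (N * ρ) ≤ ∑ i, bump (margin q (D i) / ρ)) ?_ ?_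
  · refine (measure_mono ?_).trans (hstep.trans (ENNReal.ofReal_le_ofReal ?_))
    · rintro D ⟨hD, w, hw, hlt⟩
      exact ⟨w, hw, hD, hlt⟩
    · refine le_trans ?_ (hexp a (N * a ^ 11) ha haa ?_)
      · rw [one_mul]
        rw [div_div_eq_mul_div, mul_div_assoc (2 * ((m : ℝ) + 1))]
        gcongr
      · rw [div_le_iff₀ ha]
        calc (1 : ℝ) ≤ N * a ^ 12 := hN
          _ = N * a ^ 11 * a := by ring
  · rintro w q D hwq - ⟨hD, hlt⟩
    have h1 : empMean D (fun z => bump (margin w z / ρ)) ≤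
        empMean D (fun z => 4 * bump (margin q z / ρ)) := by
      refine empMean_mono fun i => ?_
      have h2 := abs_margin_sub_le (hD i) (w := q) (v := w)
      have h3 : |(margin q (D i) - margin w (D i)) / ρ| ≤ 1 := by
        rw [abs_div, abs_of_pos hρ0, div_le_one hρ0]
        refine h2.trans ?_
        rw [norm_sub_rev]
        rwa [le_div_iff₀ hR] at hwq
      have h4 := bump_le_bump_add (margin w (D i) / ρ) ((margin q (D i) - margin w (D i)) / ρ)
      rw [← add_div, add_sub_cancel] at h4
      refine h4.trans (mul_le_mul_of_nonneg_right ?_ (bump_pos _).le)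
      have := (sq_le_one_iff_abs_le_one _).2 h3
      linarith
    rw [empMean_const_mul] at h1
    have h5 : 4 * CB * ρ ≤ empMean D (fun z => bump (margin q z / ρ)) := by linarith
    unfold empMean at h5
    rw [one_div, le_inv_mul_iff₀ hNr] at h5
    linarith
  · intro q _
    refine (pi_chernoff_upper (measurable_bump_margin q ρ) (fun z => (bump_pos _).le)
      (fun z => bump_le_one _) _).trans (ENNReal.ofReal_le_ofReal (Real.exp_le_exp.2 ?_))
    have : N * ∫ z, bump (margin q z / ρ) ∂dataLaw p ≤ N * (CB * ρ) := by
      gcongr; exact hbump q ρ hρ0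
    linarith

/-- Uniformly near `wst`, the Hessian is bounded below by the fraction of the data within `a ^ 11`
of the margin, weighted with the curvature they contribute. -/
lemma exists_measure_uniform_degenerate_le {wst : Vec m} {y r c₀ : ℝ} {Z : Finset (Vec m)}
    (hp : IsDataDensity p R) (h : IsSpanning p wst y Z r c₀) : ∃ c r₁ : ℝ, 0 < c ∧ 0 < r₁ ∧
    ∀ ε, 0 < ε → ∃ a₀ : ℝ, 0 < a₀ ∧ ∀ (N : ℕ) (a s : ℝ),
      0 < a → a ≤ a₀ → 1 ≤ N * a ^ 12 → 0 < s → s ≤ a ^ 11 →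
      sampleLaw p N {D | (∀ i, D i ∈ dataRange m R) ∧ ∃ w, ‖w - wst‖ ≤ r₁ ∧
        ¬ ∀ e, c * (s / a ^ 11) ^ 3 * ‖e‖ ^ 2 ≤ inner ℝ (hess 0 s D w e) e} ≤ ENNReal.ofReal ε := by
  have hprob := isProbabilityMeasure_dataLaw hp
  obtain ⟨c, r₁, s₁, hc, hr₁, hs₁, hloc⟩ := exists_integral_localBump_ge hp h
  have hr := h.r_pos
  refine ⟨c / 8 * r ^ 2 / (8 * (1 + R ^ 2) ^ 2), r₁ / 2, by positivity, by positivity,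
    fun ε hε => ?_⟩
  obtain ⟨a₀, ha₀, ha₀1, hexp⟩ := exists_grid_mul_exp_le m (A := 2 * (m + 1) * (r₁ / 2))
    (B := Z.card + 1) (κ := c / 4) (by positivity) (by positivity) (by positivity) hε
  refine ⟨min a₀ (min s₁ (r₁ / 2)), by positivity, fun N a s ha haa hN hs hsa => ?_⟩
  have ha1 : a ≤ 1 := haa.trans ((min_le_left _ _).trans ha₀1)
  have haρ : a ^ 11 ≤ a := pow_le_of_le_one ha.le ha1 (by norm_num)
  have hρ1 : a ^ 11 ≤ s₁ := haρ.trans (haa.trans ((min_le_right _ _).trans (min_le_left _ _)))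
  have hρ2 : a ^ 11 ≤ r₁ / 2 := haρ.trans (haa.trans ((min_le_right _ _).trans (min_le_right _ _)))
  have hexp := hexp a (N * a ^ 11) ha (haa.trans (min_le_left _ _)) (by
    rw [div_le_iff₀ ha]
    calc (1 : ℝ) ≤ N * a ^ 12 := hN
      _ = N * a ^ 11 * a := by ring)
  set ρ := a ^ 11
  have hρ0 : 0 < ρ := by positivity
  clear_value ρ
  have hN0 : 0 < N := by
    rcases Nat.eq_zero_or_pos N with rfl | h
    · simp only [Nat.cast_zero, zero_mul] at hN; linarith
    · exact h
  have hNr : (0 : ℝ) < N := by exact_mod_cast hN0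
  have hstep := measure_exists_le_of_grid (sampleLaw p N) wst (ρ := r₁ / 2) (s := ρ)
    (κ := Z.card * Real.exp (-(c / 4 * (N * ρ)))) (by positivity) hρ0
    (A := fun w D => (∀ i, D i ∈ dataRange m R) ∧
      ¬ ∀ e, c / 8 * r ^ 2 / (8 * (1 + R ^ 2) ^ 2) * (s / ρ) ^ 3 * ‖e‖ ^ 2 ≤
        inner ℝ (hess 0 s D w e) e)
    (A' := fun q D => ∃ z ∈ Z, ∑ i, localBump z r y ρ q (D i) ≤ c / 4 * (N * ρ)) ?_ ?_
  · refine (measure_mono ?_).trans (hstep.trans (ENNReal.ofReal_le_ofReal ?_))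
    · rintro D ⟨hD, w, hw, hlt⟩
      exact ⟨w, hw, hD, hlt⟩
    · refine le_trans ?_ hexp
      rw [← mul_div_assoc]
      gcongr
      linarith
  · rintro w q D hwq - ⟨hD, hnot⟩
    by_contra hcon
    simp only [not_exists, not_and, not_le] at hcon
    refine hnot fun e => ?_
    have h1 := hess_ge_of_localBump h le_rfl hs hsa hN0 hD hwq Finset.univ
      (κ := c / 8) (fun z hz => le_trans (by gcongr; norm_num) (hcon z hz).le) e
    linarith
  · intro q hq
    have hq' : ‖q - wst‖ ≤ r₁ := hq.trans (by linarith)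
    have hset : {D : Dataset m N | ∃ z ∈ Z, ∑ i, localBump z r y ρ q (D i) ≤ c / 4 * (N * ρ)} =
        ⋃ z ∈ Z, {D | ∑ i, localBump z r y ρ q (D i) ≤ c / 4 * (N * ρ)} := by ext D; simp
    rw [hset]
    refine (measure_biUnion_finset_le _ _).trans ((Finset.sum_le_sum
      (g := fun _ => ENNReal.ofReal (Real.exp (-(c / 4 * (N * ρ))))) fun z hz => ?_).trans ?_)
    · refine (pi_chernoff_lower (measurable_localBump z r y ρ q) (localBump_nonneg z r y ρ q)
        (localBump_le_one z r y ρ q) _).trans (ENNReal.ofReal_le_ofReal (Real.exp_le_exp.2 ?_))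
      have : N * (c * ρ) ≤ N * ∫ z', localBump z r y ρ q z' ∂dataLaw p := by
        gcongr; exact hloc q hq' ρ hρ0 hρ1 z hz
      linarith
    · rw [Finset.sum_const, nsmul_eq_mul, ENNReal.ofReal_mul (by positivity),
        ENNReal.ofReal_natCast]

/-- With high probability all points with a gradient of order `α = a ^ 12` lie in a fixed ball, and
the Hessian is coercive near all of them; the coercivity constant may degenerate like a power of
`s / a ^ 11`. -/
def UniformlyCoercive (p : Vec m → ℝ → ℝ) (R lam : ℝ) : Prop :=
  ∀ K : ℝ, ∃ (c r ρ₀ : ℝ) (q₀ : Vec m), 0 < c ∧ 0 < r ∧ 0 < ρ₀ ∧ ∀ ε, 0 < ε → ∃ a₀ : ℝ, 0 < a₀ ∧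
    ∀ (N : ℕ) (a s : ℝ), 0 < a → a ≤ a₀ → 1 ≤ N * a ^ 12 → 0 < s → s ≤ a ^ 11 →
      sampleLaw p N {D | (∀ i, D i ∈ dataRange m R) ∧ ∃ w, ‖grad lam (a ^ 12) D w‖ ≤ K * a ^ 12 ∧
        ¬ (‖w - q₀‖ ≤ ρ₀ ∧ ∀ v, ‖v‖ ≤ r → ∀ e, c * (s / a ^ 11) ^ 3 * ‖e‖ ^ 2 ≤
          inner ℝ (hess lam s D (w + v) e) e)} ≤ ENNReal.ofReal ε

/-- With regularization, a small gradient bounds `w`, since the gradient of the loss is at most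
`R`. -/
lemma uniformlyCoercive_of_pos (hp : IsDataDensity p R) (hlam : 0 < lam) :
    UniformlyCoercive p R lam := by
  have hR := hp.R_pos
  refine fun K => ⟨lam, 1, (|K| + R) / lam, 0, hlam, one_pos, by positivity, fun ε _ =>
    ⟨1, one_pos, fun N a s ha haa _ hs hsa => ?_⟩⟩
  rw [show {D : Dataset m N | _} = ∅ from Set.eq_empty_of_forall_notMem ?_]
  · simp
  · rintro D ⟨hD, w, hw, hnot⟩
    refine hnot ⟨?_, fun v _ e => ?_⟩
    · rw [sub_zero, le_div_iff₀ hlam]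
      have ha12 : a ^ 12 ≤ 1 := pow_le_one₀ ha.le haa
      have h1 : K * a ^ 12 ≤ |K| :=
        (mul_le_mul_of_nonneg_right (le_abs_self K) (by positivity)).trans
          (mul_le_of_le_one_right (abs_nonneg _) ha12)
      have h2 : ‖grad lam (a ^ 12) D w - lam • w‖ ≤ R := by
        refine norm_le_of_abs_inner_le hR.le fun e => ?_
        rw [inner_sub_left, inner_grad_eq_gradKer (by positivity), inner_smul_left,
          RCLike.conj_to_real, sub_sub_cancel_left, abs_neg]
        refine (abs_empMean_le (k := fun _ => R * ‖e‖) fun i => abs_gradKer_le (hD i) _ w e).trans ?_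
        exact empMean_le_const (by positivity) fun _ => le_rfl
      have h3 := norm_sub_norm_le (lam • w) (grad lam (a ^ 12) D w)
      rw [norm_sub_rev, norm_smul, Real.norm_of_nonneg hlam.le] at h3
      linarith
    · refine le_trans ?_ (lam_mul_le_inner_hess_self hs _ _)
      have : (s / a ^ 11) ^ 3 ≤ 1 := pow_le_one₀ (by positivity) (by
        rw [div_le_one (by positivity)]; exact hsa)
      gcongr
      exact mul_le_of_le_one_right hlam.le this

lemma uniformlyCoercive_of_isSpanning {wst : Vec m} {y r c₀ : ℝ} {Z : Finset (Vec m)}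
    (hp : IsDataDensity p R) (h : IsSpanning p wst y Z r c₀)
    (hmin : ∀ v, expectedObjective p 0 wst ≤ expectedObjective p 0 v) :
    UniformlyCoercive p R 0 := by
  intro K
  obtain ⟨c, r₁, hc, hr₁, hdeg⟩ := exists_measure_uniform_degenerate_le hp h
  refine ⟨c, r₁ / 2, r₁ / 2, wst, hc, by positivity, by positivity, fun ε hε => ?_⟩
  obtain ⟨a₁, ha₁, hdeg⟩ := hdeg (ε / 2) (by positivity)
  obtain ⟨c₃, C₃, α₃, hc₃, hC₃, hα₃, hloc⟩ := exists_measure_localization_le hp h hmin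
    (r₀ := r₁ / 2) (ε := ε / 2) (by positivity) (by positivity)
  refine ⟨min (min a₁ 1) (min (min α₃ (1 / C₃)) (c₃ / (|K| + 1))), by positivity,
    fun N a s ha haa hN hs hsa => ?_⟩
  have ha1 : a ≤ a₁ := haa.trans ((min_le_left _ _).trans (min_le_left _ _))
  have ha2 : a ≤ 1 := haa.trans ((min_le_left _ _).trans (min_le_right _ _))
  have ha12 : a ^ 12 ≤ a := pow_le_of_le_one ha.le ha2 (by norm_num)
  have ha3 : a ^ 12 ≤ α₃ :=
    ha12.trans (haa.trans ((min_le_right _ _).trans ((min_le_left _ _).trans (min_le_left _ _))))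
  have ha4 : a ≤ 1 / C₃ :=
    haa.trans ((min_le_right _ _).trans ((min_le_left _ _).trans (min_le_right _ _)))
  have ha5 : a ≤ c₃ / (|K| + 1) := haa.trans ((min_le_right _ _).trans (min_le_right _ _))
  have hN3 : C₃ ≤ N := by
    rw [le_div_iff₀ hC₃] at ha4
    have h1 : (N : ℝ) * a ^ 12 ≤ N * a := by gcongr
    have h2 : a * C₃ ≤ a * N := by linarith
    exact le_of_mul_le_mul_left h2 ha
  have hK : K * a ^ 12 ≤ c₃ := by
    rw [le_div_iff₀ (by positivity)] at ha5
    have h1 : K * a ^ 12 ≤ |K| * a := mul_le_mul (le_abs_self K) ha12 (by positivity) (abs_nonneg K)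
    linarith
  have hun := measure_union_le_ofReal (by positivity) (by positivity)
    (hloc N hN3 (a ^ 12) (by positivity) ha3) (hdeg N a s ha ha1 hN hs hsa)
  rw [add_halves] at hun
  refine (measure_mono ?_).trans hun
  rintro D ⟨hD, w, hw, hnot⟩
  by_contra hcon
  simp only [Set.mem_union, Set.mem_ofPred_eq, not_or, not_exists, not_and, not_le, not_not] at hcon
  obtain ⟨h1, h2⟩ := hcon
  have hnear : ‖w - wst‖ ≤ r₁ / 2 := by
    by_contra hlt
    exact (h1 w (not_le.1 hlt).le).not_ge (hw.trans hK)
  refine hnot ⟨hnear, fun v hv e => h2 hD (w + v) ?_ e⟩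
  have : w + v - wst = (w - wst) + v := by abel
  rw [this]
  exact (norm_add_le _ _).trans (by linarith)

/-- The increment of the gradient over a distance of order `τ ≥ s` is controlled by the fraction of
the data within `τ` of the margin. -/
lemma norm_grad_sub_le_bump {N : ℕ} {D : Dataset m N} {s τ : ℝ} (hR : 0 ≤ R) (hlam : 0 ≤ lam)
    (hD : ∀ i, D i ∈ dataRange m R) (hs : 0 < s) (hsτ : s ≤ τ) {w v : Vec m}
    (hvw : ‖v - w‖ * R ≤ τ) : ‖grad lam s D v - grad lam s D w‖ ≤
      lam * ‖v - w‖ + 3 * R * empMean D (fun q => bump (margin w q / τ)) := by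
  have hb : 0 ≤ empMean D (fun q => bump (margin w q / τ)) :=
    empMean_nonneg fun i => (bump_pos _).le
  refine norm_le_of_abs_inner_le (by positivity) fun e => ?_
  have h1 : inner ℝ (grad lam s D v - grad lam s D w) e =
      lam * inner ℝ (v - w) e - empMean D (fun q => gradKer s v e q - gradKer s w e q) := by
    rw [empMean_sub, inner_sub_left, inner_grad_eq_gradKer hs, inner_grad_eq_gradKer hs,
      inner_sub_left]
    ring
  have h2 : |empMean D (fun q => gradKer s v e q - gradKer s w e q)| ≤
      3 * R * ‖e‖ * empMean D (fun q => bump (margin w q / τ)) := by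
    rw [← empMean_const_mul]
    exact abs_empMean_le fun i => abs_gradKer_sub_le (hD i) hs hsτ hvw e
  have h3 : |lam * inner ℝ (v - w) e| ≤ lam * (‖v - w‖ * ‖e‖) := by
    rw [abs_mul, abs_of_nonneg hlam]
    gcongr
    exact abs_real_inner_le_norm _ _
  rw [h1]
  refine (abs_sub _ _).trans ?_
  linarith

/-- The powers of `a`: the gradient at `s = β a ^ 12` is `O(a ^ 11)`, the Hessian at least of order
`a ^ 3`, hence the step `O(a ^ 8)` and the new gradient `O(a ^ 8)`, whose square divided by `a ^ 3`
is `o(a ^ 12)`. -/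
lemma oneFullStepSuffices_of_small_grad {N : ℕ} {D : Dataset m N} {β c₁ c r K C a η G A G' : ℝ}
    {w : Vec m} (hR : 0 < R) (hlam : 0 ≤ lam) (hD : ∀ i, D i ∈ dataRange m R) (hβ0 : 0 < β)
    (hβ1 : β < 1) (hc : 0 < c) (ha : 0 < a) (ha1 : a ≤ 1) (hC : 0 < C) (hG0 : 0 < G)
    (hG : |K| + R * C ≤ G)
    (hA : G / (c * β ^ 3) ≤ A) (hG' : G + lam * A + 3 * R * (C * (A * R + 1)) ≤ G')
    (hr : A * a ≤ r) (hη : G' ^ 2 * a < c * β ^ 4 * η)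
    (hw : ‖grad lam (a ^ 12) D w‖ ≤ K * a ^ 12)
    (hH : ∀ v, ‖v‖ ≤ r → ∀ e, c * ((β * a ^ 12) / a ^ 11) ^ 3 * ‖e‖ ^ 2 ≤
      inner ℝ (hess lam (β * a ^ 12) D (w + v) e) e)
    (hb1 : empMean D (fun q => bump (margin w q / a ^ 11)) ≤ C * a ^ 11)
    (hb2 : empMean D (fun q => bump (margin w q / ((A * R + 1) * a ^ 8))) ≤
      C * ((A * R + 1) * a ^ 8)) :
    OneFullStepSuffices lam c₁ η (β * a ^ 12) D w := by
  have hA0 : 0 < A := lt_of_lt_of_le (by positivity) hA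
  have hs0 : 0 < β * a ^ 12 := by positivity
  have hsα : β * a ^ 12 ≤ a ^ 12 := mul_le_of_le_one_left (by positivity) hβ1.le
  have hpow : ∀ {i j : ℕ}, j ≤ i → a ^ i ≤ a ^ j := fun h => pow_le_pow_of_le_one ha.le ha1 h
  have hs8 : β * a ^ 12 ≤ (A * R + 1) * a ^ 8 := by
    refine hsα.trans ((hpow (i := 12) (j := 8) (by norm_num)).trans ?_)
    refine le_mul_of_one_le_left (by positivity) ?_
    have : 0 < A * R := by positivity
    linarith
  have hh : c * ((β * a ^ 12) / a ^ 11) ^ 3 = c * β ^ 3 * a ^ 3 := by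
    field_simp
  rw [hh] at hH
  have hh0 : 0 < c * β ^ 3 * a ^ 3 := by positivity
  have hr0 : 0 ≤ r := le_trans (by positivity) hr
  have hHw : ∀ e, c * β ^ 3 * a ^ 3 * ‖e‖ ^ 2 ≤ inner ℝ (hess lam (β * a ^ 12) D w e) e := by
    have := hH 0 (by simpa using hr0)
    rwa [add_zero] at this
  have hg : ‖grad lam (β * a ^ 12) D w‖ ≤ G * a ^ 11 := by
    have h1 := norm_grad_sub_scale_le (lam := lam) (w := w) hs0 hsα hR.le hD
    have h2 : empMean D (fun q => bump (margin w q / a ^ 12)) ≤ C * a ^ 11 :=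
      (empMean_mono fun i => bump_div_le (by positivity) (hpow (by norm_num))).trans hb1
    have h3 : K * a ^ 12 ≤ |K| * a ^ 11 :=
      mul_le_mul (le_abs_self K) (hpow (by norm_num)) (by positivity) (abs_nonneg K)
    have h4 := norm_sub_norm_le (grad lam (β * a ^ 12) D w) (grad lam (a ^ 12) D w)
    have h5 : R * empMean D (fun q => bump (margin w q / a ^ 12)) ≤ R * (C * a ^ 11) := by gcongr
    have h6 : (|K| + R * C) * a ^ 11 ≤ G * a ^ 11 := by gcongr
    linarith
  have hd : ‖newtonDir lam (β * a ^ 12) D w‖ ≤ A * a ^ 8 := by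
    refine (norm_newtonDir_le hh0 hHw).trans ?_
    calc ‖grad lam (β * a ^ 12) D w‖ / (c * β ^ 3 * a ^ 3)
        ≤ G * a ^ 11 / (c * β ^ 3 * a ^ 3) := by gcongr
      _ = G / (c * β ^ 3) * a ^ 8 := by field_simp
      _ ≤ A * a ^ 8 := by gcongr
  have hdr : ‖newtonDir lam (β * a ^ 12) D w‖ ≤ r := by
    refine hd.trans (le_trans ?_ hr)
    gcongr
    exact pow_le_of_le_one ha.le ha1 (by norm_num)
  have hG1 : G ≤ G' := by
    have : 0 ≤ lam * A := by positivity
    have : 0 ≤ 3 * R * (C * (A * R + 1)) := by positivity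
    linarith
  have hG'0 : 0 < G' := hG0.trans_le hG1
  have hg1 : ‖grad lam (β * a ^ 12) D (w + newtonDir lam (β * a ^ 12) D w)‖ ≤ G' * a ^ 8 := by
    have h1 := norm_grad_sub_le_bump hR.le hlam hD hs0 hs8 (w := w)
      (v := w + newtonDir lam (β * a ^ 12) D w) (by
        rw [add_sub_cancel_left]
        have : ‖newtonDir lam (β * a ^ 12) D w‖ * R ≤ A * a ^ 8 * R := by gcongr
        have : 0 < a ^ 8 := by positivity
        linarith)
    rw [add_sub_cancel_left] at h1
    have h2 : lam * ‖newtonDir lam (β * a ^ 12) D w‖ ≤ lam * (A * a ^ 8) := by gcongr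
    have h3 : 3 * R * empMean D (fun q => bump (margin w q / ((A * R + 1) * a ^ 8))) ≤
        3 * R * (C * ((A * R + 1) * a ^ 8)) := by gcongr
    have h4 : G * a ^ 11 ≤ G * a ^ 8 := by gcongr ?_ * ?_; exact hpow (by norm_num)
    have h5 := norm_sub_norm_le (grad lam (β * a ^ 12) D (w + newtonDir lam (β * a ^ 12) D w))
      (grad lam (β * a ^ 12) D w)
    have h6 : (G + lam * A + 3 * R * (C * (A * R + 1))) * a ^ 8 ≤ G' * a ^ 8 := by gcongr
    linarith
  have hfin : ∀ v, ‖v‖ ≤ r → ‖grad lam (β * a ^ 12) D (w + v)‖ ≤ G' * a ^ 8 →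
      StopTest lam η (β * a ^ 12) D (w + v) := fun v hv hgv => by
    refine stopTest_of_norm_grad hh0 (hH v hv) ?_
    rw [div_lt_iff₀ hh0]
    calc ‖grad lam (β * a ^ 12) D (w + v)‖ ^ 2 ≤ (G' * a ^ 8) ^ 2 := by gcongr
      _ = G' ^ 2 * a * a ^ 15 := by ring
      _ < c * β ^ 4 * η * a ^ 15 := by gcongr
      _ = η * (β * a ^ 12) * (c * β ^ 3 * a ^ 3) := by ring
  have htest : StopTest lam η (β * a ^ 12) D w := by
    have := hfin 0 (by simpa using hr0) (by
      rw [add_zero]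
      refine hg.trans ?_
      gcongr ?_ * ?_
      exact hpow (by norm_num))
    rwa [add_zero] at this
  exact ⟨isInvertible_of_coercive hh0 hHw, hfin _ hdr hg1, fun hns => absurd htest hns⟩

/-- One full Newton step after the reduction of the smoothing parameter, uniformly over all points
with a small gradient. -/
lemma exists_measure_small_grad_not_oneFullStep_le (hp : IsDataDensity p R) (hlam : 0 ≤ lam)
    (huc : UniformlyCoercive p R lam) {β c₁ ε K : ℝ} (hβ0 : 0 < β) (hβ1 : β < 1) (hε : 0 < ε) :
    ∀ η : ℝ, 0 < η → η < 1 → ∃ α₀ : ℝ, 0 < α₀ ∧ ∀ (N : ℕ) (α : ℝ),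
      0 < α → α ≤ α₀ → 1 ≤ N * (η ^ 2 * α) → sampleLaw p N {D | ∃ w : Vec m,
        ‖grad lam α D w‖ ≤ K * α ∧ ¬ OneFullStepSuffices lam c₁ η (β * α) D w} ≤
          ENNReal.ofReal ε := by
  intro η hη hη1
  have hR := hp.R_pos
  obtain ⟨C, hC, hbump⟩ := exists_measure_uniform_bump_gt_le hp
  obtain ⟨c, r, ρ₀, q₀, hc, hr, hρ₀, huc⟩ := huc K
  obtain ⟨G, hG⟩ : ∃ x, x = |K| + R * C := ⟨_, rfl⟩
  have hG0 : 0 < G := by rw [hG]; positivity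
  obtain ⟨A, hA⟩ : ∃ x, x = G / (c * β ^ 3) := ⟨_, rfl⟩
  have hA0 : 0 < A := by rw [hA]; positivity
  obtain ⟨G', hG'⟩ : ∃ x, x = G + lam * A + 3 * R * (C * (A * R + 1)) := ⟨_, rfl⟩
  have hG'0 : 0 < G' := by rw [hG']; positivity
  have hε3 : 0 < ε / 3 := by positivity
  obtain ⟨a₁, ha₁, huc⟩ := huc (ε / 3) hε3
  obtain ⟨a₂, ha₂, hb⟩ := hbump q₀ ρ₀ hρ₀ (ε / 3) hε3
  obtain ⟨a₀, ha₀0, h1, h2, h4, h5, h6⟩ : ∃ a₀ : ℝ, 0 < a₀ ∧ a₀ ≤ a₁ ∧ a₀ ≤ a₂ ∧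
      a₀ ≤ 1 ∧ a₀ ≤ r / A ∧ a₀ ≤ c * β ^ 4 * η / (2 * G' ^ 2) := by
    refine ⟨min (min (min a₁ a₂) 1) (min (r / A) (c * β ^ 4 * η / (2 * G' ^ 2))),
      by positivity, ?_⟩
    simp only [min_le_iff, le_refl, true_or, or_true, and_self]
  refine ⟨a₀ ^ 12, by positivity, fun N α hα hαα hN => ?_⟩
  obtain ⟨a, ha, hae⟩ : ∃ a : ℝ, 0 < a ∧ a ^ 12 = α :=
    ⟨α ^ ((12 : ℕ) : ℝ)⁻¹, by positivity, Real.rpow_inv_natCast_pow hα.le (by norm_num)⟩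
  rw [← hae] at hαα hN ⊢
  have haa : a ≤ a₀ := (pow_le_pow_iff_left₀ ha.le ha₀0.le (by norm_num)).1 hαα
  have ha1 : a ≤ 1 := haa.trans h4
  have hN1 : 1 ≤ N * a ^ 12 := by
    refine hN.trans ?_
    gcongr
    exact mul_le_of_le_one_left (by positivity) (pow_le_one₀ hη.le hη1.le)
  have hpow : a ^ 12 ≤ a ^ 11 := pow_le_pow_of_le_one ha.le ha1 (by norm_num)
  have hpow8 : a ^ 11 ≤ a ^ 8 := pow_le_pow_of_le_one ha.le ha1 (by norm_num)
  have e0 : sampleLaw p N {D | ¬ ∀ i, D i ∈ dataRange m R} ≤ ENNReal.ofReal 0 := by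
    rw [ENNReal.ofReal_zero]; exact (ae_iff.1 (ae_sampleLaw hp N)).le
  have e1 := huc N a (β * a ^ 12) ha (haa.trans h1) hN1 (by positivity)
    ((mul_le_of_le_one_left (by positivity) hβ1.le).trans hpow)
  have e2 := hb N a (a ^ 11) ha (haa.trans h2) hN1 le_rfl
  have e3 := hb N a ((A * R + 1) * a ^ 8) ha (haa.trans h2) hN1 (by
    refine hpow8.trans (le_mul_of_one_le_left (by positivity) ?_)
    have : 0 < A * R := by positivity
    linarith)
  have hun := measure_union_le_ofReal le_rfl (by positivity) e0
    (measure_union_le_ofReal hε3.le (by positivity) e1 (measure_union_le_ofReal hε3.le hε3.le e2 e3))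
  refine (measure_mono ?_).trans (hun.trans (ENNReal.ofReal_le_ofReal (by linarith)))
  rintro D ⟨w, hw, hnot⟩
  by_contra hcon
  simp only [Set.mem_union, not_or] at hcon
  obtain ⟨g0, g1, g2, g3⟩ := hcon
  have hD : ∀ i, D i ∈ dataRange m R := not_not.1 g0
  obtain ⟨hball, hH⟩ : ‖w - q₀‖ ≤ ρ₀ ∧ ∀ v, ‖v‖ ≤ r → ∀ e,
      c * (β * a ^ 12 / a ^ 11) ^ 3 * ‖e‖ ^ 2 ≤ inner ℝ (hess lam (β * a ^ 12) D (w + v) e) e := by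
    by_contra hneg
    exact g1 ⟨hD, w, hw, hneg⟩
  refine hnot (oneFullStepSuffices_of_small_grad hR hlam hD hβ0 hβ1 hc ha ha1 hC hG0 hG.ge hA.ge
    hG'.ge ?_ ?_ hw hH (not_lt.1 fun hlt => g2 ⟨hD, w, hball, hlt⟩)
    (not_lt.1 fun hlt => g3 ⟨hD, w, hball, hlt⟩))
  · rw [← le_div_iff₀' hA0]; exact haa.trans h5
  · have h7 := haa.trans h6
    rw [le_div_iff₀ (by positivity)] at h7
    have : 0 < c * β ^ 4 * η := by positivity
    linarith
end

/-! ### The two convergence statements -/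

section
variable {m : ℕ} {p : Vec m → ℝ → ℝ} {R lam : ℝ}

/-- Both alternatives of the nondegeneracy assumption give coercive Hessians. -/
lemma coercive_of_nondegenerate (hp : IsDataDensity p R) (hlam : 0 ≤ lam)
    (hnd : Nondegenerate p lam) : CoerciveSteps p R lam ∧ UniformlyCoercive p R lam := by
  rcases hlam.lt_or_eq with h | rfl
  · exact ⟨coerciveSteps_of_pos h, uniformlyCoercive_of_pos hp h⟩
  · obtain h | ⟨wst, hmin, hpos⟩ := hnd
    · exact absurd h (lt_irrefl _)
    · obtain ⟨y, Z, r, c₀, h⟩ := exists_isSpanning hp hpos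
      exact ⟨coerciveSteps_of_isSpanning hp h hmin, uniformlyCoercive_of_isSpanning hp h hmin⟩

lemma exists_measure_not_oneFullStep_le (hp : IsDataDensity p R) (hlam : 0 ≤ lam)
    (hnd : Nondegenerate p lam) {β c₁ ε : ℝ} (hβ0 : 0 < β) (hβ1 : β < 1) (hc₁ : c₁ < 1 / 2) (K : ℝ)
    (hε : 0 < ε) : ∃ C : ℝ, 0 < C ∧ ∀ η : ℝ, 0 < η → η < 1 →
      ∃ α₀ : ℝ, 0 < α₀ ∧ ∀ (N : ℕ) (α : ℝ), 0 < α → α ≤ α₀ → C ≤ N * (η ^ 2 * α) →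
        (∀ w : Vec m, sampleLaw p N {D | StopTest lam η α D w ∧
          ¬ OneFullStepSuffices lam c₁ η (β * α) D w} ≤ ENNReal.ofReal ε) ∧
        sampleLaw p N {D | ∃ w : Vec m, ‖grad lam α D w‖ ≤ K * α ∧
          ¬ OneFullStepSuffices lam c₁ η (β * α) D w} ≤ ENNReal.ofReal ε := by
  obtain ⟨hcs, huc⟩ := coercive_of_nondegenerate hp hlam hnd
  obtain ⟨C, hC, ha⟩ := exists_measure_stopTest_not_oneFullStep_le hp hlam hcs hβ0 hβ1 hc₁ hε
  refine ⟨max C 1, by positivity, fun η hη hη1 => ?_⟩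
  obtain ⟨α₁, hα₁, ha⟩ := ha η hη hη1
  obtain ⟨α₂, hα₂, hb⟩ := exists_measure_small_grad_not_oneFullStep_le (c₁ := c₁) (K := K)
    hp hlam huc hβ0 hβ1 hε η hη hη1
  exact ⟨min α₁ α₂, by positivity, fun N α hα hαα hN =>
    ⟨ha N α hα (hαα.trans (min_le_left _ _)) ((le_max_left _ _).trans hN),
      hb N α hα (hαα.trans (min_le_right _ _)) ((le_max_right _ _).trans hN)⟩⟩

/-- If the full Newton step suffices, then the guarded method stops after at most one step. -/
lemma OneFullStepSuffices.stopsWithin {N : ℕ} {D : Dataset m N} {c₁ η α smin b : ℝ} {w : Vec m}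
    (h : OneFullStepSuffices lam c₁ η α D w) (hsmin : smin ≤ 1) (hb : 1 ≤ b) :
    StopsWithin lam c₁ smin η α D w b := by
  by_cases hs : StopTest lam η α D w
  · exact ⟨0, by simpa using zero_le_one.trans hb, fun _ => w, rfl, fun i hi => by omega, hs⟩
  · refine ⟨1, by simpa using hb, fun i => if i = 0 then w else w + newtonDir lam α D w,
      if_pos rfl, fun i hi => ?_, by simpa using h.2.1⟩
    obtain rfl : i = 0 := by omega
    refine ⟨h.1, 0, fun i hi => by omega, ?_, by simpa using hsmin, by simp⟩
    simpa using h.2.2 hs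
end
end SmoothSVM
end

open SmoothSVM
theorem mainTheorem1 {m : ℕ} (p : Vec m → ℝ → ℝ) (R : ℝ) (hp : IsDataDensity p R)
    (lam : ℝ) (hlam : 0 ≤ lam) (hnd : Nondegenerate p lam)
    (β : ℝ) (hβ0 : 0 < β) (hβ1 : β < 1)
    (c₁ : ℝ) (hc0 : 0 < c₁) (hc1 : c₁ < 1 / 2)
    (smin : ℝ) (hs0 : 0 < smin) (hs1 : smin ≤ 1) (K : ℝ) :
    -- `O(1 + log log (1/α))` guarded Newton steps, for fixed `η`, if `1 ≫ α ≫ 1/N`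
    (∀ η : ℝ, 0 < η → η < 1 → ∀ ε : ℝ, 0 < ε →
      ∃ C : ℝ, 0 < C ∧ ∀ (N : ℕ) (α : ℝ), 0 < α → α ≤ 1 / C → C ≤ N * α →
        (∀ w : Vec m, sampleLaw p N {D | StopTest lam η α D w ∧
          ¬ StopsWithin lam c₁ smin η (β * α) D w (C * (1 + Real.log (Real.log (1 / α))))}
            ≤ ENNReal.ofReal ε) ∧
        sampleLaw p N {D | ∃ w : Vec m, ‖grad lam α D w‖ ≤ K * α ∧
          ¬ StopsWithin lam c₁ smin η (β * α) D w (C * (1 + Real.log (Real.log (1 / α))))}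
            ≤ ENNReal.ofReal ε) ∧
    -- one full Newton step, if in addition `η² α ≫ 1/N`
    (∀ ε : ℝ, 0 < ε → ∃ C : ℝ, 0 < C ∧ ∀ η : ℝ, 0 < η → η < 1 →
      ∃ α₀ : ℝ, 0 < α₀ ∧ ∀ (N : ℕ) (α : ℝ), 0 < α → α ≤ α₀ → C ≤ N * (η ^ 2 * α) →
        (∀ w : Vec m, sampleLaw p N {D | StopTest lam η α D w ∧
          ¬ OneFullStepSuffices lam c₁ η (β * α) D w} ≤ ENNReal.ofReal ε) ∧
        sampleLaw p N {D | ∃ w : Vec m, ‖grad lam α D w‖ ≤ K * α ∧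
          ¬ OneFullStepSuffices lam c₁ η (β * α) D w} ≤ ENNReal.ofReal ε) := by
  refine ⟨fun η hη hη1 ε hε => ?_,
    fun ε hε => exists_measure_not_oneFullStep_le hp hlam hnd hβ0 hβ1 hc1 K hε⟩
  obtain ⟨C₂, hC₂, h⟩ := exists_measure_not_oneFullStep_le hp hlam hnd hβ0 hβ1 hc1 K hε
  obtain ⟨α₀, hα₀, h⟩ := h η hη hη1
  have k1 : 0 ≤ C₂ / η ^ 2 := by positivity
  have k2 : 0 ≤ 1 / α₀ := by positivity
  refine ⟨3 + C₂ / η ^ 2 + 1 / α₀, by positivity, fun N α hα hαC hN => ?_⟩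
  have h1 : 3 + C₂ / η ^ 2 + 1 / α₀ ≤ 1 / α := by
    rwa [le_one_div (by positivity) hα]
  have h2 : α ≤ α₀ := (one_div_le_one_div hα₀ hα).1 (by linarith)
  have h3 : C₂ ≤ N * (η ^ 2 * α) := by
    have : C₂ / η ^ 2 ≤ N * α := by linarith
    rw [div_le_iff₀ (by positivity)] at this
    linarith
  -- the logarithms are nonnegative because `1 / α ≥ 3 > e`
  have h4 : 0 ≤ Real.log (Real.log (1 / α)) := by
    refine Real.log_nonneg ?_
    rw [Real.le_log_iff_exp_le (by positivity)]
    linarith [Real.exp_one_lt_d9]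
  have h5 : 1 ≤ (3 + C₂ / η ^ 2 + 1 / α₀) * (1 + Real.log (Real.log (1 / α))) := by nlinarith
  obtain ⟨ha, hb⟩ := h N α hα h2 h3
  refine ⟨fun w => (measure_mono ?_).trans (ha w), (measure_mono ?_).trans hb⟩
  · rintro D ⟨htest, hnot⟩
    exact ⟨htest, fun hone => hnot (hone.stopsWithin hs1 h5)⟩
  · rintro D ⟨w, hw, hnot⟩
    exact ⟨w, hw, fun hone => hnot (hone.stopsWithin hs1 h5)⟩
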